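/- **Setting.** Let $N\in\{2,3,4\}$ and $Y=6-N$. Let $\mathcal T,\mathcal T'\subset\mathbb R^3$ be non-degenerate tetrahedra with vertices $V_1,\dots,V_4$ and $V_1',\dots,V_4'$ and volumes $\mathcal V,\mathcal V'$, with $V_i=V_i'$ for $i\le N$. Let $P(x,x')$ be a polynomial with complex coefficients in the cartesian components of $x,x'$, and $K:(0,\infty)\to\mathbb C$ a kernel. For $\xi,u\in\mathbb R^3$ put $$x(\xi)=V_1+\sum_{i=1}^3\xi_i(V_{i+1}-V_i),\quad x'(\eta)=V_1'+\sum_{i=1}^3\eta_i(V'_{i+1}-V'_i),\quad r(\xi,u)=|x(\xi)-x'(\xi+u)|,\quad P(\xi,u)=P\big(x(\xi),x'(\xi+u)\big).$$ **Tabulated data.** For $d=1,\dots,18$ the following table gives a number $j_d(s,t)$, a vector $a_d(s,t)\in\mathbb R^3$ and affine functions $L_{id},U_{id}$ of $u$. $$\begin{array}{c|cc|cccccc} d & j_d & a_d & L_{3d}&U_{3d}&L_{2d}&U_{2d}&L_{1d}&U_{1d}\\\hline 1 & s & (st,\ s,\ 1) & 0 & -u_3 & u_3-u_2 & -u_2 &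 u_2-u_1 & -u_1 \\ 2 & 1 & (s,\ 1,\ t) & 0 & -u_2 & 0 & -u_2 & u_2-u_1 & -u_1 \\ 3 & s & (st,\ s,\ -(1-s)) & -u_3 & -u_2 & 0 & -u_2 & u_2-u_1 & -u_1 \\ 4 & s & (s,\ st,\ 1-s+st) & 0 & u_2-u_1-u_3 & u_3-u_2 & -u_1 & 0 & -u_1 \\ 5 & s & (1,\ s,\ st) & 0 & -u_1 & 0 & -u_1 & 0 & -u_1 \\ 6 & s & (s,\ st,\ -(1-s)) & -u_3 & -u_1 & 0 & -u_1 & 0 & -u_1 \\ 7 & s & (st,\ -s(1-t),\ 1-s) & 0 & u_2-u_1-u_3 & u_3-u_2 & -u_1 & 0 & -u_1 \\ 8 & s & (1-s,\ -s,\ -st) & -u_3 & u_2-u_1-u_3 & u_3-u_2 & -u_1 & 0 & -u_1 \\ 9 & s & (s(1-t),\ -st,\ -(1-s+st)) & -u_3 & -u_1 & 0 & -u_1 & 0 & -u_1 \\ 10 & s & (-st,\ s(1-t),\ 1-st) & 0 & u_1-u_3 & u_3-u_2 & u_1-u_2 & u_2-u_1 & 0 \\ 11 & s & (-st,\ 1-st,\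 s(1-t)) & 0 & u_1-u_2 & 0 & u_1-u_2 & u_2-u_1 & 0 \\ 12 & s & (-st,\ s(1-t),\ -(1-s)) & -u_3 & u_1-u_2 & 0 & u_1-u_2 & u_2-u_1 & 0 \\ 13 & s & (-s,\ -st,\ 1-s) & 0 & u_1-u_3 & u_3-u_2 & u_1-u_2 & u_2-u_1 & 0 \\ 14 & s & (-1,\ -s,\ -st) & -u_3 & u_1-u_3 & u_3-u_2 & u_1-u_2 & u_2-u_1 & 0 \\ 15 & s & (-s,\ -st,\ -(1-s+st)) & -u_3 & u_1-u_2 & 0 & u_1-u_2 & u_2-u_1 & 0 \\ 16 & s & (-st,\ -s,\ 1-s) & 0 & u_2-u_3 & u_3-u_2 & 0 & 0 & 0 \\ 17 & 1 & (-s,\ -1,\ -(1-t)) & -u_3 & u_2-u_3 & u_3-u_2 & 0 & 0 & 0 \\ 18 & s & (-st,\ -s,\ -1) & -u_3 & 0 & 0 & 0 & 0 & 0 \\ \end{array}$$ The Duffy transformations are $u_d(w,y)=w\,\hat u_d(y)$, $\xi_d(w,y)=w\,\hat\xi_d(y)$ with $w\in[0,1]$, $y\in[0,1]^Y$, where $\hat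 u_d,\hat\xi_d$ and $\mathcal J_d$ are as follows. - $N=4$: $\hat u_d=a_d(y_1,y_2)$ and $\mathcal J_d=j_d(y_1,y_2)$; no component of $\xi$ is transformed. - $N=3$: with $a=a_d(y_2,y_3)$, $\hat u_d=y_1a$, $\hat\xi_{d,3}=1+U_{3d}(\hat u_d)$, $\mathcal J_d=y_1^2\,j_d(y_2,y_3)$. - $N=2$: with $a=a_d(y_3,y_4)$ (for $d=2$: $a=a_d(y_4,y_3)$), $\hat u_d=y_1y_2a$, $\hat\xi_{d,3}=y_1\big(1+U_{3d}(y_2a)\big)$, $\hat\xi_{d,2}=1+U_{2d}(\hat u_d)$, $\mathcal J_d=y_1^3y_2^2\,j_d(y_3,y_4)$. The components of $\hat\xi_d$ that are not listed are set to $0$. Define $X_d(y)=r\big(\hat\xi_d(y),\hat u_d(y)\big)$, and with $L_{id},U_{id}$ evaluated at $u$, $$\overline P_d(u,\xi)=\begin{cases}\displaystyle\int_{L_{3d}}^{1+U_{3d}}d\xi_3\int_{\xi_3+L_{2d}}^{1+U_{2d}}d\xi_2\int_{\xi_2+L_{1d}}^{1+U_{1d}}d\xi_1\,P(\xi,u)&N=4,\\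 \displaystyle\int_{\xi_3+L_{2d}}^{1+U_{2d}}d\xi_2\int_{\xi_2+L_{1d}}^{1+U_{1d}}d\xi_1\,P(\xi,u)&N=3,\\ \displaystyle\int_{\xi_2+L_{1d}}^{1+U_{1d}}d\xi_1\,P(\xi,u)&N=2.\end{cases}$$ Let $\deg P$ be the total degree ($0$ if $P=0$), let $\mathcal P_{dn}(y)$ be the coefficient of $w^n$ in the Taylor expansion at $w=0$ of $w\mapsto\overline P_d\big(u_d(w,y),\xi_d(w,y)\big)$, let $\mathcal K_p(X)=\int_0^1w^pK(wX)\,dw$, and let $$F(y)=\sum_{d=1}^{18}\mathcal J_d(y)\sum_{n=0}^{\deg P+N-1}\mathcal P_{dn}(y)\,\mathcal K_{n+Y}\big(X_d(y)\big).$$ **Theorem.** 1. Each $\mathcal P_{dn}$ is a polynomial in $y$, and $\overline P_d(u_d(w,y),\xi_d(w,y))=\sum_{n=0}^{\deg P+N-1}\mathcal P_{dn}(y)w^n$ for all real $w$ and $y$. Moreover $r(\xi,u_d(w,y))=w\,X_d(y)$ for all $w\ge0$ and $y$ and every $\xi$ with $\xi_i=w\,\hat\xi_{d,i}(y)$ for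 $N\le i\le 3$ (that is, the $\xi_i$ with $i\le N-1$ are arbitrary). 2. (Reduction formula.) If $K$ is locally integrable on $(0,\infty)$ and $P(x,x')K(|x-x'|)$ is integrable over $\mathcal T\times\mathcal T'$, then $F$ is integrable over $[0,1]^Y$ and $$\int_{\mathcal T}dx\int_{\mathcal T'}dx'\,P(x,x')K(|x-x'|)=36\,\mathcal V\mathcal V'\int_{[0,1]^Y}F(y)\,dy.$$ 3. If $P$ vanishes to order at least $m$ at $x=x'$ (i.e. for all $x,v\in\mathbb R^3$ the polynomial $t\mapsto P(x,x+tv)$ has a zero of order at least $m$ at $t=0$; for $m=1$: $P(x,x)=0$ for all $x$), then $\mathcal P_{dn}=0$ for all $d$ and all $n<m$. 4. If $K$ is continuous on $(0,\infty)$ and $K(r)=O(r^{-q})$ as $r\to0^+$ with $q\in\mathbb R$, then for every integer $p\ge0$ with $p\ge q$ the function $w^pK(wX)$ is integrable over $[0,1]$ for each $X>0$, and $\mathcal K_p$ is continuous on $(0,\infty)$. 5. Suppose that $\mathcal T\cap\mathcal T'$ is exactly the convex hull of $V_1,\dots,V_N$ (for $N=4$ this holds automatically). Then $X_d(y)>0$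 for all $d$ and all $y\in[0,1]^Y$. If moreover $K$ is continuous on $(0,\infty)$, $K(r)=O(r^{-q})$ as $r\to0^+$, $P$ vanishes to order at least $m\ge0$ at $x=x'$, and $q\le Y+m$, then $P(x,x')K(|x-x'|)$ is integrable over $\mathcal T\times\mathcal T'$ (so that the formula in 2 applies) and $F$ is continuous on the closed cube $[0,1]^Y$. In particular (case $m=0$) singularities as strong as $1/r^2$, $1/r^3$, $1/r^4$ are removed for a common tetrahedron, face, edge respectively, and stronger ones if $P$ vanishes at $x=x'$. -/

import Mathlib

open MeasureTheory Set Filter Topology Asymptotics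

noncomputable section

namespace TaylorDuffy

/-- Euclidean three-space. -/
abbrev E3 : Type := EuclideanSpace ℝ (Fin 3)

/-- The three configurations: a common edge, a common face, or a common tetrahedron. -/
inductive CommonCase where
  | edge
  | face
  | tetrahedron

/-- The number `N_CV` of common vertices. -/
def CommonCase.numCV : CommonCase → ℕ
  | .edge => 2
  | .face => 3
  | .tetrahedron => 4

/-- The dimension `Y = 6 - N_CV` of the reduced integral. -/
def CommonCase.dimY (c : CommonCase) : ℕ := 6 - c.numCV

/-- The solid tetrahedron with the given vertices. -/
def tet (V : Fin 4 → E3) : Set E3 := convexHull ℝ (range V)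

/-- The parametrization `x(ξ) = V₁ + ξ₁ (V₂ - V₁) + ξ₂ (V₃ - V₂) + ξ₃ (V₄ - V₃)` of a tetrahedron
by the standard one `1 ≥ ξ₁ ≥ ξ₂ ≥ ξ₃ ≥ 0`. -/
def point (V : Fin 4 → E3) (ξ : Fin 3 → ℝ) : E3 :=
  V 0 + ∑ i : Fin 3, ξ i • (V i.succ - V i.castSucc)

/-- The value `P(x, x')` of a polynomial in the cartesian components of `x` and `x'`. -/
def polyEval (P : MvPolynomial (Fin 3 ⊕ Fin 3) ℂ) (x x' : E3) : ℂ :=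
  MvPolynomial.eval (Sum.elim (fun i => (x i : ℂ)) (fun i => (x' i : ℂ))) P

/-- The integrand `P(x, x') K(|x - x'|)`. -/
def kernelIntegrand (P : MvPolynomial (Fin 3 ⊕ Fin 3) ℂ) (K : ℝ → ℂ) (x x' : E3) : ℂ :=
  polyEval P x x' * K ‖x - x'‖

/-- The distance `r` between `x(ξ)` and `x'(ξ + u)`. -/
def pairDist (V V' : Fin 4 → E3) (ξ u : Fin 3 → ℝ) : ℝ :=
  ‖point V ξ - point V' (ξ + u)‖

/-- Data describing the limits of the `ξ` integrals over a subdomain: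
`L₃ ≤ ξ₃ ≤ 1 + U₃`, `ξ₃ + L₂ ≤ ξ₂ ≤ 1 + U₂`, `ξ₂ + L₁ ≤ ξ₁ ≤ 1 + U₁`. -/
structure XiLimits where
  L₃ : ℝ
  U₃ : ℝ
  L₂ : ℝ
  U₂ : ℝ
  L₁ : ℝ
  U₁ : ℝ

/-- The table of the limits of the `ξ` integrals, as functions of `u`, for the 18 subdomains. -/
def xiLimits (u : Fin 3 → ℝ) : Fin 18 → XiLimits :=
  let u₁ := u 0
  let u₂ := u 1
  let u₃ := u 2
  ![⟨0, -u₃, u₃ - u₂, -u₂, u₂ - u₁, -u₁⟩,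
    ⟨0, -u₂, 0, -u₂, u₂ - u₁, -u₁⟩,
    ⟨-u₃, -u₂, 0, -u₂, u₂ - u₁, -u₁⟩,
    ⟨0, u₂ - u₁ - u₃, u₃ - u₂, -u₁, 0, -u₁⟩,
    ⟨0, -u₁, 0, -u₁, 0, -u₁⟩,
    ⟨-u₃, -u₁, 0, -u₁, 0, -u₁⟩,
    ⟨0, u₂ - u₁ - u₃, u₃ - u₂, -u₁, 0, -u₁⟩,
    ⟨-u₃, u₂ - u₁ - u₃, u₃ - u₂, -u₁, 0, -u₁⟩,
    ⟨-u₃, -u₁, 0, -u₁, 0, -u₁⟩,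
    ⟨0, u₁ - u₃, u₃ - u₂, u₁ - u₂, u₂ - u₁, 0⟩,
    ⟨0, u₁ - u₂, 0, u₁ - u₂, u₂ - u₁, 0⟩,
    ⟨-u₃, u₁ - u₂, 0, u₁ - u₂, u₂ - u₁, 0⟩,
    ⟨0, u₁ - u₃, u₃ - u₂, u₁ - u₂, u₂ - u₁, 0⟩,
    ⟨-u₃, u₁ - u₃, u₃ - u₂, u₁ - u₂, u₂ - u₁, 0⟩,
    ⟨-u₃, u₁ - u₂, 0, u₁ - u₂, u₂ - u₁, 0⟩,
    ⟨0, u₂ - u₃, u₃ - u₂, 0, 0, 0⟩,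
    ⟨-u₃, u₂ - u₃, u₃ - u₂, 0, 0, 0⟩,
    ⟨-u₃, 0, 0, 0, 0, 0⟩]

/-- One row of a table of Duffy transformations: the factor `𝒥_d(y)` of the Jacobian
`w ^ Y * 𝒥_d(y)`, and the vectors `u / w` and `ξ / w` (a component of `ξ` that is not transformed,
being integrated out beforehand, is entered as `0`). -/
@[ext]
structure DuffyRow where
  jac : ℝ
  u : Fin 3 → ℝ
  xi : Fin 3 → ℝ

/-- Duffy transformations for four common vertices. -/
def duffyTet (y : Fin 2 → ℝ) : Fin 18 → DuffyRow :=
  let y₁ := y 0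
  let y₂ := y 1
  ![⟨y₁, ![y₁ * y₂, y₁, 1], ![0, 0, 0]⟩,
    ⟨1, ![y₁, 1, y₂], ![0, 0, 0]⟩,
    ⟨y₁, ![y₁ * y₂, y₁, -(1 - y₁)], ![0, 0, 0]⟩,
    ⟨y₁, ![y₁, y₁ * y₂, 1 - y₁ + y₁ * y₂], ![0, 0, 0]⟩,
    ⟨y₁, ![1, y₁, y₁ * y₂], ![0, 0, 0]⟩,
    ⟨y₁, ![y₁, y₁ * y₂, -(1 - y₁)], ![0, 0, 0]⟩,
    ⟨y₁, ![y₁ * y₂, -y₁ * (1 - y₂), 1 - y₁], ![0, 0, 0]⟩,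
    ⟨y₁, ![1 - y₁, -y₁, -y₁ * y₂], ![0, 0, 0]⟩,
    ⟨y₁, ![y₁ * (1 - y₂), -y₁ * y₂, -(1 - y₁ + y₁ * y₂)], ![0, 0, 0]⟩,
    ⟨y₁, ![-y₁ * y₂, y₁ * (1 - y₂), 1 - y₁ * y₂], ![0, 0, 0]⟩,
    ⟨y₁, ![-y₁ * y₂, 1 - y₁ * y₂, y₁ * (1 - y₂)], ![0, 0, 0]⟩,
    ⟨y₁, ![-y₁ * y₂, y₁ * (1 - y₂), -(1 - y₁)], ![0, 0, 0]⟩,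
    ⟨y₁, ![-y₁, -y₁ * y₂, 1 - y₁], ![0, 0, 0]⟩,
    ⟨y₁, ![-1, -y₁, -y₁ * y₂], ![0, 0, 0]⟩,
    ⟨y₁, ![-y₁, -y₁ * y₂, -(1 - y₁ + y₁ * y₂)], ![0, 0, 0]⟩,
    ⟨y₁, ![-y₁ * y₂, -y₁, 1 - y₁], ![0, 0, 0]⟩,
    ⟨1, ![-y₁, -1, -(1 - y₂)], ![0, 0, 0]⟩,
    ⟨y₁, ![-y₁ * y₂, -y₁, -1], ![0, 0, 0]⟩]

/-- Duffy transformations for three common vertices. -/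
def duffyFace (y : Fin 3 → ℝ) : Fin 18 → DuffyRow :=
  let y₁ := y 0
  let y₂ := y 1
  let y₃ := y 2
  ![⟨y₁ ^ 2 * y₂, ![y₁ * y₂ * y₃, y₁ * y₂, y₁], ![0, 0, 1 - y₁]⟩,
    ⟨y₁ ^ 2, ![y₁ * y₂, y₁, y₁ * y₃], ![0, 0, 1 - y₁]⟩,
    ⟨y₁ ^ 2 * y₂, ![y₁ * y₂ * y₃, y₁ * y₂, -y₁ * (1 - y₂)], ![0, 0, (1 - y₁ * y₂)]⟩,
    ⟨y₁ ^ 2 * y₂, ![y₁ * y₂, y₁ * y₂ * y₃, y₁ * (1 - y₂ + y₂ * y₃)], ![0, 0, 1 - y₁]⟩,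
    ⟨y₁ ^ 2 * y₂, ![y₁, y₁ * y₂, y₁ * y₂ * y₃], ![0, 0, 1 - y₁]⟩,
    ⟨y₁ ^ 2 * y₂, ![y₁ * y₂, y₁ * y₂ * y₃, -y₁ * (1 - y₂)], ![0, 0, (1 - y₁ * y₂)]⟩,
    ⟨y₁ ^ 2 * y₂, ![y₁ * y₂ * y₃, -y₁ * y₂ * (1 - y₃), y₁ * (1 - y₂)], ![0, 0, 1 - y₁]⟩,
    ⟨y₁ ^ 2 * y₂, ![y₁ * (1 - y₂), -y₁ * y₂, -y₁ * y₂ * y₃], ![0, 0, (1 - y₁ + y₁ * y₂ * y₃)]⟩,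
    ⟨y₁ ^ 2 * y₂, ![y₁ * y₂ * (1 - y₃), -y₁ * y₂ * y₃, -y₁ * (1 - y₂ + y₂ * y₃)], ![0, 0, (1 - y₁ * y₂ + y₁ * y₂ * y₃)]⟩,
    ⟨y₁ ^ 2 * y₂, ![-y₁ * y₂ * y₃, y₁ * y₂ * (1 - y₃), y₁ * (1 - y₂ * y₃)], ![0, 0, 1 - y₁]⟩,
    ⟨y₁ ^ 2 * y₂, ![-y₁ * y₂ * y₃, y₁ * (1 - y₂ * y₃), y₁ * y₂ * (1 - y₃)], ![0, 0, 1 - y₁]⟩,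
    ⟨y₁ ^ 2 * y₂, ![-y₁ * y₂ * y₃, y₁ * y₂ * (1 - y₃), -y₁ * (1 - y₂)], ![0, 0, (1 - y₁ * y₂)]⟩,
    ⟨y₁ ^ 2 * y₂, ![-y₁ * y₂, -y₁ * y₂ * y₃, y₁ * (1 - y₂)], ![0, 0, 1 - y₁]⟩,
    ⟨y₁ ^ 2 * y₂, ![-y₁, -y₁ * y₂, -y₁ * y₂ * y₃], ![0, 0, (1 - y₁ + y₁ * y₂ * y₃)]⟩,
    ⟨y₁ ^ 2 * y₂, ![-y₁ * y₂, -y₁ * y₂ * y₃, -y₁ * (1 - y₂ + y₂ * y₃)], ![0, 0, (1 - y₁ * y₂ + y₁ * y₂ * y₃)]⟩,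
    ⟨y₁ ^ 2 * y₂, ![-y₁ * y₂ * y₃, -y₁ * y₂, y₁ * (1 - y₂)], ![0, 0, 1 - y₁]⟩,
    ⟨y₁ ^ 2, ![-y₁ * y₂, -y₁, -y₁ * (1 - y₃)], ![0, 0, (1 - y₁ * y₃)]⟩,
    ⟨y₁ ^ 2 * y₂, ![-y₁ * y₂ * y₃, -y₁ * y₂, -y₁], ![0, 0, 1]⟩]

/-- Duffy transformations for two common vertices. -/
def duffyEdge (y : Fin 4 → ℝ) : Fin 18 → DuffyRow :=
  let y₁ := y 0
  let y₂ := y 1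
  let y₃ := y 2
  let y₄ := y 3
  ![⟨y₁ ^ 3 * y₂ ^ 2 * y₃, ![y₁ * y₂ * y₃ * y₄, y₁ * y₂ * y₃, y₁ * y₂], ![0, (1 - y₁ * y₂ * y₃), y₁ * (1 - y₂)]⟩,
    ⟨y₁ ^ 3 * y₂ ^ 2, ![y₁ * y₂ * y₄, y₁ * y₂, y₁ * y₂ * y₃], ![0, (1 - y₁ * y₂), y₁ * (1 - y₂)]⟩,
    ⟨y₁ ^ 3 * y₂ ^ 2 * y₃, ![y₁ * y₂ * y₃ * y₄, y₁ * y₂ * y₃, -y₁ * y₂ * (1 - y₃)], ![0, (1 - y₁ * y₂ * y₃), y₁ * (1 - y₂ * y₃)]⟩,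
    ⟨y₁ ^ 3 * y₂ ^ 2 * y₃, ![y₁ * y₂ * y₃, y₁ * y₂ * y₃ * y₄, y₁ * y₂ * (1 - y₃ + y₃ * y₄)], ![0, (1 - y₁ * y₂ * y₃), y₁ * (1 - y₂)]⟩,
    ⟨y₁ ^ 3 * y₂ ^ 2 * y₃, ![y₁ * y₂, y₁ * y₂ * y₃, y₁ * y₂ * y₃ * y₄], ![0, (1 - y₁ * y₂), y₁ * (1 - y₂)]⟩,
    ⟨y₁ ^ 3 * y₂ ^ 2 * y₃, ![y₁ * y₂ * y₃, y₁ * y₂ * y₃ * y₄, -y₁ * y₂ * (1 - y₃)], ![0, (1 - y₁ * y₂ * y₃), y₁ * (1 - y₂ * y₃)]⟩,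
    ⟨y₁ ^ 3 * y₂ ^ 2 * y₃, ![y₁ * y₂ * y₃ * y₄, -y₁ * y₂ * y₃ * (1 - y₄), y₁ * y₂ * (1 - y₃)], ![0, (1 - y₁ * y₂ * y₃ * y₄), y₁ * (1 - y₂)]⟩,
    ⟨y₁ ^ 3 * y₂ ^ 2 * y₃, ![y₁ * y₂ * (1 - y₃), -y₁ * y₂ * y₃, -y₁ * y₂ * y₃ * y₄], ![0, (1 - y₁ * y₂ + y₁ * y₂ * y₃), y₁ * (1 - y₂ + y₂ * y₃ * y₄)]⟩,
    ⟨y₁ ^ 3 * y₂ ^ 2 * y₃, ![y₁ * y₂ * y₃ * (1 - y₄), -y₁ * y₂ * y₃ * y₄, -y₁ * y₂ * (1 - y₃ + y₃ * y₄)], ![0, (1 - y₁ * y₂ * y₃ + y₁ * y₂ * y₃ * y₄), y₁ * (1 - y₂ * y₃ + y₂ * y₃ * y₄)]⟩,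
    ⟨y₁ ^ 3 * y₂ ^ 2 * y₃, ![-y₁ * y₂ * y₃ * y₄, y₁ * y₂ * y₃ * (1 - y₄), y₁ * y₂ * (1 - y₃ * y₄)], ![0, (1 - y₁ * y₂ * y₃), y₁ * (1 - y₂)]⟩,
    ⟨y₁ ^ 3 * y₂ ^ 2 * y₃, ![-y₁ * y₂ * y₃ * y₄, y₁ * y₂ * (1 - y₃ * y₄), y₁ * y₂ * y₃ * (1 - y₄)], ![0, (1 - y₁ * y₂), y₁ * (1 - y₂)]⟩,
    ⟨y₁ ^ 3 * y₂ ^ 2 * y₃, ![-y₁ * y₂ * y₃ * y₄, y₁ * y₂ * y₃ * (1 - y₄), -y₁ * y₂ * (1 - y₃)], ![0, (1 - y₁ * y₂ * y₃), y₁ * (1 - y₂ * y₃)]⟩,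
    ⟨y₁ ^ 3 * y₂ ^ 2 * y₃, ![-y₁ * y₂ * y₃, -y₁ * y₂ * y₃ * y₄, y₁ * y₂ * (1 - y₃)], ![0, (1 - y₁ * y₂ * y₃ + y₁ * y₂ * y₃ * y₄), y₁ * (1 - y₂)]⟩,
    ⟨y₁ ^ 3 * y₂ ^ 2 * y₃, ![-y₁ * y₂, -y₁ * y₂ * y₃, -y₁ * y₂ * y₃ * y₄], ![0, (1 - y₁ * y₂ + y₁ * y₂ * y₃), y₁ * (1 - y₂ + y₂ * y₃ * y₄)]⟩,
    ⟨y₁ ^ 3 * y₂ ^ 2 * y₃, ![-y₁ * y₂ * y₃, -y₁ * y₂ * y₃ * y₄, -y₁ * y₂ * (1 - y₃ + y₃ * y₄)], ![0, (1 - y₁ * y₂ * y₃ + y₁ * y₂ * y₃ * y₄), y₁ * (1 - y₂ * y₃ + y₂ * y₃ * y₄)]⟩,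
    ⟨y₁ ^ 3 * y₂ ^ 2 * y₃, ![-y₁ * y₂ * y₃ * y₄, -y₁ * y₂ * y₃, y₁ * y₂ * (1 - y₃)], ![0, 1, y₁ * (1 - y₂)]⟩,
    ⟨y₁ ^ 3 * y₂ ^ 2, ![-y₁ * y₂ * y₃, -y₁ * y₂, -y₁ * y₂ * (1 - y₄)], ![0, 1, y₁ * (1 - y₂ * y₄)]⟩,
    ⟨y₁ ^ 3 * y₂ ^ 2 * y₃, ![-y₁ * y₂ * y₃ * y₄, -y₁ * y₂ * y₃, -y₁ * y₂], ![0, 1, y₁]⟩]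

/-- The table for three common vertices in terms of the one for four:
`u/w = y₁ a`, `ξ₃/w = 1 + U₃(u/w)` and `𝒥 = y₁² 𝒥⁰`, where `a` and `𝒥⁰` are the entries
of the latter at `(y₂, y₃)`. -/
theorem duffyFace_eq (y : Fin 3 → ℝ) (d : Fin 18) :
    duffyFace y d =
      (let R := duffyTet ![y 1, y 2] d
       let v := y 0 • R.u
       ⟨y 0 ^ 2 * R.jac, v, ![0, 0, 1 + (xiLimits v d).U₃]⟩) := by
  fin_cases d <;> refine DuffyRow.ext ?_ ?_ ?_ <;>
    first
    | (ext i; fin_cases i <;>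
        simp [duffyFace, duffyTet, xiLimits, -mul_eq_mul_left_iff, -mul_eq_mul_right_iff] <;> ring)
    | (simp [duffyFace, duffyTet, -mul_eq_mul_left_iff])

/-- The table for two common vertices in terms of the one for four:
`u/w = y₁ y₂ a`, `ξ₃/w = y₁ (1 + U₃(y₂ a))`, `ξ₂/w = 1 + U₂(u/w)` and `𝒥 = y₁³ y₂² 𝒥⁰`, where
`a` and `𝒥⁰` are the entries of the latter at `(y₃, y₄)`, except that in the second row they are
taken at `(y₄, y₃)`. -/
theorem duffyEdge_eq (y : Fin 4 → ℝ) (d : Fin 18) :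
    duffyEdge y d =
      (let R := duffyTet (if d = 1 then ![y 3, y 2] else ![y 2, y 3]) d
       let v := (y 0 * y 1) • R.u
       ⟨y 0 ^ 3 * y 1 ^ 2 * R.jac, v,
        ![0, 1 + (xiLimits v d).U₂, y 0 * (1 + (xiLimits (y 1 • R.u) d).U₃)]⟩) := by
  fin_cases d <;> refine DuffyRow.ext ?_ ?_ ?_ <;>
    first
    | (ext i; fin_cases i <;>
        simp [duffyEdge, duffyTet, xiLimits, -mul_eq_mul_left_iff, -mul_eq_mul_right_iff] <;> ring)
    | (simp [duffyEdge, duffyTet, -mul_eq_mul_left_iff])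

/-- The Duffy transformations in all three cases:
`u = w • (duffy c d y).u` and `ξ = w • (duffy c d y).xi`. -/
def duffy (c : CommonCase) (d : Fin 18) (y : Fin c.dimY → ℝ) : DuffyRow :=
  match c, y with
  | .edge, y => duffyEdge y d
  | .face, y => duffyFace y d
  | .tetrahedron, y => duffyTet y d

/-- The components of `ξ` on which the distance depends: `ξ₂, ξ₃` for a common edge, `ξ₃` for a
common face, none for a common tetrahedron (indices are counted from `0` here). -/
def kept (c : CommonCase) : Set (Fin 3) := {i | c.numCV ≤ (i : ℕ) + 1}

/-- The polynomial `P` in the variables `(ξ, u)`. -/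
def polyXi (P : MvPolynomial (Fin 3 ⊕ Fin 3) ℂ) (V V' : Fin 4 → E3) (ξ u : Fin 3 → ℝ) : ℂ :=
  polyEval P (point V ξ) (point V' (ξ + u))

/-- The polynomial `P̄_d(u, ξ)`: the integral of `P` over the components of `ξ` on which the
distance does not depend, over the `d`-th subdomain. -/
def pbar (c : CommonCase) (P : MvPolynomial (Fin 3 ⊕ Fin 3) ℂ) (V V' : Fin 4 → E3) (d : Fin 18)
    (u ξ : Fin 3 → ℝ) : ℂ :=
  let l := xiLimits u d
  match c with
  | .edge =>
      ∫ s₁ in (ξ 1 + l.L₁)..(1 + l.U₁), polyXi P V V' ![s₁, ξ 1, ξ 2] u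
  | .face =>
      ∫ s₂ in (ξ 2 + l.L₂)..(1 + l.U₂), ∫ s₁ in (s₂ + l.L₁)..(1 + l.U₁),
        polyXi P V V' ![s₁, s₂, ξ 2] u
  | .tetrahedron =>
      ∫ s₃ in l.L₃..(1 + l.U₃), ∫ s₂ in (s₃ + l.L₂)..(1 + l.U₂),
        ∫ s₁ in (s₂ + l.L₁)..(1 + l.U₁), polyXi P V V' ![s₁, s₂, s₃] u

/-- `P̄_d` after the Duffy transformation, as a function of `(w, y)`. -/
def pbarDuffy (c : CommonCase) (P : MvPolynomial (Fin 3 ⊕ Fin 3) ℂ) (V V' : Fin 4 → E3)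
    (d : Fin 18) (y : Fin c.dimY → ℝ) (w : ℝ) : ℂ :=
  pbar c P V V' d (w • (duffy c d y).u) (w • (duffy c d y).xi)

/-- `𝒫_{dn}(y)`, the coefficient of `w ^ n` in the expansion of `P̄_d` in powers of `w`. -/
def pcoeff (c : CommonCase) (P : MvPolynomial (Fin 3 ⊕ Fin 3) ℂ) (V V' : Fin 4 → E3)
    (d : Fin 18) (n : ℕ) (y : Fin c.dimY → ℝ) : ℂ :=
  iteratedDeriv n (pbarDuffy c P V V' d y) 0 / (n.factorial : ℂ)

/-- `X_d(y)`, the distance at `w = 1`. -/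
def xdist (c : CommonCase) (V V' : Fin 4 → E3) (d : Fin 18) (y : Fin c.dimY → ℝ) : ℝ :=
  pairDist V V' (duffy c d y).xi (duffy c d y).u

/-- The first integral `𝒦_p(X) = ∫₀¹ w ^ p K(w X) dw` of the kernel. -/
def firstIntegral (K : ℝ → ℂ) (p : ℕ) (X : ℝ) : ℂ :=
  ∫ w in (0 : ℝ)..1, ((w ^ p : ℝ) : ℂ) * K (w * X)

/-- The number of powers of `w` that can occur: the degree of `P̄_d` in `w` is at most
`deg P + N_CV - 1`. -/
def numTerms (c : CommonCase) (P : MvPolynomial (Fin 3 ⊕ Fin 3) ℂ) : ℕ :=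
  P.totalDegree + c.numCV

/-- The integrand `∑_d 𝒥_d(y) ∑_n 𝒫_{dn}(y) 𝒦_{n+Y}(X_d(y))` of the reduced integral. -/
def reducedIntegrand (c : CommonCase) (P : MvPolynomial (Fin 3 ⊕ Fin 3) ℂ) (K : ℝ → ℂ)
    (V V' : Fin 4 → E3) (y : Fin c.dimY → ℝ) : ℂ :=
  ∑ d : Fin 18, ((duffy c d y).jac : ℂ) *
    ∑ n ∈ Finset.range (numTerms c P),
      pcoeff c P V V' d n y * firstIntegral K (n + c.dimY) (xdist c V V' d y)

/-- `P` vanishes to order (at least) `m` at `x = x'`: for all `x` and `v`, the polynomial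
`t ↦ P(x, x + t v)` has a zero of order at least `m` at `t = 0`. For `m = 1` this says that
`P(x, x) = 0` for all `x`, and for `m = 0` it says nothing. -/
def VanishesOnDiagonal (P : MvPolynomial (Fin 3 ⊕ Fin 3) ℂ) (m : ℕ) : Prop :=
  ∀ (x v : E3) (k : ℕ), k < m → iteratedDeriv k (fun t : ℝ => polyEval P x (x + t • v)) 0 = 0

/-- The two tetrahedra meet only in the simplex spanned by their common vertices. -/
def MeetInCommonSimplex (c : CommonCase) (V V' : Fin 4 → E3) : Prop :=
  tet V ∩ tet V' = convexHull ℝ (V '' {i | (i : ℕ) < c.numCV})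

end TaylorDuffy

end

open TaylorDuffy

/-! Both tetrahedra are affine images of the simplex `1 ≥ ξ₁ ≥ ξ₂ ≥ ξ₃ ≥ 0` of volume `1/6`, which
accounts for the factor `36 𝒱 𝒱'` (`integral_tet_prod`). With `u` the difference of the two
coordinate vectors, `ξ` and `ξ + u` both lie in the simplex iff `ξ₁ ≤ 1 + min (0, -u₁)`, `ξ₁ - ξ₂ ≥
max (0, u₂ - u₁)`, `ξ₂ - ξ₃ ≥ max (0, u₃ - u₂)` and `ξ₃ ≥ max (0, -u₃)`. Placing `0` relative to
`u₁`, then `u₂` relative to `0, u₁`, then `u₃` relative to `0, u₂` leaves `2 · 3 · 3 = 18` cones of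
`u`, and on each of them these extrema are linear: they are the table of limits. The shift `α_i =
ξ_i - U_i` turns the slice over `u` into `1 ≥ α₁ ≥ α₂ ≥ α₃ ≥ β₁` with `β₁ = L₃ - U₃`, and a
unimodular map parametrizes the cone by a chain of inequalities in `β`. Up to null sets the product
of two simplices is therefore a disjoint union of 18 cells in volume-preserving coordinates `(β, α)`
(`integral_simplex_prod`).

Successive ratios map such a chain onto a cube, with a triangular Jacobian matrix
(`integral_triangular`). The parameters that determine the distance, namely `β` and the `α_i` of the
kept components, are listed first and in decreasing order, so that the first cube coordinate `w` is
a factor of all of them. This reproduces the tabulated transformations and the Jacobian `w ^ Y 𝒥_d`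
(`coneVec_arrange`, `duffyCell_kept`, `duffyCellJac_eq`). Edges shared by the tetrahedra cancel in
`x - x'`, which leaves a linear function of the kept quantities; hence `r = w X_d(y)`
(`pairDist_smul`). Integration over the remaining `α_i` gives `P̄_d` (`integral_cube_cellPoly`), a
polynomial in `w` whose degree grows by one with each integration (`pbarDuffy_eq_sum`), and the
integral over `w` gives the first integrals of `K`. Splitting that integral into powers of `w`
requires each term to be integrable; the lowest power present controls the others near `w = 0`
(`integrable_terms`).

If `P` vanishes to order `m` on the diagonal, then `P̄_d = O(w ^ m)`, because the separation is
proportional to `w`, and the lower coefficients vanish (`pcoeff_eq_zero`). At `w = 1` the number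
`X_d(y)` is the distance of two actual points of the tetrahedra; if it were `0` the point would lie
in the common simplex, which is impossible when some kept `α_i` or `β₁` equals `1` (`xdist_pos`).
Compactness then bounds `w` by a multiple of `r`, so the Jacobian and `P` together compensate a
singularity of degree `Y + m`. -/

namespace TaylorDuffy

/-! ### Polynomials in `w` with coefficients in an algebra of functions. -/

/-- Evaluation of the members of an algebra of functions at a point. -/
def evalAt {X : Type*} (A : Subalgebra ℂ (X → ℂ)) (x : X) : A →ₐ[ℂ] ℂ :=
  (Pi.evalAlgHom ℂ (fun _ : X => ℂ) x).comp A.val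

@[simp] lemma evalAt_apply {X : Type*} (A : Subalgebra ℂ (X → ℂ)) (x : X) (a : A) :
    evalAt A x a = (a : X → ℂ) x := rfl

/-- `f x w` is a polynomial in `w` of degree at most `n`, with coefficients in an algebra `A` of
functions of `x`. -/
def PolyIn {X : Type*} (A : Subalgebra ℂ (X → ℂ)) (n : ℕ) (f : X → ℝ → ℂ) : Prop :=
  ∃ p : Polynomial A, p.natDegree ≤ n ∧
    ∀ x (w : ℝ), f x w = p.eval₂ (evalAt A x : A →+* ℂ) (w : ℂ)

namespace PolyIn

variable {X : Type*} {A : Subalgebra ℂ (X → ℂ)} {n m : ℕ} {f g : X → ℝ → ℂ}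

lemma mono (hf : PolyIn A n f) (h : n ≤ m) : PolyIn A m f :=
  let ⟨p, hp, e⟩ := hf
  ⟨p, hp.trans h, e⟩

lemma add (hf : PolyIn A n f) (hg : PolyIn A n g) : PolyIn A n (fun x w => f x w + g x w) := by
  obtain ⟨p, hp, e⟩ := hf
  obtain ⟨q, hq, e'⟩ := hg
  refine ⟨p + q, (Polynomial.natDegree_add_le _ _).trans (max_le hp hq), fun x w => ?_⟩
  simp only [Polynomial.eval₂_add, e, e']

lemma mul (hf : PolyIn A n f) (hg : PolyIn A m g) :
    PolyIn A (n + m) (fun x w => f x w * g x w) := by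
  obtain ⟨p, hp, e⟩ := hf
  obtain ⟨q, hq, e'⟩ := hg
  refine ⟨p * q, Polynomial.natDegree_mul_le.trans (add_le_add hp hq), fun x w => ?_⟩
  simp only [Polynomial.eval₂_mul, e, e']

lemma coeff {a : X → ℂ} (ha : a ∈ A) : PolyIn A n (fun x _ => a x) :=
  ⟨Polynomial.C ⟨a, ha⟩, (Polynomial.natDegree_C _).le.trans n.zero_le, fun x w => by
    rw [Polynomial.eval₂_C]; rfl⟩

lemma const (c : ℂ) : PolyIn A n (fun _ _ => c) :=
  coeff (A.algebraMap_mem c)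

lemma linear {a : X → ℂ} (ha : a ∈ A) : PolyIn A 1 (fun x w => w * a x) :=
  ⟨Polynomial.C ⟨a, ha⟩ * Polynomial.X, by
    simpa only [pow_one] using Polynomial.natDegree_C_mul_X_pow_le (⟨a, ha⟩ : A) 1, fun x w => by
    rw [Polynomial.eval₂_mul, Polynomial.eval₂_C, Polynomial.eval₂_X, mul_comm]; rfl⟩

lemma neg (hf : PolyIn A n f) : PolyIn A n (fun x w => -f x w) := by
  simpa using (const (n := 0) (-1)).mul hf

lemma sub (hf : PolyIn A n f) (hg : PolyIn A n g) : PolyIn A n (fun x w => f x w - g x w) := by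
  simpa [sub_eq_add_neg] using hf.add hg.neg

/-- Substitution of affine functions into a polynomial. -/
lemma mvPolynomial_eval {σ : Type*} (P : MvPolynomial σ ℂ) {z : σ → X → ℝ → ℂ}
    (hz : ∀ i, PolyIn A 1 (z i)) :
    PolyIn A P.totalDegree (fun x w => MvPolynomial.eval (fun i => z i x w) P) := by
  -- The polynomials `p i` of degree at most one are substituted into `P` over `A[w]`; evaluation at
  -- `(x, w)` is a ring homomorphism and commutes with the substitution.
  choose p hp e using hz
  refine ⟨MvPolynomial.aeval p (MvPolynomial.map (algebraMap ℂ A) P), ?_, fun x w => ?_⟩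
  · have h := MvPolynomial.aeval_natDegree_le (MvPolynomial.map (algebraMap ℂ A) P)
      (m := P.totalDegree) (Finset.sup_mono (MvPolynomial.support_map_subset _ _)) p hp
    simpa using h
  · have : (Polynomial.eval₂RingHom (evalAt A x : A →+* ℂ) (w : ℂ))
        (MvPolynomial.aeval p (MvPolynomial.map (algebraMap ℂ A) P)) =
        MvPolynomial.eval (fun i => z i x w) P := by
      rw [MvPolynomial.aeval_def, MvPolynomial.eval₂_map, MvPolynomial.hom_eval₂]
      rw [← MvPolynomial.eval₂_id]
      congr 1
      · ext c
        simp
      · funext i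
        simp [e]
    exact this.symm

lemma eq_sum (hf : PolyIn A n f) : ∃ q : ℕ → X → ℂ, (∀ k, q k ∈ A) ∧ (∀ k, n < k → q k = 0) ∧
    ∀ x (w : ℝ), f x w = ∑ k ∈ Finset.range (n + 1), q k x * (w : ℂ) ^ k := by
  obtain ⟨p, hp, e⟩ := hf
  refine ⟨fun k => p.coeff k, fun k => (p.coeff k).2, fun k hk => ?_, fun x w => ?_⟩
  · beta_reduce
    rw [Polynomial.coeff_eq_zero_of_natDegree_lt (hp.trans_lt hk)]
    rfl
  · rw [e, Polynomial.eval₂_eq_sum_range' _ (Nat.lt_succ_of_le hp)]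
    rfl

lemma of_sum (N : ℕ) {q : ℕ → X → ℂ} (hq : ∀ k, q k ∈ A)
    (h : ∀ x (w : ℝ), f x w = ∑ k ∈ Finset.range (N + 1), q k x * (w : ℂ) ^ k) : PolyIn A N f := by
  refine ⟨∑ k ∈ Finset.range (N + 1), Polynomial.C ⟨q k, hq k⟩ * Polynomial.X ^ k, ?_, ?_⟩
  · refine Polynomial.natDegree_sum_le_of_forall_le _ _ fun k hk => ?_
    exact (Polynomial.natDegree_C_mul_X_pow_le _ _).trans (by simpa [Nat.lt_succ_iff] using hk)
  · intro x w
    rw [h, Polynomial.eval₂_finsetSum]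
    simp [Polynomial.eval₂_mul, Polynomial.eval₂_pow]

end PolyIn

/-! ### Integration over a parameter. -/

/-- The functions of `(x, τ)` which are polynomials in `τ` with coefficients in `A`. -/
def polyExt {X : Type*} (A : Subalgebra ℂ (X → ℂ)) : Subalgebra ℂ (X × ℝ → ℂ) where
  carrier := {f | ∃ n, PolyIn A n (fun x τ => f (x, τ))}
  mul_mem' := fun ⟨_, h⟩ ⟨_, h'⟩ => ⟨_, h.mul h'⟩
  add_mem' := fun ⟨n, h⟩ ⟨m, h'⟩ =>
    ⟨max n m, (h.mono (le_max_left _ _)).add (h'.mono (le_max_right _ _))⟩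
  algebraMap_mem' c := ⟨0, PolyIn.const c⟩

namespace PolyIn

variable {X : Type*} {A : Subalgebra ℂ (X → ℂ)} {n : ℕ}

/-- The integral of `τ ^ k` over the unit interval is the scalar `1 / (k + 1)`, so the result is a
linear combination of the coefficients in `A`. -/
lemma integral_mem {f : X × ℝ → ℂ} (hf : f ∈ polyExt A) :
    (fun x => ∫ τ in (0 : ℝ)..1, f (x, τ)) ∈ A := by
  obtain ⟨N, hN⟩ := hf
  obtain ⟨q, hq, -, e⟩ := hN.eq_sum
  have : (fun x => ∫ τ in (0 : ℝ)..1, f (x, τ)) =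
      ∑ k ∈ Finset.range (N + 1), (1 / ((k : ℂ) + 1)) • q k := by
    funext x
    simp only [e, Finset.sum_apply, Pi.smul_apply, smul_eq_mul]
    rw [intervalIntegral.integral_finsetSum]
    · refine Finset.sum_congr rfl fun k _ => ?_
      rw [intervalIntegral.integral_const_mul]
      have : ∫ τ in (0 : ℝ)..1, ((τ : ℂ)) ^ k = 1 / ((k : ℂ) + 1) := by
        have := integral_pow (a := 0) (b := 1) k
        have h2 : ∫ τ in (0 : ℝ)..1, ((τ : ℂ)) ^ k = ((∫ τ in (0 : ℝ)..1, τ ^ k : ℝ) : ℂ) := by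
          rw [← intervalIntegral.integral_ofReal]
          simp
        rw [h2, this]
        simp
      rw [this, mul_comm]
    · intro k _
      exact Continuous.intervalIntegrable (by fun_prop) _ _
  rw [this]
  exact A.sum_mem fun k _ => A.smul_mem (hq k) _

lemma integral_unit {f : X × ℝ → ℝ → ℂ} (hf : PolyIn (polyExt A) n f) :
    PolyIn A n (fun x w => ∫ τ in (0 : ℝ)..1, f (x, τ) w) := by
  obtain ⟨q, hq, -, e⟩ := hf.eq_sum
  refine of_sum n (fun k => integral_mem (hq k)) fun x w => ?_
  simp only [e]
  rw [intervalIntegral.integral_finsetSum]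
  · simp only [intervalIntegral.integral_mul_const]
  · intro k _
    obtain ⟨N, hN⟩ := hq k
    obtain ⟨r, -, -, e'⟩ := hN.eq_sum
    simp only [e']
    exact Continuous.intervalIntegrable (by fun_prop) _ _

lemma lift {f : X → ℝ → ℂ} (hf : PolyIn A n f) : PolyIn (polyExt A) n (fun z => f z.1) := by
  obtain ⟨q, hq, -, e⟩ := hf.eq_sum
  exact of_sum n (q := fun k z => q k z.1) (fun k => ⟨0, coeff (hq k)⟩) fun x w => e _ _

lemma snd : PolyIn (polyExt A) n (fun z _ => (z.2 : ℂ)) := by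
  refine coeff ⟨1, ?_⟩
  simpa using linear (X := X) (A := A) (a := fun _ => 1) A.one_mem

/-- Integration between affine limits raises the degree by at most one. -/
lemma integral {h : X → ℝ → ℝ → ℂ} {a b : X → ℝ → ℝ}
    (ha : PolyIn A 1 (fun x w => (a x w : ℂ))) (hb : PolyIn A 1 (fun x w => (b x w : ℂ)))
    (hh : ∀ s : X × ℝ → ℝ → ℝ, PolyIn (polyExt A) 1 (fun z w => (s z w : ℂ)) →
      PolyIn (polyExt A) n (fun z w => h z.1 w (s z w))) :
    PolyIn A (1 + n) (fun x w => ∫ s in a x w..b x w, h x w s) := by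
  -- Substitute `s = a + (b - a) τ`. The factor `b - a` accounts for the extra degree, and `s` is
  -- affine in `w` with coefficients polynomial in `τ`; this is why `hh` is required over `polyExt
  -- A`. Nested integrals iterate the extension.
  have key := (hb.sub ha).mul (integral_unit (hh (fun z w => a z.1 w + (b z.1 w - a z.1 w) * z.2) (by
    have := ha.lift.add ((((hb.sub ha).lift).mul (snd (n := 0))))
    simpa using this)))
  convert key using 3 with x w
  have := intervalIntegral.smul_integral_comp_add_mul (a := 0) (b := 1) (h x w)
    (b x w - a x w) (a x w)
  simp only [mul_zero, add_zero, mul_one, add_sub_cancel] at this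
  rw [← this, Complex.real_smul]
  push_cast
  rfl

end PolyIn

/-! ### Polynomial functions and Taylor coefficients. -/

/-- The functions on `ℝ ^ ι` given by complex polynomials. -/
noncomputable def polyFun (ι : Type*) : Subalgebra ℂ ((ι → ℝ) → ℂ) :=
  (AlgHom.pi fun y : ι → ℝ => (MvPolynomial.aeval fun i => (y i : ℂ) :
    MvPolynomial ι ℂ →ₐ[ℂ] ℂ)).range

lemma mem_polyFun {ι : Type*} {f : (ι → ℝ) → ℂ} :
    f ∈ polyFun ι ↔
      ∃ Q : MvPolynomial ι ℂ, ∀ y, f y = MvPolynomial.eval (fun i => (y i : ℂ)) Q := by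
  constructor
  · rintro ⟨Q, rfl⟩
    exact ⟨Q, fun y => by simp [MvPolynomial.aeval_eq_eval]⟩
  · rintro ⟨Q, h⟩
    exact ⟨Q, funext fun y => by simp [h, MvPolynomial.aeval_eq_eval]⟩

lemma coord_mem_polyFun {ι : Type*} (i : ι) : (fun y : ι → ℝ => (y i : ℂ)) ∈ polyFun ι :=
  mem_polyFun.2 ⟨MvPolynomial.X i, by simp⟩

/-- The Taylor coefficients at `0` of a polynomial. -/
lemma iteratedDeriv_sum_div_factorial (N n : ℕ) (c : ℕ → ℂ) (hc : ∀ k, N ≤ k → c k = 0) :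
    iteratedDeriv n (fun w : ℝ => ∑ k ∈ Finset.range N, c k * (w : ℂ) ^ k) 0 / (n.factorial : ℂ) =
      c n := by
  have hk : ∀ k, iteratedDeriv n (fun w : ℝ => c k * (w : ℂ) ^ k) 0 =
      if k = n then c n * n.factorial else 0 := by
    intro k
    have h1 : (fun w : ℝ => c k * (w : ℂ) ^ k) = fun w : ℝ => c k * ((w ^ k : ℝ) : ℂ) := by
      funext w; push_cast; rfl
    -- The embedding of the reals in the complex numbers commutes with differentiation, which
    -- reduces the claim to the real monomial `w ^ k`.
    have h2 : ∀ (n : ℕ), iteratedDeriv n (fun w : ℝ => c k * ((w ^ k : ℝ) : ℂ)) =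
        fun w : ℝ => c k * ((iteratedDeriv n (fun w : ℝ => w ^ k) w : ℝ) : ℂ) := by
      intro n
      induction n with
      | zero => simp
      | succ n ih =>
        funext w
        rw [iteratedDeriv_succ, ih, iteratedDeriv_succ]
        have hd : DifferentiableAt ℝ (iteratedDeriv n fun w : ℝ => w ^ k) w := by
          have : ContDiff ℝ ⊤ (fun w : ℝ => w ^ k) := by fun_prop
          exact (this.differentiable_iteratedDeriv n (by exact_mod_cast WithTop.coe_lt_top _)) w
        exact (hd.hasDerivAt.ofReal_comp.const_mul (c k)).deriv
    rw [h1, h2]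
    beta_reduce
    rw [iteratedDeriv_pow]
    rcases lt_trichotomy k n with h | h | h
    · simp [Nat.descFactorial_eq_zero_iff_lt.2 h, h.ne]
    · subst h; simp [Nat.descFactorial_self]
    · simp [h.ne', (Nat.sub_pos_of_lt h).ne']
  have hs : iteratedDeriv n (fun w : ℝ => ∑ k ∈ Finset.range N, c k * (w : ℂ) ^ k) 0 =
      ∑ k ∈ Finset.range N, iteratedDeriv n (fun w : ℝ => c k * (w : ℂ) ^ k) 0 := by
    refine iteratedDeriv_fun_sum fun k _ => ?_
    apply ContDiff.contDiffAt
    have : ContDiff ℝ n (fun w : ℝ => (w : ℂ)) := Complex.ofRealCLM.contDiff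
    fun_prop
  rw [hs]
  simp only [hk, Finset.sum_ite_eq', Finset.mem_range]
  split_ifs with h
  · exact mul_div_cancel_right₀ _ (by exact_mod_cast n.factorial_ne_zero)
  · rw [hc n (not_lt.1 h)]; simp

/-! ### The tables -/

/-- Recording linearity once, through the values at the basis vectors, spares later regularity
arguments a case distinction over the 18 rows. -/
lemma xiLimits_linear (u : Fin 3 → ℝ) (d : Fin 18) :
    let l := xiLimits u d
    let a := xiLimits ![1, 0, 0] d
    let b := xiLimits ![0, 1, 0] d
    let c := xiLimits ![0, 0, 1] d
    l.L₃ = u 0 * a.L₃ + u 1 * b.L₃ + u 2 * c.L₃ ∧ l.U₃ = u 0 * a.U₃ + u 1 * b.U₃ + u 2 * c.U₃ ∧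
    l.L₂ = u 0 * a.L₂ + u 1 * b.L₂ + u 2 * c.L₂ ∧ l.U₂ = u 0 * a.U₂ + u 1 * b.U₂ + u 2 * c.U₂ ∧
    l.L₁ = u 0 * a.L₁ + u 1 * b.L₁ + u 2 * c.L₁ ∧ l.U₁ = u 0 * a.U₁ + u 1 * b.U₁ + u 2 * c.U₁ := by
  fin_cases d <;> simp [xiLimits] <;> ring_nf <;> simp

/-- Every entry has degree at most one in each variable and is thus determined by its values at the
four corners of the square. -/
lemma duffyTet_bilinear (y : Fin 2 → ℝ) (d : Fin 18) :
    duffyTet y d =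
      ⟨(1 - y 0) * (1 - y 1) * (duffyTet ![0, 0] d).jac + (1 - y 0) * y 1 * (duffyTet ![0, 1] d).jac +
        y 0 * (1 - y 1) * (duffyTet ![1, 0] d).jac + y 0 * y 1 * (duffyTet ![1, 1] d).jac,
       fun i => (1 - y 0) * (1 - y 1) * (duffyTet ![0, 0] d).u i +
        (1 - y 0) * y 1 * (duffyTet ![0, 1] d).u i +
        y 0 * (1 - y 1) * (duffyTet ![1, 0] d).u i + y 0 * y 1 * (duffyTet ![1, 1] d).u i, 0⟩ := by
  fin_cases d <;> refine DuffyRow.ext ?_ ?_ ?_ <;>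
    first
    | (ext i; fin_cases i <;> simp [duffyTet] <;> ring)
    | (simp [duffyTet]; done)
    | (simp [duffyTet]; ring)

/-- This relation and the next make the shifted variables `ξ_i - U_i` satisfy the plain inequalities
`α₁ ≥ α₂ ≥ α₃`. -/
lemma xiLimits_U₂ (u : Fin 3 → ℝ) (d : Fin 18) :
    (xiLimits u d).U₂ = (xiLimits u d).U₁ - (xiLimits u d).L₁ := by
  fin_cases d <;> simp [xiLimits] <;> ring

lemma xiLimits_U₃ (u : Fin 3 → ℝ) (d : Fin 18) :
    (xiLimits u d).U₃ = (xiLimits u d).U₂ - (xiLimits u d).L₂ := by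
  fin_cases d <;> simp [xiLimits] <;> ring

/-! ### The coefficients are polynomials -/

/-- A real function is a member of an algebra of complex functions. -/
def RealMem {X : Type*} (A : Subalgebra ℂ (X → ℂ)) (f : X → ℝ) : Prop :=
  (fun x => (f x : ℂ)) ∈ A

namespace RealMem

variable {X : Type*} {A : Subalgebra ℂ (X → ℂ)} {f g : X → ℝ}

lemma add (hf : RealMem A f) (hg : RealMem A g) : RealMem A (fun x => f x + g x) := by
  have : (fun x => ((f x + g x : ℝ) : ℂ)) = (fun x => (f x : ℂ)) + fun x => (g x : ℂ) := by
    funext x; simp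
  rw [RealMem, this]
  exact A.add_mem hf hg

lemma mul (hf : RealMem A f) (hg : RealMem A g) : RealMem A (fun x => f x * g x) := by
  have : (fun x => ((f x * g x : ℝ) : ℂ)) = (fun x => (f x : ℂ)) * fun x => (g x : ℂ) := by
    funext x; simp
  rw [RealMem, this]
  exact A.mul_mem hf hg

lemma const (c : ℝ) : RealMem A (fun _ => c) := A.algebraMap_mem (c : ℂ)

lemma sub (hf : RealMem A f) (hg : RealMem A g) : RealMem A (fun x => f x - g x) := by
  have : (fun x => ((f x - g x : ℝ) : ℂ)) = (fun x => (f x : ℂ)) - fun x => (g x : ℂ) := by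
    funext x; simp
  rw [RealMem, this]
  exact A.sub_mem hf hg

lemma pow (hf : RealMem A f) (n : ℕ) : RealMem A (fun x => f x ^ n) := by
  have : (fun x => ((f x ^ n : ℝ) : ℂ)) = (fun x => (f x : ℂ)) ^ n := by
    funext x; simp
  rw [RealMem, this]
  exact A.pow_mem hf n

lemma bilinear (hf : RealMem A f) (hg : RealMem A g) (a b c e : ℝ) :
    RealMem A (fun x => (1 - f x) * (1 - g x) * a + (1 - f x) * g x * b + f x * (1 - g x) * c +
      f x * g x * e) :=
  have hf' := (const 1).sub hf
  have hg' := (const 1).sub hg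
  ((((hf'.mul hg').mul (const a)).add ((hf'.mul hg).mul (const b))).add
    ((hf.mul hg').mul (const c))).add ((hf.mul hg).mul (const e))

lemma duffyTet_u {y : X → Fin 2 → ℝ} (hy : ∀ i, RealMem A fun x => y x i) (d : Fin 18) (i : Fin 3) :
    RealMem A (fun x => (duffyTet (y x) d).u i) :=
  (funext fun x => congrFun (congrArg DuffyRow.u (duffyTet_bilinear (y x) d)) i :
    (fun x => (duffyTet (y x) d).u i) = _) ▸ bilinear (hy 0) (hy 1) _ _ _ _

lemma duffyTet_jac {y : X → Fin 2 → ℝ} (hy : ∀ i, RealMem A fun x => y x i) (d : Fin 18) :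
    RealMem A (fun x => (duffyTet (y x) d).jac) :=
  (funext fun x => congrArg DuffyRow.jac (duffyTet_bilinear (y x) d) :
    (fun x => (duffyTet (y x) d).jac) = _) ▸ bilinear (hy 0) (hy 1) _ _ _ _

lemma linearCombination {u : X → Fin 3 → ℝ} (hu : ∀ i, RealMem A fun x => u x i) (a b c : ℝ) :
    RealMem A (fun x => u x 0 * a + u x 1 * b + u x 2 * c) :=
  (((hu 0).mul (const a)).add ((hu 1).mul (const b))).add ((hu 2).mul (const c))

lemma xiLimits_U {u : X → Fin 3 → ℝ} (hu : ∀ i, RealMem A fun x => u x i) (d : Fin 18) :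
    RealMem A (fun x => (xiLimits (u x) d).U₂) ∧ RealMem A (fun x => (xiLimits (u x) d).U₃) :=
  ⟨(funext fun x => (xiLimits_linear (u x) d).2.2.2.1 : (fun x => (xiLimits (u x) d).U₂) = _) ▸
      linearCombination hu _ _ _,
    (funext fun x => (xiLimits_linear (u x) d).2.1 : (fun x => (xiLimits (u x) d).U₃) = _) ▸
      linearCombination hu _ _ _⟩

end RealMem

lemma realMem_coord {ι : Type*} (i : ι) : RealMem (polyFun ι) (fun y => y i) := coord_mem_polyFun i

lemma realMem_vec2 {X : Type*} {A : Subalgebra ℂ (X → ℂ)} {f g : X → ℝ} (hf : RealMem A f)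
    (hg : RealMem A g) (i : Fin 2) : RealMem A (fun x => ![f x, g x] i) := by
  fin_cases i
  exacts [hf, hg]

lemma realMem_duffyTet (d : Fin 18) :
    RealMem (polyFun (Fin 2)) (fun y => (duffyTet y d).jac) ∧
    (∀ i, RealMem (polyFun (Fin 2)) (fun y => (duffyTet y d).u i)) ∧
    (∀ i, RealMem (polyFun (Fin 2)) (fun y => (duffyTet y d).xi i)) := by
  refine ⟨RealMem.duffyTet_jac realMem_coord d, RealMem.duffyTet_u realMem_coord d, fun i => ?_⟩
  exact (funext fun y => congrFun (congrArg DuffyRow.xi (duffyTet_bilinear y d)) i :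
    (fun y => (duffyTet y d).xi i) = _) ▸ RealMem.const 0

lemma realMem_duffyFace (d : Fin 18) :
    RealMem (polyFun (Fin 3)) (fun y => (duffyFace y d).jac) ∧
    (∀ i, RealMem (polyFun (Fin 3)) (fun y => (duffyFace y d).u i)) ∧
    (∀ i, RealMem (polyFun (Fin 3)) (fun y => (duffyFace y d).xi i)) := by
  simp only [duffyFace_eq]
  have ht := realMem_vec2 (realMem_coord (1 : Fin 3)) (realMem_coord (2 : Fin 3))
  have hu : ∀ i, RealMem (polyFun (Fin 3))
      fun y => (y 0 • (duffyTet ![y 1, y 2] d).u) i := fun i =>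
    (realMem_coord 0).mul (RealMem.duffyTet_u ht d i)
  refine ⟨((realMem_coord (0 : Fin 3)).pow 2).mul (RealMem.duffyTet_jac ht d), hu, fun i => ?_⟩
  fin_cases i
  · exact RealMem.const 0
  · exact RealMem.const 0
  · exact (RealMem.const 1).add (RealMem.xiLimits_U hu d).2

lemma realMem_duffyEdge (d : Fin 18) :
    RealMem (polyFun (Fin 4)) (fun y => (duffyEdge y d).jac) ∧
    (∀ i, RealMem (polyFun (Fin 4)) (fun y => (duffyEdge y d).u i)) ∧
    (∀ i, RealMem (polyFun (Fin 4)) (fun y => (duffyEdge y d).xi i)) := by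
  simp only [duffyEdge_eq]
  have ht : ∀ i, RealMem (polyFun (Fin 4))
      fun y => (if d = 1 then ![y 3, y 2] else ![y 2, y 3]) i := by
    split_ifs
    · exact realMem_vec2 (realMem_coord (3 : Fin 4)) (realMem_coord (2 : Fin 4))
    · exact realMem_vec2 (realMem_coord (2 : Fin 4)) (realMem_coord (3 : Fin 4))
  have h01 := (realMem_coord (0 : Fin 4)).mul (realMem_coord (1 : Fin 4))
  have hu := fun i => h01.mul (RealMem.duffyTet_u ht d i)
  refine ⟨(((realMem_coord (0 : Fin 4)).pow 3).mul ((realMem_coord (1 : Fin 4)).pow 2)).mul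
    (RealMem.duffyTet_jac ht d), hu, fun i => ?_⟩
  fin_cases i
  · exact RealMem.const 0
  · exact (RealMem.const 1).add (RealMem.xiLimits_U (u := fun y : Fin 4 → ℝ =>
      (y 0 * y 1) • (duffyTet (if d = 1 then ![y 3, y 2] else ![y 2, y 3]) d).u) hu d).1
  · exact (realMem_coord (0 : Fin 4)).mul ((RealMem.const 1).add (RealMem.xiLimits_U
      (u := fun y : Fin 4 → ℝ =>
        y 1 • (duffyTet (if d = 1 then ![y 3, y 2] else ![y 2, y 3]) d).u)
      (fun i => (realMem_coord (1 : Fin 4)).mul (RealMem.duffyTet_u ht d i)) d).2)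

lemma realMem_duffy (c : CommonCase) (d : Fin 18) :
    RealMem (polyFun (Fin c.dimY)) (fun y => (duffy c d y).jac) ∧
    (∀ i, RealMem (polyFun (Fin c.dimY)) (fun y => (duffy c d y).u i)) ∧
    (∀ i, RealMem (polyFun (Fin c.dimY)) (fun y => (duffy c d y).xi i)) := by
  cases c
  exacts [realMem_duffyEdge d, realMem_duffyFace d, realMem_duffyTet d]

/-! ### Functions affine in `w`, and the degree of the inner integrals. -/

/-- A real function of `x` and `w` which is affine in `w`, with coefficients in `A`. -/
def AffIn {X : Type*} (A : Subalgebra ℂ (X → ℂ)) (f : X → ℝ → ℝ) : Prop :=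
  PolyIn A 1 (fun x w => (f x w : ℂ))

namespace AffIn

variable {X : Type*} {A : Subalgebra ℂ (X → ℂ)} {f g : X → ℝ → ℝ}

lemma add (hf : AffIn A f) (hg : AffIn A g) : AffIn A (fun x w => f x w + g x w) := by
  simpa [AffIn] using PolyIn.add hf hg

lemma const (c : ℝ) : AffIn A (fun _ _ => c) := PolyIn.const (c : ℂ)

lemma mul_const (hf : AffIn A f) (c : ℝ) : AffIn A (fun x w => f x w * c) := by
  simpa [AffIn] using PolyIn.mul hf (PolyIn.const (n := 0) (c : ℂ))

lemma lift (hf : AffIn A f) : AffIn (polyExt A) (fun z => f z.1) := PolyIn.lift hf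

lemma linear {a : X → ℝ} (ha : RealMem A a) : AffIn A (fun x w => w * a x) := by
  simpa [AffIn] using PolyIn.linear ha

lemma linearCombination {u : X → ℝ → Fin 3 → ℝ} (hu : ∀ i, AffIn A fun x w => u x w i)
    (a b c : ℝ) : AffIn A (fun x w => u x w 0 * a + u x w 1 * b + u x w 2 * c) :=
  (((hu 0).mul_const a).add ((hu 1).mul_const b)).add ((hu 2).mul_const c)

lemma xiLimits {u : X → ℝ → Fin 3 → ℝ} (hu : ∀ i, AffIn A fun x w => u x w i) (d : Fin 18) :
    AffIn A (fun x w => (xiLimits (u x w) d).L₃) ∧ AffIn A (fun x w => (xiLimits (u x w) d).U₃) ∧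
    AffIn A (fun x w => (xiLimits (u x w) d).L₂) ∧ AffIn A (fun x w => (xiLimits (u x w) d).U₂) ∧
    AffIn A (fun x w => (xiLimits (u x w) d).L₁) ∧ AffIn A (fun x w => (xiLimits (u x w) d).U₁) := by
  refine ⟨?_, ?_, ?_, ?_, ?_, ?_⟩
  · exact (funext₂ fun x w => (xiLimits_linear (u x w) d).1 :
      (fun x w => (TaylorDuffy.xiLimits (u x w) d).L₃) = _) ▸ linearCombination hu _ _ _
  · exact (funext₂ fun x w => (xiLimits_linear (u x w) d).2.1 :
      (fun x w => (TaylorDuffy.xiLimits (u x w) d).U₃) = _) ▸ linearCombination hu _ _ _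
  · exact (funext₂ fun x w => (xiLimits_linear (u x w) d).2.2.1 :
      (fun x w => (TaylorDuffy.xiLimits (u x w) d).L₂) = _) ▸ linearCombination hu _ _ _
  · exact (funext₂ fun x w => (xiLimits_linear (u x w) d).2.2.2.1 :
      (fun x w => (TaylorDuffy.xiLimits (u x w) d).U₂) = _) ▸ linearCombination hu _ _ _
  · exact (funext₂ fun x w => (xiLimits_linear (u x w) d).2.2.2.2.1 :
      (fun x w => (TaylorDuffy.xiLimits (u x w) d).L₁) = _) ▸ linearCombination hu _ _ _
  · exact (funext₂ fun x w => (xiLimits_linear (u x w) d).2.2.2.2.2 :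
      (fun x w => (TaylorDuffy.xiLimits (u x w) d).U₁) = _) ▸ linearCombination hu _ _ _

lemma point {ξ : X → ℝ → Fin 3 → ℝ} (hξ : ∀ i, AffIn A fun x w => ξ x w i) (V : Fin 4 → E3)
    (i : Fin 3) : AffIn A (fun x w => point V (ξ x w) i) := by
  have := (const (A := A) (V 0 i)).add ((((hξ 0).mul_const ((V 1 - V 0) i)).add
    ((hξ 1).mul_const ((V 2 - V 1) i))).add ((hξ 2).mul_const ((V 3 - V 2) i)))
  convert this using 3 with x w
  simp [TaylorDuffy.point, Fin.sum_univ_three]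

lemma polyXi {ξ u : X → ℝ → Fin 3 → ℝ} (hξ : ∀ i, AffIn A fun x w => ξ x w i)
    (hu : ∀ i, AffIn A fun x w => u x w i) (P : MvPolynomial (Fin 3 ⊕ Fin 3) ℂ)
    (V V' : Fin 4 → E3) :
    PolyIn A P.totalDegree (fun x w => polyXi P V V' (ξ x w) (u x w)) := by
  unfold TaylorDuffy.polyXi polyEval
  have := PolyIn.mvPolynomial_eval (A := A) P (z := fun i x w =>
    Sum.elim (fun i => (TaylorDuffy.point V (ξ x w) i : ℂ))
      (fun i => (TaylorDuffy.point V' (ξ x w + u x w) i : ℂ)) i) ?_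
  · exact this
  · rintro (i | i)
    · exact point hξ V i
    · exact point (ξ := fun x w => ξ x w + u x w) (fun j => (hξ j).add (hu j)) V' i

lemma vec3 {a b c : X → ℝ → ℝ} (ha : AffIn A a) (hb : AffIn A b) (hc : AffIn A c) (i : Fin 3) :
    AffIn A (fun x w => ![a x w, b x w, c x w] i) := by
  fin_cases i
  exacts [ha, hb, hc]

end AffIn

/-- The limits are affine in `w` and the integrand has degree at most `deg P`; each of the `N_CV -
1` integrations raises the degree by at most one. -/
lemma polyIn_pbar {X : Type*} {A : Subalgebra ℂ (X → ℂ)} (c : CommonCase)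
    (P : MvPolynomial (Fin 3 ⊕ Fin 3) ℂ) (V V' : Fin 4 → E3) (d : Fin 18)
    {ξ u : X → ℝ → Fin 3 → ℝ} (hξ : ∀ i, AffIn A fun x w => ξ x w i)
    (hu : ∀ i, AffIn A fun x w => u x w i) :
    PolyIn A (numTerms c P - 1) (fun x w => pbar c P V V' d (u x w) (ξ x w)) := by
  obtain ⟨hL₃, hU₃, hL₂, hU₂, hL₁, hU₁⟩ := AffIn.xiLimits hu d
  have h1 : ∀ {X : Type _} {A : Subalgebra ℂ (X → ℂ)}, AffIn A fun _ _ => (1 : ℝ) :=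
    fun {_ _} => AffIn.const 1
  cases c with
  | edge =>
    refine (PolyIn.integral ((hξ 1).add hL₁) (h1.add hU₁) (n := P.totalDegree)
      (fun s hs => ?_)).mono (by simp [numTerms, CommonCase.numCV]; omega)
    exact AffIn.polyXi (AffIn.vec3 hs (hξ 1).lift (hξ 2).lift) (fun i => (hu i).lift) P V V'
  | face =>
    refine (PolyIn.integral ((hξ 2).add hL₂) (h1.add hU₂) (n := 1 + P.totalDegree)
      (fun s hs => ?_)).mono (by simp [numTerms, CommonCase.numCV]; omega)
    refine PolyIn.integral (AffIn.add hs hL₁.lift) (h1.add hU₁.lift) (fun s' hs' => ?_)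
    exact AffIn.polyXi (AffIn.vec3 hs' (AffIn.lift hs) (hξ 2).lift.lift)
      (fun i => (hu i).lift.lift) P V V'
  | tetrahedron =>
    refine (PolyIn.integral hL₃ (h1.add hU₃) (n := 1 + (1 + P.totalDegree))
      (fun s hs => ?_)).mono (by simp [numTerms, CommonCase.numCV]; omega)
    refine PolyIn.integral (AffIn.add hs hL₂.lift) (h1.add hU₂.lift) (fun s' hs' => ?_)
    refine PolyIn.integral (AffIn.add hs' hL₁.lift.lift) (h1.add hU₁.lift.lift) (fun s'' hs'' => ?_)
    exact AffIn.polyXi (AffIn.vec3 hs'' (AffIn.lift hs') (AffIn.lift hs).lift)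
      (fun i => (hu i).lift.lift.lift) P V V'

lemma pbarDuffy_eq_sum (c : CommonCase) (P : MvPolynomial (Fin 3 ⊕ Fin 3) ℂ) (V V' : Fin 4 → E3)
    (d : Fin 18) : (∀ n, pcoeff c P V V' d n ∈ polyFun (Fin c.dimY)) ∧
      ∀ (y : Fin c.dimY → ℝ) (w : ℝ), pbarDuffy c P V V' d y w =
        ∑ n ∈ Finset.range (numTerms c P), pcoeff c P V V' d n y * (w : ℂ) ^ n := by
  have h : PolyIn (polyFun (Fin c.dimY)) (numTerms c P - 1) (pbarDuffy c P V V' d) :=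
    polyIn_pbar c P V V' d (fun i => AffIn.linear ((realMem_duffy c d).2.2 i))
      (fun i => AffIn.linear ((realMem_duffy c d).2.1 i))
  obtain ⟨q, hq, hq0, e⟩ := h.eq_sum
  have hN : numTerms c P - 1 + 1 = numTerms c P := by
    cases c <;> simp [numTerms, CommonCase.numCV]
  rw [hN] at e
  -- The Taylor coefficients coincide with the coefficients of the finite expansion, also beyond its
  -- degree, where both vanish.
  have hc : ∀ n, pcoeff c P V V' d n = q n := by
    intro n
    funext y
    have : pbarDuffy c P V V' d y = fun w : ℝ =>
      ∑ k ∈ Finset.range (numTerms c P), q k y * (w : ℂ) ^ k := funext (e y)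
    rw [pcoeff, this]
    exact iteratedDeriv_sum_div_factorial _ n (fun k => q k y) fun k hk => by
      rw [hq0 k (by omega)]; rfl
  refine ⟨fun n => hc n ▸ hq n, fun y w => ?_⟩
  simp only [hc, e]

/-! ### The kernel and its first integrals -/

/-- Near `0` the growth bound gives `r ^ (p - q) ≤ 1` for `r ≤ 1`; the rest of the interval is
compact and `K` is continuous there. -/
lemma exists_bound_kernel {K : ℝ → ℂ} {q : ℝ} (hK : ContinuousOn K (Ioi 0))
    (hO : K =O[𝓝[>] 0] fun r : ℝ => r ^ (-q)) {p : ℕ} (hp : q ≤ p) (R : ℝ) :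
    ∃ C, 0 ≤ C ∧ ∀ r, 0 < r → r ≤ R → ‖K r‖ * r ^ p ≤ C := by
  obtain ⟨c, hc⟩ := hO.bound
  obtain ⟨δ, hδ, h⟩ := mem_nhdsGT_iff_exists_Ioo_subset.1 hc
  have hδ : 0 < δ := hδ
  -- Below `ε` both the growth estimate (`r < δ`) and `r ≤ 1` are available.
  set ε := min (δ / 2) 1 with hε
  have hε0 : 0 < ε := lt_min (by linarith) one_pos
  obtain ⟨M, hM⟩ := (isCompact_Icc (a := ε) (b := R)).exists_bound_of_continuousOn
    (f := fun r => K r * (r : ℂ) ^ p)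
    (((hK.mono fun r hr => hε0.trans_le hr.1)).mul (by fun_prop))
  refine ⟨max |c| M, (abs_nonneg c).trans (le_max_left _ _), fun r hr hrR => ?_⟩
  rcases le_or_gt ε r with h1 | h1
  · refine le_trans ?_ (le_max_right _ _)
    simpa [abs_of_pos hr] using hM r ⟨h1, hrR⟩
  · refine le_trans ?_ (le_max_left _ _)
    have h2 : ‖K r‖ ≤ c * ‖r ^ (-q)‖ :=
      h ⟨hr, h1.trans_le ((min_le_left _ _).trans (by linarith))⟩
    have h3 : 0 < r ^ (-q) := Real.rpow_pos_of_pos hr _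
    rw [Real.norm_of_nonneg h3.le] at h2
    have h4 : r ^ (-q) * r ^ p ≤ 1 := by
      rw [← Real.rpow_natCast r p, ← Real.rpow_add hr]
      exact Real.rpow_le_one hr.le (h1.le.trans (min_le_right _ _)) (by linarith)
    calc ‖K r‖ * r ^ p ≤ c * r ^ (-q) * r ^ p := by gcongr
      _ ≤ |c| * (r ^ (-q) * r ^ p) := by
        rw [mul_assoc]
        exact mul_le_mul_of_nonneg_right (le_abs_self c) (by positivity)
      _ ≤ |c| * 1 := by gcongr
      _ = |c| := mul_one _

lemma continuousOn_scaled {K : ℝ → ℂ} (hK : ContinuousOn K (Ioi 0)) (p : ℕ) {X : ℝ} (hX : 0 < X) :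
    ContinuousOn (fun w : ℝ => ((w ^ p : ℝ) : ℂ) * K (w * X)) (Ioi 0) := by
  refine ContinuousOn.mul (by fun_prop) ?_
  exact hK.comp (by fun_prop) fun w hw => mul_pos hw hX

lemma norm_scaled_le {K : ℝ → ℂ} {p : ℕ} {C R X w : ℝ}
    (hC : ∀ r, 0 < r → r ≤ R → ‖K r‖ * r ^ p ≤ C) (hX : 0 < X) (hw : 0 < w) (hR : w * X ≤ R) :
    ‖((w ^ p : ℝ) : ℂ) * K (w * X)‖ ≤ C / X ^ p := by
  rw [le_div_iff₀ (by positivity)]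
  have := hC (w * X) (by positivity) hR
  rw [norm_mul, Complex.norm_real, Real.norm_of_nonneg (by positivity)]
  calc w ^ p * ‖K (w * X)‖ * X ^ p = ‖K (w * X)‖ * (w * X) ^ p := by ring
    _ ≤ C := this

lemma firstIntegral_regular {K : ℝ → ℂ} {q : ℝ} (hK : ContinuousOn K (Ioi 0))
    (hO : K =O[𝓝[>] 0] fun r : ℝ => r ^ (-q)) {p : ℕ} (hp : q ≤ p) :
    (∀ X : ℝ, 0 < X →
      IntervalIntegrable (fun w : ℝ => ((w ^ p : ℝ) : ℂ) * K (w * X)) volume 0 1) ∧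
    ContinuousOn (firstIntegral K p) (Ioi 0) := by
  have hmeas : ∀ X : ℝ, 0 < X → AEStronglyMeasurable
      (fun w : ℝ => ((w ^ p : ℝ) : ℂ) * K (w * X)) (volume.restrict (Ioc 0 1)) := fun X hX =>
    ((continuousOn_scaled hK p hX).mono fun w hw => hw.1).aestronglyMeasurable measurableSet_Ioc
  constructor
  · intro X hX
    obtain ⟨C, -, hC⟩ := exists_bound_kernel hK hO hp X
    rw [intervalIntegrable_iff_integrableOn_Ioc_of_le zero_le_one]
    refine IntegrableOn.of_bound measure_Ioc_lt_top (hmeas X hX) (C / X ^ p) ?_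
    refine (ae_restrict_iff' measurableSet_Ioc).2 (ae_of_all _ fun w hw => ?_)
    exact norm_scaled_le hC hX hw.1 (mul_le_of_le_one_left hX.le hw.2)
  · intro X₀ hX₀
    have hX₀ : 0 < X₀ := hX₀
    apply ContinuousAt.continuousWithinAt
    -- Dominated convergence: for `X₀ / 2 < X < 2 X₀` and `w ≤ 1` the argument `w X` stays below `2
    -- X₀`, and a constant dominates.
    obtain ⟨C, hC0, hC⟩ := exists_bound_kernel hK hO hp (2 * X₀)
    have hnhds : ∀ᶠ X in 𝓝 X₀, X₀ / 2 < X ∧ X < 2 * X₀ :=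
      (lt_mem_nhds (by linarith)).and (gt_mem_nhds (by linarith))
    unfold firstIntegral
    refine intervalIntegral.continuousAt_of_dominated_interval
      (bound := fun _ => C / (X₀ / 2) ^ p) ?_ ?_ (by simp) ?_
    · filter_upwards [hnhds] with X hX
      rw [uIoc_of_le zero_le_one]
      exact hmeas X (by linarith)
    · filter_upwards [hnhds] with X hX
      refine ae_of_all _ fun w hw => ?_
      rw [uIoc_of_le zero_le_one] at hw
      have hX0 : 0 < X := by linarith
      refine (norm_scaled_le hC hX0 hw.1 ?_).trans ?_
      · exact (mul_le_of_le_one_left hX0.le hw.2).trans hX.2.le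
      · gcongr
        exact hX.1.le
    · refine ae_of_all _ fun w hw => ?_
      rw [uIoc_of_le zero_le_one] at hw
      have h1 : ContinuousAt K (w * X₀) := hK.continuousAt (Ioi_mem_nhds (mul_pos hw.1 hX₀))
      exact continuousAt_const.mul (ContinuousAt.comp (f := fun X => w * X) h1 (by fun_prop))

lemma locallyIntegrableOn_scaled {K : ℝ → ℂ} (hK : LocallyIntegrableOn K (Ioi 0)) {X : ℝ}
    (hX : 0 < X) : LocallyIntegrableOn (fun w => K (w * X)) (Ioi 0) := by
  rw [locallyIntegrableOn_iff isOpen_Ioi.isLocallyClosed] at hK ⊢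
  intro k hk hkc
  rcases k.eq_empty_or_nonempty with rfl | hne
  · simp
  obtain ⟨a, ha, ha'⟩ := hkc.exists_isLeast hne
  obtain ⟨b, hb, hb'⟩ := hkc.exists_isGreatest hne
  have ha0 : 0 < a := hk ha
  have hab : a ≤ b := ha' hb
  have h1 : IntervalIntegrable K volume (a * X) (b * X) := by
    rw [intervalIntegrable_iff_integrableOn_Icc_of_le (by gcongr)]
    exact hK _ (fun r hr => lt_of_lt_of_le (by positivity) hr.1) isCompact_Icc
  have h2 := h1.comp_mul_right (c := X)
  rw [mul_div_cancel_right₀ _ hX.ne', mul_div_cancel_right₀ _ hX.ne',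
    intervalIntegrable_iff_integrableOn_Icc_of_le hab] at h2
  exact h2.mono_set fun r hr => ⟨ha' hr, hb' hr⟩

/-- A nonzero polynomial is a power of the variable times one that does not vanish at `0`. -/
lemma exists_eq_X_pow_mul {p : Polynomial ℂ} (hp : p ≠ 0) :
    ∃ (n : ℕ) (q : Polynomial ℂ), p = Polynomial.X ^ n * q ∧ q.eval 0 ≠ 0 := by
  obtain ⟨q, h1, h2⟩ := Polynomial.exists_eq_pow_rootMultiplicity_mul_and_not_dvd p hp 0
  rw [Polynomial.dvd_iff_isRoot] at h2
  exact ⟨_, q, by simpa using h1, h2⟩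

/-- If `w ^ Y p(w) K(w X)` is integrable near `0`, then so is every term of the polynomial. -/
lemma integrable_terms {K : ℝ → ℂ} (hK : LocallyIntegrableOn K (Ioi 0)) {X : ℝ} (hX : 0 < X)
    (Y : ℕ) (p : Polynomial ℂ)
    (h : IntegrableOn (fun w : ℝ => ((w ^ Y : ℝ) : ℂ) * p.eval (w : ℂ) * K (w * X)) (Ioc 0 1))
    {n : ℕ} (hn : p.coeff n ≠ 0) :
    IntegrableOn (fun w : ℝ => ((w ^ (n + Y) : ℝ) : ℂ) * K (w * X)) (Ioc 0 1) := by
  have hp : p ≠ 0 := by rintro rfl; simp at hn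
  -- With `k` the lowest power in the polynomial, `k ≤ n`. Near `0` the factor `q` is bounded away
  -- from zero, so `w ^ n ≤ w ^ k` lets the given integrand dominate the term; away from `0` local
  -- integrability of `K` suffices.
  obtain ⟨k, q, rfl, hq⟩ := exists_eq_X_pow_mul hp
  have hkn : k ≤ n := by
    by_contra hlt
    exact hn (by rw [Polynomial.coeff_X_pow_mul']; simp [hlt])
  have hloc := locallyIntegrableOn_scaled hK hX
  have hcont : Continuous fun w : ℝ => ‖q.eval (w : ℂ)‖ :=
    (q.continuous.comp Complex.continuous_ofReal).norm
  have hη : 0 < ‖q.eval 0‖ / 2 := by positivity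
  have hev : ∀ᶠ w : ℝ in 𝓝 0, ‖q.eval 0‖ / 2 < ‖q.eval (w : ℂ)‖ :=
    (hcont.tendsto 0).eventually_const_lt (by simpa using half_lt_self (norm_pos_iff.2 hq))
  obtain ⟨δ, hδ, hball⟩ := Metric.eventually_nhds_iff.1 hev
  set ε := min (δ / 2) 1
  have hε0 : 0 < ε := lt_min (by linarith) one_pos
  have hε1 : ε ≤ 1 := min_le_right _ _
  rw [← Ioc_union_Ioc_eq_Ioc hε0.le hε1]
  have hfac : Continuous fun w : ℝ => ((w ^ (n + Y) : ℝ) : ℂ) := by fun_prop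
  refine IntegrableOn.union ?_ ?_
  · refine Integrable.mono' ((h.mono_set (Ioc_subset_Ioc_right hε1)).norm.const_mul
      (‖q.eval 0‖ / 2)⁻¹) ?_ ?_
    · exact hfac.aestronglyMeasurable.mul
        (hloc.aestronglyMeasurable.mono_measure (Measure.restrict_mono (fun w hw => hw.1) le_rfl))
    · refine (ae_restrict_iff' measurableSet_Ioc).2 (ae_of_all _ fun w hw => ?_)
      have hw0 : 0 < w := hw.1
      have hw1 : w ≤ 1 := hw.2.trans hε1
      have hqw : ‖q.eval 0‖ / 2 < ‖q.eval (w : ℂ)‖ := hball (by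
        rw [Real.dist_eq, sub_zero, abs_of_pos hw0]
        exact hw.2.trans_lt ((min_le_left _ _).trans_lt (by linarith)))
      rw [inv_mul_eq_div, le_div_iff₀ hη]
      simp only [norm_mul, Polynomial.eval_mul, Polynomial.eval_pow, Polynomial.eval_X, norm_pow,
        Complex.norm_real, Real.norm_of_nonneg hw0.le]
      calc w ^ (n + Y) * ‖K (w * X)‖ * (‖q.eval 0‖ / 2)
          ≤ (w ^ Y * w ^ k) * ‖K (w * X)‖ * ‖q.eval (w : ℂ)‖ := by
            rw [pow_add, mul_comm (w ^ n)]
            gcongr ?_ * ?_ * _ * ?_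
            exact pow_le_pow_of_le_one hw0.le hw1 hkn
        _ = w ^ Y * (w ^ k * ‖q.eval (w : ℂ)‖) * ‖K (w * X)‖ := by ring
  · have h1 : IntegrableOn (fun w => K (w * X)) (Icc ε 1) :=
      hloc.integrableOn_compact_subset (fun w hw => hε0.trans_le hw.1) isCompact_Icc
    exact (h1.continuousOn_mul hfac.continuousOn isCompact_Icc).mono_set Ioc_subset_Icc_self

/-! ### Vanishing on the diagonal -/

/-- Dividing by the lowest power `w ^ k` present, with `k ≤ n < m`, would bound a factor that is
nonzero at `0` by `C * w ^ (m - k)`, which tends to `0`. -/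
lemma coeff_eq_zero_of_bound {p : Polynomial ℂ} {m : ℕ} {C : ℝ}
    (h : ∀ w : ℝ, 0 < w → w ≤ 1 → ‖p.eval (w : ℂ)‖ ≤ C * w ^ m) {n : ℕ} (hn : n < m) :
    p.coeff n = 0 := by
  by_contra hne
  have hp : p ≠ 0 := by rintro rfl; simp at hne
  obtain ⟨k, q, rfl, hq⟩ := exists_eq_X_pow_mul hp
  have hkn : k ≤ n := by
    by_contra hlt
    exact hne (by rw [Polynomial.coeff_X_pow_mul']; simp [hlt])
  have h1 : ∀ w : ℝ, 0 < w → w ≤ 1 → ‖q.eval (w : ℂ)‖ ≤ C * w ^ (m - k) := by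
    intro w hw hw1
    have := h w hw hw1
    simp only [Polynomial.eval_mul, Polynomial.eval_pow, Polynomial.eval_X, norm_mul, norm_pow,
      Complex.norm_real, Real.norm_of_nonneg hw.le] at this
    rw [show m = k + (m - k) by omega, pow_add] at this
    refine le_of_mul_le_mul_left ?_ (pow_pos hw k)
    calc _ ≤ _ := this
      _ = _ := by ring
  have hcont : Continuous fun w : ℝ => ‖q.eval (w : ℂ)‖ :=
    (q.continuous.comp Complex.continuous_ofReal).norm
  have h2 : Tendsto (fun w : ℝ => ‖q.eval (w : ℂ)‖) (𝓝[>] 0) (𝓝 ‖q.eval 0‖) := by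
    simpa using (hcont.tendsto 0).mono_left nhdsWithin_le_nhds
  have h3 : Tendsto (fun w : ℝ => C * w ^ (m - k)) (𝓝[>] 0) (𝓝 0) := by
    have : Continuous fun w : ℝ => C * w ^ (m - k) := by fun_prop
    simpa [show m - k ≠ 0 by omega] using (this.tendsto 0).mono_left nhdsWithin_le_nhds
  have h4 := le_of_tendsto_of_tendsto h2 h3 (by
    filter_upwards [Ioc_mem_nhdsGT one_pos] with w hw using h1 w hw.1 hw.2)
  exact hq (norm_le_zero_iff.1 h4)

/-- The algebra of continuous functions. -/
def contFun (X : Type*) [TopologicalSpace X] : Subalgebra ℂ (X → ℂ) where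
  carrier := {f | Continuous f}
  mul_mem' := fun hf hg => Continuous.mul hf hg
  add_mem' := fun hf hg => Continuous.add hf hg
  algebraMap_mem' c := (continuous_const : Continuous fun _ : X => c)

/-- The coefficients of `t ↦ P(x, x + t v)` are continuous in `(x, v)` and vanish below order `m`.
Taking `t = ‖v‖` and the direction in the unit ball, where they are bounded, makes the estimate
uniform. -/
lemma VanishesOnDiagonal.exists_bound {P : MvPolynomial (Fin 3 ⊕ Fin 3) ℂ} {m : ℕ}
    (hP : VanishesOnDiagonal P m) (R : ℝ) :
    ∃ C, 0 ≤ C ∧ ∀ x v : E3, ‖x‖ ≤ R → ‖v‖ ≤ R → ‖polyEval P x (x + v)‖ ≤ C * ‖v‖ ^ m := by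
  have h : PolyIn (contFun (E3 × E3)) P.totalDegree
      (fun z t => polyEval P z.1 (z.1 + t • z.2)) := by
    have := PolyIn.mvPolynomial_eval (A := contFun (E3 × E3)) P (z := fun i z t =>
      Sum.elim (fun i => (z.1 i : ℂ)) (fun i => ((z.1 + t • z.2) i : ℂ)) i) ?_
    · exact this
    · have hc : ∀ i, RealMem (contFun (E3 × E3)) fun z => z.1 i := fun i =>
        (by fun_prop : Continuous fun z : E3 × E3 => (z.1 i : ℂ))
      have hc' : ∀ i, RealMem (contFun (E3 × E3)) fun z => z.2 i := fun i =>
        (by fun_prop : Continuous fun z : E3 × E3 => (z.2 i : ℂ))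
      rintro (i | i)
      · exact PolyIn.coeff (hc i)
      · exact AffIn.add (PolyIn.coeff (hc i)) (AffIn.linear (hc' i))
  obtain ⟨q, hq, hq0, e⟩ := h.eq_sum
  have hqm : ∀ k < m, ∀ z, q k z = 0 := by
    intro k hk z
    have h1 := hP z.1 z.2 k hk
    rw [show (fun t : ℝ => polyEval P z.1 (z.1 + t • z.2)) = fun w : ℝ =>
      ∑ k ∈ Finset.range (P.totalDegree + 1), q k z * (w : ℂ) ^ k from funext (e z)] at h1
    rw [← iteratedDeriv_sum_div_factorial (P.totalDegree + 1) k (fun k => q k z)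
      (fun k hk => by rw [hq0 k hk]; rfl), h1, zero_div]
  have hM : ∀ k, ∃ M, 0 ≤ M ∧ ∀ z ∈ Metric.closedBall (0 : E3) R ×ˢ Metric.closedBall (0 : E3) 1,
      ‖q k z‖ ≤ M := by
    intro k
    obtain ⟨M, hM⟩ := ((isCompact_closedBall (0 : E3) R).prod
      (isCompact_closedBall (0 : E3) 1)).exists_bound_of_continuousOn
        (f := q k) (Continuous.continuousOn (hq k))
    exact ⟨max M 0, le_max_right _ _, fun z hz => (hM z hz).trans (le_max_left _ _)⟩
  choose M hM0 hM using hM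
  refine ⟨∑ k ∈ Finset.range (P.totalDegree + 1), M k * |R| ^ (k - m),
    Finset.sum_nonneg fun k _ => mul_nonneg (hM0 k) (by positivity), fun x v hx hv => ?_⟩
  -- For `v = 0` the convention `0⁻¹ = 0` gives direction `0`, which also lies in the unit ball.
  have hv' : v = ‖v‖ • (‖v‖⁻¹ • v) := by
    rcases eq_or_ne v 0 with rfl | hv0
    · simp
    · rw [smul_smul, mul_inv_cancel₀ (norm_ne_zero_iff.2 hv0), one_smul]
  have he1 : ‖‖v‖⁻¹ • v‖ ≤ 1 := by
    rw [norm_smul, norm_inv, norm_norm]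
    exact inv_mul_le_one
  have e' := e (x, ‖v‖⁻¹ • v) ‖v‖
  simp only [← hv'] at e'
  rw [e', Finset.sum_mul]
  refine (norm_sum_le _ _).trans (Finset.sum_le_sum fun k _ => ?_)
  rcases lt_or_ge k m with hk | hk
  · rw [hqm k hk]
    simp only [zero_mul, norm_zero]
    have := hM0 k
    positivity
  · have h1 := hM k (x, ‖v‖⁻¹ • v) ⟨by simpa using hx, by simpa using he1⟩
    rw [norm_mul, norm_pow, Complex.norm_real, norm_norm]
    calc ‖q k (x, ‖v‖⁻¹ • v)‖ * ‖v‖ ^ k ≤ M k * ‖v‖ ^ k := by gcongr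
      _ = M k * ‖v‖ ^ (k - m) * ‖v‖ ^ m := by
        rw [mul_assoc, ← pow_add, Nat.sub_add_cancel hk]
      _ ≤ M k * |R| ^ (k - m) * ‖v‖ ^ m := by
        have := hM0 k
        gcongr
        exact hv.trans (le_abs_self R)

/-! ### Geometry of the tetrahedra -/

/-- The standard simplex `1 ≥ ξ₁ ≥ ξ₂ ≥ ξ₃ ≥ 0`. -/
def simplex : Set (Fin 3 → ℝ) := {ξ | 0 ≤ ξ 2 ∧ ξ 2 ≤ ξ 1 ∧ ξ 1 ≤ ξ 0 ∧ ξ 0 ≤ 1}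

/-- The linear part of `point V`. -/
noncomputable def edgeMap (V : Fin 4 → E3) : (Fin 3 → ℝ) →ₗ[ℝ] E3 :=
  Fintype.linearCombination ℝ fun i : Fin 3 => V i.succ - V i.castSucc

lemma edgeMap_apply (V : Fin 4 → E3) (ξ : Fin 3 → ℝ) :
    edgeMap V ξ = ∑ i : Fin 3, ξ i • (V i.succ - V i.castSucc) := rfl

lemma point_eq (V : Fin 4 → E3) (ξ : Fin 3 → ℝ) : point V ξ = V 0 + edgeMap V ξ := rfl

lemma point_eq_weights (V : Fin 4 → E3) (ξ : Fin 3 → ℝ) :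
    point V ξ = ∑ i, ![1 - ξ 0, ξ 0 - ξ 1, ξ 1 - ξ 2, ξ 2] i • V i := by
  simp only [point, Fin.sum_univ_four, Fin.sum_univ_three]
  simp
  module

/-- A vector killed by the linear part yields weights on the vertices with sum zero and vanishing
combination; affine independence makes all of them zero. -/
lemma edgeMap_injective {V : Fin 4 → E3} (hV : AffineIndependent ℝ V) :
    Function.Injective (edgeMap V) := by
  rw [injective_iff_map_eq_zero]
  intro ξ h
  have h1 := (affineIndependent_iff.1 hV) Finset.univ ![-ξ 0, ξ 0 - ξ 1, ξ 1 - ξ 2, ξ 2]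
    (by simp [Fin.sum_univ_four]; ring) (by
      rw [← h, edgeMap_apply]
      simp only [Fin.sum_univ_four, Fin.sum_univ_three]
      simp
      module)
  have e0 := h1 0 (by simp)
  have e1 := h1 1 (by simp)
  have e2 := h1 2 (by simp)
  simp at e0 e1 e2
  ext i
  fin_cases i <;> simp <;> linarith

lemma point_injective {V : Fin 4 → E3} (hV : AffineIndependent ℝ V) :
    Function.Injective (point V) := fun ξ η h =>
  edgeMap_injective hV (by simpa [point_eq] using h)

lemma continuous_point (V : Fin 4 → E3) : Continuous (point V) := by
  unfold point; fun_prop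

lemma convex_image_point (V : Fin 4 → E3) {s : Set (Fin 3 → ℝ)} (hs : Convex ℝ s) :
    Convex ℝ (point V '' s) := by
  have : point V '' s = (fun x => V 0 + x) '' (edgeMap V '' s) := by
    rw [image_image]; rfl
  rw [this]
  exact (hs.linear_image (edgeMap V)).translate (V 0)

/-- The coordinates `ξ` of the vertices. -/
def vertexCoord (i : Fin 4) : Fin 3 → ℝ := fun j => if (j : ℕ) < i then 1 else 0

lemma point_vertexCoord (V : Fin 4 → E3) (i : Fin 4) : point V (vertexCoord i) = V i := by
  rw [point_eq_weights]
  fin_cases i <;> simp [vertexCoord, Fin.sum_univ_four]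

/-- The barycentric coordinates of `point V ξ` are `1 - ξ₁, ξ₁ - ξ₂, ξ₂ - ξ₃, ξ₃`; they are
nonnegative exactly on the standard simplex. -/
lemma tet_eq_image (V : Fin 4 → E3) : tet V = point V '' simplex := by
  apply Subset.antisymm
  · refine convexHull_min ?_ (convex_image_point V ?_)
    · rintro _ ⟨i, rfl⟩
      refine ⟨vertexCoord i, ?_, point_vertexCoord V i⟩
      fin_cases i <;> simp [vertexCoord, simplex]
    · intro x hx y hy a b ha hb hab
      obtain ⟨h1, h2, h3, h4⟩ := hx
      obtain ⟨k1, k2, k3, k4⟩ := hy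
      simp only [simplex, mem_ofPred_eq, Pi.add_apply, Pi.smul_apply, smul_eq_mul]
      refine ⟨by positivity, by gcongr, by gcongr, ?_⟩
      nlinarith
  · rintro _ ⟨ξ, ⟨h1, h2, h3, h4⟩, rfl⟩
    rw [point_eq_weights]
    refine (convex_convexHull ℝ (range V)).sum_mem (fun i _ => ?_) ?_
      (fun i _ => subset_convexHull ℝ _ (mem_range_self i))
    · fin_cases i <;> simp <;> linarith
    · simp [Fin.sum_univ_four]

lemma commonSimplex_subset (c : CommonCase) (V : Fin 4 → E3) :
    convexHull ℝ (V '' {i | (i : ℕ) < c.numCV}) ⊆ point V '' {ξ | ∀ i ∈ kept c, ξ i = 0} := by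
  refine convexHull_min ?_ (convex_image_point V ?_)
  · rintro _ ⟨i, hi, rfl⟩
    refine ⟨vertexCoord i, fun j hj => ?_, point_vertexCoord V i⟩
    simp only [kept, mem_ofPred_eq] at hi hj
    simp only [vertexCoord]
    rw [if_neg (by omega)]
  · intro x hx y hy a b _ _ _ i hi
    simp [hx i hi, hy i hi]

section Common

variable {c : CommonCase} {V V' : Fin 4 → E3}

lemma pairDist_eq (h0 : V 0 = V' 0) (ξ u : Fin 3 → ℝ) :
    pairDist V V' ξ u = ‖edgeMap V ξ - edgeMap V' (ξ + u)‖ := by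
  rw [pairDist, point_eq, point_eq, h0, add_sub_add_left_eq_sub]

/-- A component outside `kept c` multiplies an edge vector joining two common vertices, and that
edge is the same for both tetrahedra. -/
lemma edgeMap_sub_congr (hcommon : ∀ i : Fin 4, (i : ℕ) < c.numCV → V i = V' i)
    {ξ ζ : Fin 3 → ℝ} (h : ∀ i ∈ kept c, ξ i = ζ i) :
    edgeMap V ξ - edgeMap V' ξ = edgeMap V ζ - edgeMap V' ζ := by
  simp only [edgeMap_apply, ← Finset.sum_sub_distrib, ← smul_sub]
  refine Finset.sum_congr rfl fun i _ => ?_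
  by_cases hi : i ∈ kept c
  · rw [h i hi]
  · have hi : (i : ℕ) + 1 < c.numCV := by simpa [kept] using hi
    rw [hcommon i.succ (by simpa using hi), hcommon i.castSucc (by simp; omega)]
    simp

lemma zero_lt_numCV (c : CommonCase) : 0 < c.numCV := by cases c <;> simp [CommonCase.numCV]

/-- The separation `x(ξ) - x'(ξ + w û)` is proportional to `w`. -/
lemma point_sub_point (hcommon : ∀ i : Fin 4, (i : ℕ) < c.numCV → V i = V' i)
    {ξ ζ u : Fin 3 → ℝ} {w : ℝ} (h : ∀ i ∈ kept c, ξ i = w * ζ i) :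
    point V ξ - point V' (ξ + w • u) = w • (edgeMap V ζ - edgeMap V' (ζ + u)) := by
  have h1 := edgeMap_sub_congr hcommon (ξ := ξ) (ζ := w • ζ) (by simpa using h)
  rw [point_eq, point_eq, hcommon 0 (zero_lt_numCV c), add_sub_add_left_eq_sub, map_add, map_add,
    map_smul, ← sub_sub, h1, map_smul, map_smul]
  module

lemma pairDist_smul (hcommon : ∀ i : Fin 4, (i : ℕ) < c.numCV → V i = V' i)
    {ξ ζ u : Fin 3 → ℝ} {w : ℝ} (hw : 0 ≤ w) (h : ∀ i ∈ kept c, ξ i = w * ζ i) :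
    pairDist V V' ξ (w • u) = w * pairDist V V' ζ u := by
  rw [pairDist_eq (hcommon 0 (zero_lt_numCV c)) ζ, pairDist, point_sub_point hcommon h, norm_smul,
    Real.norm_of_nonneg hw]

/-- If the points coincided, the point would lie in the common simplex, so the kept components of
`ξ` would vanish. Then `x(ξ) = x'(ξ)`, and injectivity of the second parametrization forces `u = 0`.
-/
lemma pairDist_pos (hV : AffineIndependent ℝ V) (hV' : AffineIndependent ℝ V')
    (hcommon : ∀ i : Fin 4, (i : ℕ) < c.numCV → V i = V' i) (hmeet : MeetInCommonSimplex c V V')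
    {ξ u : Fin 3 → ℝ} (hξ : ξ ∈ simplex) (hη : ξ + u ∈ simplex)
    (hne : (∃ i ∈ kept c, ξ i ≠ 0) ∨ u ≠ 0) : 0 < pairDist V V' ξ u := by
  rw [pairDist, norm_pos_iff, sub_ne_zero]
  intro heq
  have hmem : point V ξ ∈ tet V ∩ tet V' := by
    refine ⟨?_, ?_⟩
    · rw [tet_eq_image]; exact mem_image_of_mem _ hξ
    · rw [tet_eq_image, heq]; exact mem_image_of_mem _ hη
  rw [hmeet] at hmem
  obtain ⟨ζ, hζ, hζe⟩ := commonSimplex_subset c V hmem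
  have hζξ := point_injective hV hζe
  subst hζξ
  have h1 := edgeMap_sub_congr hcommon (ξ := ζ) (ζ := 0) (by simpa using hζ)
  rw [map_zero, map_zero, sub_zero, sub_eq_zero] at h1
  have h2 : point V ζ = point V' ζ := by
    rw [point_eq, point_eq, h1, hcommon 0 (zero_lt_numCV c)]
  rw [h2] at heq
  have h3 : u = 0 := by simpa using point_injective hV' heq
  rcases hne with ⟨i, hi, hi'⟩ | h
  · exact hi' (hζ i hi)
  · exact h h3

/-! ### The coefficients below the order of vanishing -/

lemma xiLimits_smul (w : ℝ) (u : Fin 3 → ℝ) (d : Fin 18) :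
    let l := xiLimits (w • u) d
    let a := xiLimits u d
    l.L₃ = w * a.L₃ ∧ l.U₃ = w * a.U₃ ∧ l.L₂ = w * a.L₂ ∧ l.U₂ = w * a.U₂ ∧
    l.L₁ = w * a.L₁ ∧ l.U₁ = w * a.U₁ := by
  obtain ⟨h1, h2, h3, h4, h5, h6⟩ := xiLimits_linear (w • u) d
  obtain ⟨k1, k2, k3, k4, k5, k6⟩ := xiLimits_linear u d
  simp only [h1, h2, h3, h4, h5, h6, k1, k2, k3, k4, k5, k6, Pi.smul_apply, smul_eq_mul]
  refine ⟨?_, ?_, ?_, ?_, ?_, ?_⟩ <;> ring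

lemma norm_integral_le_of_abs_le {f : ℝ → ℂ} {a b T C : ℝ} (ha : |a| ≤ T) (hb : |b| ≤ T)
    (h : ∀ s, |s| ≤ T → ‖f s‖ ≤ C) : ‖∫ s in a..b, f s‖ ≤ C * (2 * T) := by
  have hT : 0 ≤ T := (abs_nonneg a).trans ha
  have hC : 0 ≤ C := (norm_nonneg _).trans (h 0 (by simpa using hT))
  rw [abs_le] at ha hb
  refine (intervalIntegral.norm_integral_le_of_norm_le_const (C := C) fun s hs => h s ?_).trans ?_
  · rw [mem_uIoc] at hs
    rw [abs_le]
    rcases hs with hs | hs <;> constructor <;> linarith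
  · gcongr
    rw [abs_le]
    constructor <;> linarith

/-- A deliberately crude bound: the variables `s₃`, `s₂`, `s₁` range in absolute value below at most
`M`, `2 M`, `3 M`, since each lower limit adds a term of size `M` to the preceding variable. -/
lemma norm_pbar_le (P : MvPolynomial (Fin 3 ⊕ Fin 3) ℂ) (d : Fin 18) {u ξ : Fin 3 → ℝ} {M B : ℝ}
    (hM : 1 ≤ M) (hξ : ∀ i, |ξ i| ≤ M)
    (hl : let l := xiLimits u d
      |l.L₃| ≤ M ∧ |1 + l.U₃| ≤ M ∧ |l.L₂| ≤ M ∧ |1 + l.U₂| ≤ M ∧ |l.L₁| ≤ M ∧ |1 + l.U₁| ≤ M)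
    (hB : ∀ s : Fin 3 → ℝ, (∀ i, |s i| ≤ 3 * M) → (∀ i ∈ kept c, s i = ξ i) →
      ‖polyXi P V V' s u‖ ≤ B) :
    ‖pbar c P V V' d u ξ‖ ≤ B * (6 * M) ^ 3 := by
  obtain ⟨h3, k3, h2, k2, h1, k1⟩ := hl
  have add : ∀ {a b T T' : ℝ}, |a| ≤ T → |b| ≤ T' → |a + b| ≤ T + T' := fun {a b T T'} ha hb =>
    (abs_add_le _ _).trans (add_le_add ha hb)
  have vec : ∀ {a b e : ℝ}, |a| ≤ 3 * M → |b| ≤ 3 * M → |e| ≤ 3 * M →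
      ∀ i, |(![a, b, e] : Fin 3 → ℝ) i| ≤ 3 * M := by
    intro a b e ha hb he i
    fin_cases i
    exacts [ha, hb, he]
  have hM6 : 1 ≤ 6 * M := by linarith
  cases c with
  | edge =>
    have hk : ∀ s₁, ∀ i ∈ kept .edge, (![s₁, ξ 1, ξ 2] : Fin 3 → ℝ) i = ξ i := by
      intro s₁ i hi
      fin_cases i <;> simp [kept, CommonCase.numCV] at hi ⊢
    have h := norm_integral_le_of_abs_le (T := 3 * M) (C := B)
      (f := fun s₁ => polyXi P V V' ![s₁, ξ 1, ξ 2] u)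
      ((add (hξ 1) h1).trans (by linarith)) (k1.trans (by linarith)) fun s hs =>
        hB _ (vec hs ((hξ 1).trans (by linarith)) ((hξ 2).trans (by linarith))) (hk s)
    have hB0 : 0 ≤ B := (norm_nonneg _).trans (hB ξ (fun i => (hξ i).trans (by linarith))
      fun _ _ => rfl)
    refine h.trans ?_
    rw [show 2 * (3 * M) = 6 * M by ring]
    gcongr
    exact le_self_pow₀ hM6 (by norm_num)
  | face =>
    have hk : ∀ s₁ s₂, ∀ i ∈ kept .face, (![s₁, s₂, ξ 2] : Fin 3 → ℝ) i = ξ i := by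
      intro s₁ s₂ i hi
      fin_cases i <;> simp [kept, CommonCase.numCV] at hi ⊢
    have hB0 : 0 ≤ B := (norm_nonneg _).trans (hB ξ (fun i => (hξ i).trans (by linarith))
      fun _ _ => rfl)
    have h := norm_integral_le_of_abs_le (T := 2 * M) (C := B * (2 * (3 * M)))
      (f := fun s₂ => ∫ s₁ in (s₂ + (xiLimits u d).L₁)..(1 + (xiLimits u d).U₁),
        polyXi P V V' ![s₁, s₂, ξ 2] u)
      ((add (hξ 2) h2).trans (by linarith)) (k2.trans (by linarith)) fun s₂ hs₂ =>
      norm_integral_le_of_abs_le ((add hs₂ h1).trans (by linarith)) (k1.trans (by linarith))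
        fun s hs => hB _ (vec hs (hs₂.trans (by linarith)) ((hξ 2).trans (by linarith))) (hk s s₂)
    refine h.trans ?_
    rw [show B * (2 * (3 * M)) * (2 * (2 * M)) = B * (6 * M * (4 * M)) by ring]
    gcongr
    calc 6 * M * (4 * M) ≤ 6 * M * (6 * M) := by gcongr; linarith
      _ = (6 * M) ^ 2 := by ring
      _ ≤ (6 * M) ^ 3 := pow_le_pow_right₀ hM6 (by norm_num)
  | tetrahedron =>
    have hk : ∀ s₁ s₂ s₃, ∀ i ∈ kept .tetrahedron, (![s₁, s₂, s₃] : Fin 3 → ℝ) i = ξ i := by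
      intro s₁ s₂ s₃ i hi
      simp [kept, CommonCase.numCV] at hi
      omega
    have hB0 : 0 ≤ B := (norm_nonneg _).trans (hB ξ (fun i => (hξ i).trans (by linarith))
      fun _ _ => rfl)
    have h := norm_integral_le_of_abs_le (T := M) (C := B * (2 * (3 * M)) * (2 * (2 * M)))
      (f := fun s₃ => ∫ s₂ in (s₃ + (xiLimits u d).L₂)..(1 + (xiLimits u d).U₂),
        ∫ s₁ in (s₂ + (xiLimits u d).L₁)..(1 + (xiLimits u d).U₁), polyXi P V V' ![s₁, s₂, s₃] u)
      (h3.trans (by linarith)) (k3.trans (by linarith)) fun s₃ hs₃ =>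
      norm_integral_le_of_abs_le ((add hs₃ h2).trans (by linarith)) (k2.trans (by linarith))
        fun s₂ hs₂ =>
      norm_integral_le_of_abs_le ((add hs₂ h1).trans (by linarith)) (k1.trans (by linarith))
        fun s hs => hB _ (vec hs (hs₂.trans (by linarith)) (hs₃.trans (by linarith))) (hk s s₂ s₃)
    refine h.trans ?_
    rw [show B * (2 * (3 * M)) * (2 * (2 * M)) * (2 * M) = B * ((6 * M) * (4 * M) * (2 * M)) by ring,
      show (6 * M) ^ 3 = (6 * M) * (6 * M) * (6 * M) by ring]
    gcongr <;> linarith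

/-- The separation is `w • D` whatever the free components of `ξ`, so the integrand, and with it the
integral over bounded limits, is `O(w ^ m)`. A polynomial in `w` with this bound has no lower terms.
-/
lemma pcoeff_eq_zero (hcommon : ∀ i : Fin 4, (i : ℕ) < c.numCV → V i = V' i)
    {P : MvPolynomial (Fin 3 ⊕ Fin 3) ℂ} {m : ℕ} (hP : VanishesOnDiagonal P m) (d : Fin 18) {n : ℕ}
    (hn : n < m) (y : Fin c.dimY → ℝ) : pcoeff c P V V' d n y = 0 := by
  obtain ⟨-, e⟩ := pbarDuffy_eq_sum c P V V' d
  set R := duffy c d y with hR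
  set l := xiLimits R.u d with hl
  set M := 1 + (|l.L₃| + |l.U₃| + |l.L₂| + |l.U₂| + |l.L₁| + |l.U₁|) + ∑ i, |R.xi i| with hM
  have hsum : ∀ i, |R.xi i| ≤ ∑ i, |R.xi i| := fun i =>
    Finset.single_le_sum (f := fun i => |R.xi i|) (fun _ _ => abs_nonneg _) (Finset.mem_univ i)
  have hsum0 : 0 ≤ ∑ i, |R.xi i| := Finset.sum_nonneg fun _ _ => abs_nonneg _
  have a1 := abs_nonneg l.L₃
  have a2 := abs_nonneg l.U₃
  have a3 := abs_nonneg l.L₂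
  have a4 := abs_nonneg l.U₂
  have a5 := abs_nonneg l.L₁
  have a6 := abs_nonneg l.U₁
  set D := edgeMap V R.xi - edgeMap V' (R.xi + R.u) with hD
  obtain ⟨r, hr⟩ := (isCompact_closedBall (0 : Fin 3 → ℝ) (3 * M)).exists_bound_of_continuousOn
    (f := point V) (continuous_point V).continuousOn
  obtain ⟨C, hC0, hC⟩ := hP.exists_bound (max r ‖D‖)
  have key : ∀ w : ℝ, 0 < w → w ≤ 1 →
      ‖pbarDuffy c P V V' d y w‖ ≤ C * ‖D‖ ^ m * (6 * M) ^ 3 * w ^ m := by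
    intro w hw hw1
    have hmul : ∀ a, |w * a| ≤ |a| := fun a => by
      rw [abs_mul, abs_of_pos hw]
      exact mul_le_of_le_one_left (abs_nonneg a) hw1
    have hadd : ∀ a, |1 + w * a| ≤ 1 + |a| := fun a =>
      (abs_add_le _ _).trans (by rw [abs_one]; linarith [hmul a])
    have hb := norm_pbar_le (c := c) (V := V) (V' := V') P d (u := w • R.u) (ξ := w • R.xi) (M := M)
      (B := C * (w * ‖D‖) ^ m) (by linarith)
      (fun i => (hmul _).trans ((hsum i).trans (by linarith))) (by
        obtain ⟨k1, k2, k3, k4, k5, k6⟩ := xiLimits_smul w R.u d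
        simp only [k1, k2, k3, k4, k5, k6]
        refine ⟨(hmul _).trans ?_, (hadd _).trans ?_, (hmul _).trans ?_, (hadd _).trans ?_,
          (hmul _).trans ?_, (hadd _).trans ?_⟩ <;> linarith)
      (fun s hs hsk => by
        have h1 := point_sub_point (u := R.u) (ζ := R.xi) (w := w) hcommon (ξ := s)
          (by simpa using hsk)
        rw [polyXi, show point V' (s + w • R.u) = point V s + -(w • D) by
          rw [← h1]; abel]
        have h2 : ‖-(w • D)‖ = w * ‖D‖ := by rw [norm_neg, norm_smul, Real.norm_of_nonneg hw.le]
        rw [← h2]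
        refine hC _ _ ((hr s ?_).trans (le_max_left _ _)) ?_
        · rw [mem_closedBall_zero_iff]
          exact (pi_norm_le_iff_of_nonneg (by linarith)).2 hs
        · rw [h2]
          exact (mul_le_of_le_one_left (norm_nonneg D) hw1).trans (le_max_right _ _))
    refine hb.trans (le_of_eq ?_)
    rw [mul_pow]
    ring
  have := coeff_eq_zero_of_bound (m := m) (n := n) (C := C * ‖D‖ ^ m * (6 * M) ^ 3)
    (p := ∑ k ∈ Finset.range (numTerms c P),
      Polynomial.C (pcoeff c P V V' d k y) * Polynomial.X ^ k) (fun w hw hw1 => by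
      have := key w hw hw1
      rw [e] at this
      simpa [Polynomial.eval_finsetSum] using this) hn
  rw [Polynomial.finsetSum_coeff] at this
  simp only [Polynomial.coeff_C_mul_X_pow, Finset.sum_ite_eq, Finset.mem_range] at this
  by_cases hnN : n < numTerms c P
  · rwa [if_pos hnN] at this
  -- Beyond the range of the expansion the bound says nothing; there the Taylor coefficient is zero
  -- because the expansion is finite.
  · have hfun : pbarDuffy c P V V' d y = fun w : ℝ => ∑ k ∈ Finset.range (numTerms c P),
        (if k < numTerms c P then pcoeff c P V V' d k y else 0) * (w : ℂ) ^ k := by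
      funext w
      rw [e]
      refine Finset.sum_congr rfl fun k hk => ?_
      rw [if_pos (Finset.mem_range.1 hk)]
    rw [pcoeff, hfun, iteratedDeriv_sum_div_factorial _ _
      (fun k => if k < numTerms c P then pcoeff c P V V' d k y else 0)
      (fun k hk => if_neg (not_lt.2 hk)), if_neg hnN]

end Common

/-! ### The cones of the difference variable -/

/-- Case analysis that leaves numerals as indices, so that the row lemmas below apply as rewriting
rules. -/
lemma forall_fin_eighteen {p : Fin 18 → Prop} (h0 : p 0) (h1 : p 1) (h2 : p 2) (h3 : p 3)
    (h4 : p 4) (h5 : p 5) (h6 : p 6) (h7 : p 7) (h8 : p 8) (h9 : p 9) (h10 : p 10) (h11 : p 11)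
    (h12 : p 12) (h13 : p 13) (h14 : p 14) (h15 : p 15) (h16 : p 16) (h17 : p 17) (d : Fin 18) :
    p d := by
  fin_cases d <;> assumption

lemma xiLimits_rows (u : Fin 3 → ℝ) :
    xiLimits u 0 = ⟨0, -u 2, u 2 - u 1, -u 1, u 1 - u 0, -u 0⟩ ∧
    xiLimits u 1 = ⟨0, -u 1, 0, -u 1, u 1 - u 0, -u 0⟩ ∧
    xiLimits u 2 = ⟨-u 2, -u 1, 0, -u 1, u 1 - u 0, -u 0⟩ ∧
    xiLimits u 3 = ⟨0, u 1 - u 0 - u 2, u 2 - u 1, -u 0, 0, -u 0⟩ ∧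
    xiLimits u 4 = ⟨0, -u 0, 0, -u 0, 0, -u 0⟩ ∧
    xiLimits u 5 = ⟨-u 2, -u 0, 0, -u 0, 0, -u 0⟩ ∧
    xiLimits u 6 = ⟨0, u 1 - u 0 - u 2, u 2 - u 1, -u 0, 0, -u 0⟩ ∧
    xiLimits u 7 = ⟨-u 2, u 1 - u 0 - u 2, u 2 - u 1, -u 0, 0, -u 0⟩ ∧
    xiLimits u 8 = ⟨-u 2, -u 0, 0, -u 0, 0, -u 0⟩ ∧
    xiLimits u 9 = ⟨0, u 0 - u 2, u 2 - u 1, u 0 - u 1, u 1 - u 0, 0⟩ ∧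
    xiLimits u 10 = ⟨0, u 0 - u 1, 0, u 0 - u 1, u 1 - u 0, 0⟩ ∧
    xiLimits u 11 = ⟨-u 2, u 0 - u 1, 0, u 0 - u 1, u 1 - u 0, 0⟩ ∧
    xiLimits u 12 = ⟨0, u 0 - u 2, u 2 - u 1, u 0 - u 1, u 1 - u 0, 0⟩ ∧
    xiLimits u 13 = ⟨-u 2, u 0 - u 2, u 2 - u 1, u 0 - u 1, u 1 - u 0, 0⟩ ∧
    xiLimits u 14 = ⟨-u 2, u 0 - u 1, 0, u 0 - u 1, u 1 - u 0, 0⟩ ∧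
    xiLimits u 15 = ⟨0, u 1 - u 2, u 2 - u 1, 0, 0, 0⟩ ∧
    xiLimits u 16 = ⟨-u 2, u 1 - u 2, u 2 - u 1, 0, 0, 0⟩ ∧
    xiLimits u 17 = ⟨-u 2, 0, 0, 0, 0, 0⟩ :=
  ⟨rfl, rfl, rfl, rfl, rfl, rfl, rfl, rfl, rfl,
    rfl, rfl, rfl, rfl, rfl, rfl, rfl, rfl, rfl⟩

/-- Unimodular parametrizations `u = A_d β` of the 18 cones; with `sw` the last two
parameters of the second cone are exchanged. -/
def coneVec (sw : Bool) (β : Fin 3 → ℝ) : Fin 18 → Fin 3 → ℝ :=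
  ![![β 2, β 1, β 0],
    bif sw then ![β 2, β 0, β 1] else ![β 1, β 0, β 2],
    ![β 2, β 1, β 1 - β 0],
    ![β 1, β 2, β 0 - β 1 + β 2],
    ![β 0, β 1, β 2],
    ![β 1, β 2, β 1 - β 0],
    ![β 2, β 2 - β 1, β 0 - β 1],
    ![β 0 - β 1, -β 1, -β 2],
    ![β 1 - β 2, -β 2, β 1 - β 0 - β 2],
    ![-β 2, β 1 - β 2, β 0 - β 2],
    ![-β 2, β 0 - β 2, β 1 - β 2],
    ![-β 2, β 1 - β 2, β 1 - β 0],
    ![-β 1, -β 2, β 0 - β 1],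
    ![-β 0, -β 1, -β 2],
    ![-β 1, -β 2, β 1 - β 0 - β 2],
    ![-β 2, -β 1, β 0 - β 1],
    ![-β 1, -β 0, β 2 - β 0],
    ![-β 2, -β 1, -β 0]]

lemma coneVec_rows (sw : Bool) (β : Fin 3 → ℝ) :
    coneVec sw β 0 = ![β 2, β 1, β 0] ∧
    coneVec sw β 1 = (bif sw then ![β 2, β 0, β 1] else ![β 1, β 0, β 2]) ∧
    coneVec sw β 2 = ![β 2, β 1, β 1 - β 0] ∧
    coneVec sw β 3 = ![β 1, β 2, β 0 - β 1 + β 2] ∧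
    coneVec sw β 4 = ![β 0, β 1, β 2] ∧
    coneVec sw β 5 = ![β 1, β 2, β 1 - β 0] ∧
    coneVec sw β 6 = ![β 2, β 2 - β 1, β 0 - β 1] ∧
    coneVec sw β 7 = ![β 0 - β 1, -β 1, -β 2] ∧
    coneVec sw β 8 = ![β 1 - β 2, -β 2, β 1 - β 0 - β 2] ∧
    coneVec sw β 9 = ![-β 2, β 1 - β 2, β 0 - β 2] ∧
    coneVec sw β 10 = ![-β 2, β 0 - β 2, β 1 - β 2] ∧
    coneVec sw β 11 = ![-β 2, β 1 - β 2, β 1 - β 0] ∧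
    coneVec sw β 12 = ![-β 1, -β 2, β 0 - β 1] ∧
    coneVec sw β 13 = ![-β 0, -β 1, -β 2] ∧
    coneVec sw β 14 = ![-β 1, -β 2, β 1 - β 0 - β 2] ∧
    coneVec sw β 15 = ![-β 2, -β 1, β 0 - β 1] ∧
    coneVec sw β 16 = ![-β 1, -β 0, β 2 - β 0] ∧
    coneVec sw β 17 = ![-β 2, -β 1, -β 0] :=
  ⟨rfl, rfl, rfl, rfl, rfl, rfl, rfl, rfl, rfl,
    rfl, rfl, rfl, rfl, rfl, rfl, rfl, rfl, rfl⟩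

/-- The inverses of the parametrizations `coneVec`. -/
def coneInv (sw : Bool) (u : Fin 3 → ℝ) : Fin 18 → Fin 3 → ℝ :=
  ![![u 2, u 1, u 0],
    bif sw then ![u 1, u 2, u 0] else ![u 1, u 0, u 2],
    ![u 1 - u 2, u 1, u 0],
    ![u 2 + u 0 - u 1, u 0, u 1],
    ![u 0, u 1, u 2],
    ![u 0 - u 2, u 0, u 1],
    ![u 2 + u 0 - u 1, u 0 - u 1, u 0],
    ![u 0 - u 1, -u 1, -u 2],
    ![u 0 - u 2, u 0 - u 1, -u 1],
    ![u 2 - u 0, u 1 - u 0, -u 0],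
    ![u 1 - u 0, u 2 - u 0, -u 0],
    ![u 1 - u 0 - u 2, u 1 - u 0, -u 0],
    ![u 2 - u 0, -u 0, -u 1],
    ![-u 0, -u 1, -u 2],
    ![u 1 - u 0 - u 2, -u 0, -u 1],
    ![u 2 - u 1, -u 1, -u 0],
    ![-u 1, -u 0, u 2 - u 1],
    ![-u 2, -u 1, -u 0]]

lemma coneInv_rows (sw : Bool) (u : Fin 3 → ℝ) :
    coneInv sw u 0 = ![u 2, u 1, u 0] ∧
    coneInv sw u 1 = (bif sw then ![u 1, u 2, u 0] else ![u 1, u 0, u 2]) ∧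
    coneInv sw u 2 = ![u 1 - u 2, u 1, u 0] ∧
    coneInv sw u 3 = ![u 2 + u 0 - u 1, u 0, u 1] ∧
    coneInv sw u 4 = ![u 0, u 1, u 2] ∧
    coneInv sw u 5 = ![u 0 - u 2, u 0, u 1] ∧
    coneInv sw u 6 = ![u 2 + u 0 - u 1, u 0 - u 1, u 0] ∧
    coneInv sw u 7 = ![u 0 - u 1, -u 1, -u 2] ∧
    coneInv sw u 8 = ![u 0 - u 2, u 0 - u 1, -u 1] ∧
    coneInv sw u 9 = ![u 2 - u 0, u 1 - u 0, -u 0] ∧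
    coneInv sw u 10 = ![u 1 - u 0, u 2 - u 0, -u 0] ∧
    coneInv sw u 11 = ![u 1 - u 0 - u 2, u 1 - u 0, -u 0] ∧
    coneInv sw u 12 = ![u 2 - u 0, -u 0, -u 1] ∧
    coneInv sw u 13 = ![-u 0, -u 1, -u 2] ∧
    coneInv sw u 14 = ![u 1 - u 0 - u 2, -u 0, -u 1] ∧
    coneInv sw u 15 = ![u 2 - u 1, -u 1, -u 0] ∧
    coneInv sw u 16 = ![-u 1, -u 0, u 2 - u 1] ∧
    coneInv sw u 17 = ![-u 2, -u 1, -u 0] :=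
  ⟨rfl, rfl, rfl, rfl, rfl, rfl, rfl, rfl, rfl,
    rfl, rfl, rfl, rfl, rfl, rfl, rfl, rfl, rfl⟩

/-- The two cones which are not simplicial. -/
def isPyramid (d : Fin 18) : Bool := d = 1 || d = 16

/-- The parameter domain of a cone. -/
def coneDom (p : Bool) : Set (Fin 3 → ℝ) :=
  {β | 0 < β 2 ∧ 0 < β 1 ∧ β 1 < β 0 ∧ β 2 < bif p then β 0 else β 1}

/-- The shift `ξ_i - α_i`. -/
def shift (d : Fin 18) (u : Fin 3 → ℝ) : Fin 3 → ℝ :=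
  ![(xiLimits u d).U₁, (xiLimits u d).U₂, (xiLimits u d).U₃]


@[simp] lemma shift_zero (d : Fin 18) (u : Fin 3 → ℝ) : shift d u 0 = (xiLimits u d).U₁ := rfl
@[simp] lemma shift_one (d : Fin 18) (u : Fin 3 → ℝ) : shift d u 1 = (xiLimits u d).U₂ := rfl
@[simp] lemma shift_two (d : Fin 18) (u : Fin 3 → ℝ) : shift d u 2 = (xiLimits u d).U₃ := rfl

lemma coneVec_true (β : Fin 3 → ℝ) (d : Fin 18) :
    coneVec true β d = coneVec false (if d = 1 then ![β 0, β 2, β 1] else β) d := by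
  revert d
  apply forall_fin_eighteen <;> simp [coneVec_rows]

lemma coneInv_true (u : Fin 3 → ℝ) (d : Fin 18) :
    coneInv true u d = if d = 1 then ![u 1, u 2, u 0] else coneInv false u d := by
  revert d
  apply forall_fin_eighteen <;> simp [coneInv_rows]

lemma vec3_ext {a b c : ℝ} {u : Fin 3 → ℝ} (h0 : a = u 0) (h1 : b = u 1) (h2 : c = u 2) :
    ![a, b, c] = u := by
  ext i
  fin_cases i
  exacts [h0, h1, h2]

lemma coneVec_coneInv (sw : Bool) (u : Fin 3 → ℝ) (d : Fin 18) :
    coneVec sw (coneInv sw u d) d = u := by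
  revert d
  cases sw <;> apply forall_fin_eighteen <;> simp only [coneVec_rows, coneInv_rows, cond_true,
    cond_false] <;> apply vec3_ext <;> simp <;> ring

lemma coneInv_coneVec (sw : Bool) (β : Fin 3 → ℝ) (d : Fin 18) :
    coneInv sw (coneVec sw β d) d = β := by
  revert d
  cases sw <;> apply forall_fin_eighteen <;> simp only [coneVec_rows, coneInv_rows, cond_true,
    cond_false] <;> apply vec3_ext <;> simp <;> ring

/-- The first parameter is the gauge of the cone: the slice over `u` is the simplex `1 ≥ α₁ ≥ α₂ ≥
α₃ ≥ β 0`, nonempty exactly for `β 0 ≤ 1`. -/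
lemma L₃_sub_U₃ (sw : Bool) (β : Fin 3 → ℝ) (d : Fin 18) :
    (xiLimits (coneVec sw β d) d).L₃ - (xiLimits (coneVec sw β d) d).U₃ = β 0 := by
  revert d
  cases sw <;> apply forall_fin_eighteen <;> simp [coneVec_rows, xiLimits_rows] <;> ring

/-- The closure of `coneDom`. -/
def coneDomClosed (p : Bool) : Set (Fin 3 → ℝ) :=
  {β | 0 ≤ β 2 ∧ 0 ≤ β 1 ∧ β 1 ≤ β 0 ∧ β 2 ≤ bif p then β 0 else β 1}

lemma coneDom_subset (p : Bool) : coneDom p ⊆ coneDomClosed p := fun _ h =>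
  ⟨h.1.le, h.2.1.le, h.2.2.1.le, h.2.2.2.le⟩

lemma isPyramid_rows : isPyramid 0 = false ∧ isPyramid 1 = true ∧ isPyramid 2 = false ∧
    isPyramid 3 = false ∧ isPyramid 4 = false ∧ isPyramid 5 = false ∧ isPyramid 6 = false ∧
    isPyramid 7 = false ∧ isPyramid 8 = false ∧ isPyramid 9 = false ∧ isPyramid 10 = false ∧
    isPyramid 11 = false ∧ isPyramid 12 = false ∧ isPyramid 13 = false ∧ isPyramid 14 = false ∧
    isPyramid 15 = false ∧ isPyramid 16 = true ∧ isPyramid 17 = false := by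
  decide

/-- Together with `xiLimits_extremal` this identifies each limit with the minimum or maximum of its
two candidates. -/
lemma xiLimits_cases (u : Fin 3 → ℝ) (d : Fin 18) :
    ((xiLimits u d).U₁ = 0 ∨ (xiLimits u d).U₁ = -u 0) ∧
    ((xiLimits u d).L₁ = 0 ∨ (xiLimits u d).L₁ = u 1 - u 0) ∧
    ((xiLimits u d).L₂ = 0 ∨ (xiLimits u d).L₂ = u 2 - u 1) ∧
    ((xiLimits u d).L₃ = 0 ∨ (xiLimits u d).L₃ = -u 2) := by
  revert d
  apply forall_fin_eighteen <;> simp only [xiLimits_rows, true_or, or_true, true_and]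

lemma xiLimits_extremal_false (d : Fin 18) {β : Fin 3 → ℝ} (h : β ∈ coneDomClosed (isPyramid d)) :
    let u := coneVec false β d
    let l := xiLimits u d
    (l.U₁ ≤ 0 ∧ l.U₁ ≤ -u 0) ∧ (0 ≤ l.L₁ ∧ u 1 - u 0 ≤ l.L₁) ∧ (0 ≤ l.L₂ ∧ u 2 - u 1 ≤ l.L₂) ∧
      0 ≤ l.L₃ ∧ -u 2 ≤ l.L₃ := by
  obtain ⟨h1, h2, h3, h4⟩ := h
  revert d
  apply forall_fin_eighteen <;> intro h4 <;>
    simp only [isPyramid_rows, cond_true, cond_false] at h4 <;>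
    simp [coneVec_rows, xiLimits_rows] <;>
    (try constructorm* _ ∧ _) <;> linarith

/-- Over each cone, `U₁ = min (0, -u₁)`, `L₁ = max (0, u₂ - u₁)`, `L₂ = max (0, u₃ - u₂)` and
`L₃ = max (0, -u₃)`. -/
lemma xiLimits_extremal (sw : Bool) (d : Fin 18) {β : Fin 3 → ℝ}
    (h : β ∈ coneDomClosed (isPyramid d)) :
    let u := coneVec sw β d
    let l := xiLimits u d
    (l.U₁ ≤ 0 ∧ l.U₁ ≤ -u 0) ∧ (0 ≤ l.L₁ ∧ u 1 - u 0 ≤ l.L₁) ∧ (0 ≤ l.L₂ ∧ u 2 - u 1 ≤ l.L₂) ∧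
      0 ≤ l.L₃ ∧ -u 2 ≤ l.L₃ := by
  cases sw
  · exact xiLimits_extremal_false d h
  · rw [coneVec_true]
    refine xiLimits_extremal_false d ?_
    -- The domain of the pyramid `0 < β₁, β₂ < β₀` is symmetric in its last two parameters; this is
    -- also true of its closure.
    split_ifs with hd
    · subst hd
      obtain ⟨h1, h2, h3, h4⟩ := h
      simp only [isPyramid_rows, cond_true] at h4
      simp only [coneDomClosed, isPyramid_rows, cond_true, mem_ofPred_eq]
      exact ⟨h2, h1, h4, h3⟩
    · exact h

/-! ### Cells over the cones. -/

/-- The interiors of the simplices `1 ≥ α₁ ≥ α₂ ≥ α₃ ≥ β₁` over the cones. -/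
def cellDom (p : Bool) : Set ((Fin 3 → ℝ) × (Fin 3 → ℝ)) :=
  {z | z.1 ∈ coneDom p ∧ z.1 0 < z.2 2 ∧ z.2 2 < z.2 1 ∧ z.2 1 < z.2 0 ∧ z.2 0 < 1}

/-- The pair `(ξ, ξ + u)` with the parameters `(β, α)`. -/
def cellMap (sw : Bool) (d : Fin 18) (z : (Fin 3 → ℝ) × (Fin 3 → ℝ)) :
    (Fin 3 → ℝ) × (Fin 3 → ℝ) :=
  let u := coneVec sw z.1 d
  let ξ := z.2 + shift d u
  (ξ, ξ + u)

lemma cellMap_mem (sw : Bool) (d : Fin 18) {β α : Fin 3 → ℝ} (h : β ∈ coneDomClosed (isPyramid d))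
    (h' : β 0 ≤ α 2 ∧ α 2 ≤ α 1 ∧ α 1 ≤ α 0 ∧ α 0 ≤ 1) :
    (cellMap sw d (β, α)).1 ∈ simplex ∧ (cellMap sw d (β, α)).2 ∈ simplex := by
  have h0 := L₃_sub_U₃ sw β d
  have h2 := xiLimits_U₂ (coneVec sw β d) d
  have h3 := xiLimits_U₃ (coneVec sw β d) d
  obtain ⟨⟨k1, k2⟩, ⟨k3, k4⟩, ⟨k5, k6⟩, k7, k8⟩ := xiLimits_extremal sw d h
  obtain ⟨m1, m2, m3, m4⟩ := h'
  simp only [cellMap, simplex, mem_ofPred_eq, Pi.add_apply, shift_zero, shift_one, shift_two]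
  refine ⟨⟨?_, ?_, ?_, ?_⟩, ?_, ?_, ?_, ?_⟩ <;> linarith

/-- The interior of the standard simplex. -/
def simplexInt : Set (Fin 3 → ℝ) := {ξ | 0 < ξ 2 ∧ ξ 2 < ξ 1 ∧ ξ 1 < ξ 0 ∧ ξ 0 < 1}

/-- Each strict inequality for `α` is one of the inequalities for `ξ` or for `ξ + u`, according to
which candidate the limit equals. -/
lemma mem_cellDom (sw : Bool) (d : Fin 18) {β α : Fin 3 → ℝ} (h : β ∈ coneDom (isPyramid d))
    (h1 : (cellMap sw d (β, α)).1 ∈ simplexInt) (h2 : (cellMap sw d (β, α)).2 ∈ simplexInt) :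
    (β, α) ∈ cellDom (isPyramid d) := by
  refine ⟨h, ?_⟩
  have e0 := L₃_sub_U₃ sw β d
  have e2 := xiLimits_U₂ (coneVec sw β d) d
  have e3 := xiLimits_U₃ (coneVec sw β d) d
  obtain ⟨k1, k2, k3, k4⟩ := xiLimits_cases (coneVec sw β d) d
  simp only [cellMap, simplexInt, mem_ofPred_eq, Pi.add_apply, shift_zero, shift_one,
    shift_two] at h1 h2
  obtain ⟨m1, m2, m3, m4⟩ := h1
  obtain ⟨n1, n2, n3, n4⟩ := h2
  refine ⟨?_, ?_, ?_, ?_⟩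
  · rcases k4 with k | k <;> linarith
  · rcases k3 with k | k <;> linarith
  · rcases k2 with k | k <;> linarith
  · rcases k1 with k | k <;> linarith

/-- The row index encodes the order pattern of `u`: `d < 9` is the sign of `u 0`, the digit `d % 9 /
3` says whether `u 1` lies above, between or below `0` and `u 0`, and `d % 3` does the same for `u
2` relative to `0` and `u 1`. -/
lemma sign_of_coneInv_mem {u : Fin 3 → ℝ} {d : Fin 18}
    (h : coneInv false u d ∈ coneDom (isPyramid d)) :
    ((d : ℕ) < 9 ∧ 0 < u 0 ∨ 9 ≤ (d : ℕ) ∧ u 0 < 0) ∧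
    ((d : ℕ) % 9 / 3 = 0 ∧ 0 < u 1 ∧ u 0 < u 1 ∨
      (d : ℕ) % 9 / 3 = 1 ∧ (0 < u 1 ∧ u 1 < u 0 ∨ u 1 < 0 ∧ u 0 < u 1) ∨
      (d : ℕ) % 9 / 3 = 2 ∧ u 1 < 0 ∧ u 1 < u 0) ∧
    ((d : ℕ) % 3 = 0 ∧ 0 < u 2 ∧ u 1 < u 2 ∨
      (d : ℕ) % 3 = 1 ∧ (0 < u 2 ∧ u 2 < u 1 ∨ u 2 < 0 ∧ u 1 < u 2) ∨
      (d : ℕ) % 3 = 2 ∧ u 2 < 0 ∧ u 2 < u 1) := by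
  obtain ⟨h1, h2, h3, h4⟩ := h
  revert d
  apply forall_fin_eighteen <;> intro h1 h2 h3 h4 <;>
    simp [isPyramid_rows, coneInv_rows] at h1 h2 h3 h4 <;> refine ⟨?_, ?_, ?_⟩ <;> norm_num <;>
    first
    | linarith
    | (constructor <;> linarith)
    | (left; constructor <;> linarith)
    | (right; constructor <;> linarith)

/-- The order pattern of `u` determines the three digits of the index. -/
lemma coneInv_disjoint {u : Fin 3 → ℝ} {d d' : Fin 18}
    (h : coneInv false u d ∈ coneDom (isPyramid d))
    (h' : coneInv false u d' ∈ coneDom (isPyramid d')) : d = d' := by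
  obtain ⟨a, b, c⟩ := sign_of_coneInv_mem h
  obtain ⟨a', b', c'⟩ := sign_of_coneInv_mem h'
  have e1 : (d : ℕ) < 9 ↔ (d' : ℕ) < 9 := by
    rcases a with a | a <;> rcases a' with a' | a' <;>
      first | (exfalso; linarith [a.2, a'.2]) | omega
  have e2 : (d : ℕ) % 9 / 3 = (d' : ℕ) % 9 / 3 := by
    rcases b with b | ⟨b, b1 | b1⟩ | b <;> rcases b' with b' | ⟨b', b1' | b1'⟩ | b' <;>
      first | omega | (exfalso; linarith)
  have e3 : (d : ℕ) % 3 = (d' : ℕ) % 3 := by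
    rcases c with c | ⟨c, c1 | c1⟩ | c <;> rcases c' with c' | ⟨c', c1' | c1'⟩ | c' <;>
      first | omega | (exfalso; linarith)
  have := d.2
  have := d'.2
  exact Fin.ext (by omega)

lemma exists_coneInv_mem {u : Fin 3 → ℝ} (h0 : u 0 ≠ 0) (h1 : u 1 ≠ 0) (h2 : u 2 ≠ 0)
    (h10 : u 1 ≠ u 0) (h21 : u 2 ≠ u 1) : ∃ d, coneInv false u d ∈ coneDom (isPyramid d) := by
  rcases h0.lt_or_gt with a | a
  · rcases h1.lt_or_gt with b | b
    · rcases h10.lt_or_gt with e | e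
      · rcases h2.lt_or_gt with c | c
        · rcases h21.lt_or_gt with f | f
          · refine ⟨17, ?_, ?_, ?_, ?_⟩ <;> simp [isPyramid_rows, coneInv_rows] <;> linarith
          · refine ⟨16, ?_, ?_, ?_, ?_⟩ <;> simp [isPyramid_rows, coneInv_rows] <;> linarith
        · refine ⟨15, ?_, ?_, ?_, ?_⟩ <;> simp [isPyramid_rows, coneInv_rows] <;> linarith
      · rcases h2.lt_or_gt with c | c
        · rcases h21.lt_or_gt with f | f
          · refine ⟨14, ?_, ?_, ?_, ?_⟩ <;> simp [isPyramid_rows, coneInv_rows] <;> linarith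
          · refine ⟨13, ?_, ?_, ?_, ?_⟩ <;> simp [isPyramid_rows, coneInv_rows] <;> linarith
        · refine ⟨12, ?_, ?_, ?_, ?_⟩ <;> simp [isPyramid_rows, coneInv_rows] <;> linarith
    · rcases h2.lt_or_gt with c | c
      · refine ⟨11, ?_, ?_, ?_, ?_⟩ <;> simp [isPyramid_rows, coneInv_rows] <;> linarith
      · rcases h21.lt_or_gt with f | f
        · refine ⟨10, ?_, ?_, ?_, ?_⟩ <;> simp [isPyramid_rows, coneInv_rows] <;> linarith
        · refine ⟨9, ?_, ?_, ?_, ?_⟩ <;> simp [isPyramid_rows, coneInv_rows] <;> linarith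
  · rcases h1.lt_or_gt with b | b
    · rcases h2.lt_or_gt with c | c
      · rcases h21.lt_or_gt with f | f
        · refine ⟨8, ?_, ?_, ?_, ?_⟩ <;> simp [isPyramid_rows, coneInv_rows] <;> linarith
        · refine ⟨7, ?_, ?_, ?_, ?_⟩ <;> simp [isPyramid_rows, coneInv_rows] <;> linarith
      · refine ⟨6, ?_, ?_, ?_, ?_⟩ <;> simp [isPyramid_rows, coneInv_rows] <;> linarith
    · rcases h10.lt_or_gt with e | e
      · rcases h2.lt_or_gt with c | c
        · refine ⟨5, ?_, ?_, ?_, ?_⟩ <;> simp [isPyramid_rows, coneInv_rows] <;> linarith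
        · rcases h21.lt_or_gt with f | f
          · refine ⟨4, ?_, ?_, ?_, ?_⟩ <;> simp [isPyramid_rows, coneInv_rows] <;> linarith
          · refine ⟨3, ?_, ?_, ?_, ?_⟩ <;> simp [isPyramid_rows, coneInv_rows] <;> linarith
      · rcases h2.lt_or_gt with c | c
        · refine ⟨2, ?_, ?_, ?_, ?_⟩ <;> simp [isPyramid_rows, coneInv_rows] <;> linarith
        · rcases h21.lt_or_gt with f | f
          · refine ⟨1, ?_, ?_, ?_, ?_⟩ <;> simp [isPyramid_rows, coneInv_rows] <;> linarith
          · refine ⟨0, ?_, ?_, ?_, ?_⟩ <;> simp [isPyramid_rows, coneInv_rows] <;> linarith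

/-! ### The partition of the product of two simplices -/

lemma continuous_coneVec (sw : Bool) (d : Fin 18) : Continuous fun β => coneVec sw β d := by
  revert d
  cases sw <;> apply forall_fin_eighteen <;> simp only [coneVec_rows, cond_true, cond_false] <;>
    fun_prop

lemma continuous_shift (d : Fin 18) : Continuous (shift d) := by
  unfold shift
  revert d
  apply forall_fin_eighteen <;> simp only [xiLimits_rows] <;> fun_prop

/-- The parametrizations are linear with determinant `±1`. -/
lemma measurePreserving_coneVec (sw : Bool) (d : Fin 18) :
    MeasurePreserving fun β => coneVec sw β d := by
  set M : Matrix (Fin 3) (Fin 3) ℝ := Matrix.of fun i j => coneVec sw (Pi.single j 1) d i with hM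
  have h1 : (fun β => coneVec sw β d) = Matrix.toLin' M := by
    funext β i
    simp only [Matrix.toLin'_apply, Matrix.mulVec, dotProduct, Fin.sum_univ_three, hM,
      Matrix.of_apply]
    clear hM M
    revert d
    cases sw <;> apply forall_fin_eighteen <;> simp only [coneVec_rows, cond_true, cond_false] <;>
      fin_cases i <;> simp <;> ring
  have h2 : |M.det| = 1 := by
    clear h1
    simp only [Matrix.det_fin_three, hM, Matrix.of_apply]
    clear hM M
    revert d
    cases sw <;> apply forall_fin_eighteen <;> simp [coneVec_rows]
  have h3 : M.det ≠ 0 := by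
    intro h
    rw [h] at h2
    simp at h2
  refine ⟨(continuous_coneVec sw d).measurable, ?_⟩
  rw [h1, Real.map_matrix_volume_pi_eq_smul_volume_pi h3, abs_inv, h2]
  simp

lemma continuous_cellMap (sw : Bool) (d : Fin 18) : Continuous (cellMap sw d) := by
  have h1 : Continuous fun z : (Fin 3 → ℝ) × (Fin 3 → ℝ) => coneVec sw z.1 d :=
    (continuous_coneVec sw d).comp continuous_fst
  have h2 : Continuous fun z : (Fin 3 → ℝ) × (Fin 3 → ℝ) => z.2 + shift d (coneVec sw z.1 d) :=
    continuous_snd.add ((continuous_shift d).comp h1)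
  exact h2.prodMk (h2.add h1)

lemma cellMap_snd_sub_fst (sw : Bool) (d : Fin 18) (z : (Fin 3 → ℝ) × (Fin 3 → ℝ)) :
    (cellMap sw d z).2 - (cellMap sw d z).1 = coneVec sw z.1 d := by
  simp [cellMap]

lemma cellMap_injective (sw : Bool) (d : Fin 18) : Function.Injective (cellMap sw d) := by
  intro z z' h
  have h1 : coneVec sw z.1 d = coneVec sw z'.1 d := by
    rw [← cellMap_snd_sub_fst, ← cellMap_snd_sub_fst, h]
  have h2 : z.1 = z'.1 := by rw [← coneInv_coneVec sw z.1 d, h1, coneInv_coneVec]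
  have h3 : z.2 + shift d (coneVec sw z.1 d) = z'.2 + shift d (coneVec sw z'.1 d) :=
    congrArg Prod.fst h
  rw [h2] at h3
  exact Prod.ext h2 (add_right_cancel h3)

lemma measurableEmbedding_cellMap (sw : Bool) (d : Fin 18) : MeasurableEmbedding (cellMap sw d) :=
  (continuous_cellMap sw d).measurableEmbedding (cellMap_injective sw d)

/-- A composition of the unimodular map in `β`, a translation of `α` depending on `u`, and the shear
`(u, ξ) ↦ (ξ, ξ + u)`. -/
lemma measurePreserving_cellMap (sw : Bool) (d : Fin 18) : MeasurePreserving (cellMap sw d) := by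
  have h1 : MeasurePreserving (fun z : (Fin 3 → ℝ) × (Fin 3 → ℝ) =>
      (coneVec sw z.1 d, z.2 + shift d (coneVec sw z.1 d)))
      ((volume : Measure (Fin 3 → ℝ)).prod (volume : Measure (Fin 3 → ℝ)))
      ((volume : Measure (Fin 3 → ℝ)).prod (volume : Measure (Fin 3 → ℝ))) := by
    refine (measurePreserving_coneVec sw d).skew_product
      (g := fun β α => α + shift d (coneVec sw β d)) ?_ (ae_of_all _ fun β => ?_)
    · exact (continuous_snd.add ((continuous_shift d).comp
        ((continuous_coneVec sw d).comp continuous_fst))).measurable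
    · exact (measurePreserving_add_right volume _).map_eq
  exact (measurePreserving_prod_add_swap (volume : Measure (Fin 3 → ℝ))
    (volume : Measure (Fin 3 → ℝ))).comp h1

/-- A level set of a nonzero linear form is a null set. -/
lemma ae_ne_of_isLinearMap {E : Type*} [NormedAddCommGroup E] [NormedSpace ℝ E]
    [MeasurableSpace E] [BorelSpace E] [FiniteDimensional ℝ E] (μ : Measure E)
    [μ.IsAddHaarMeasure] {f : E → ℝ} (hf : IsLinearMap ℝ f) {v : E} (hv : f v ≠ 0) (c : ℝ) :
    ∀ᵐ x ∂μ, f x ≠ c := by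
  rw [ae_iff]
  simp only [not_not]
  rcases Set.eq_empty_or_nonempty {x | f x = c} with h | ⟨x₀, hx₀⟩
  · rw [h, measure_empty]
  · have hx₀ : f x₀ = c := hx₀
    have h1 : {x | f x = c} = (fun x => x + -x₀) ⁻¹' (LinearMap.ker (hf.mk' f) : Set E) := by
      ext x
      simp only [mem_ofPred_eq, mem_preimage, SetLike.mem_coe, LinearMap.mem_ker,
        IsLinearMap.mk'_apply, ← sub_eq_add_neg, hf.map_sub, hx₀, sub_eq_zero]
    rw [h1, measure_preimage_add_right]
    refine Measure.addHaar_submodule μ _ fun h => hv ?_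
    have : v ∈ LinearMap.ker (hf.mk' f) := h ▸ Submodule.mem_top
    simpa using this

lemma simplexInt_subset : simplexInt ⊆ simplex := fun _ h =>
  ⟨h.1.le, h.2.1.le, h.2.2.1.le, h.2.2.2.le⟩

lemma ae_generic : ∀ᵐ z : (Fin 3 → ℝ) × (Fin 3 → ℝ),
    (z.1 ∈ simplex → z.1 ∈ simplexInt) ∧ (z.2 ∈ simplex → z.2 ∈ simplexInt) ∧
    ∃ d, coneInv false (z.2 - z.1) d ∈ coneDom (isPyramid d) := by
  -- All exceptional configurations, boundary faces of either simplex and boundaries between cones,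
  -- are level sets of nonzero linear forms in the pair.
  have key : ∀ a b : Fin 3 → ℝ, (∃ v : (Fin 3 → ℝ) × (Fin 3 → ℝ),
      a 0 * v.1 0 + a 1 * v.1 1 + a 2 * v.1 2 + (b 0 * v.2 0 + b 1 * v.2 1 + b 2 * v.2 2) ≠ 0) →
      ∀ c : ℝ, ∀ᵐ z : (Fin 3 → ℝ) × (Fin 3 → ℝ),
      a 0 * z.1 0 + a 1 * z.1 1 + a 2 * z.1 2 + (b 0 * z.2 0 + b 1 * z.2 1 + b 2 * z.2 2) ≠ c := by
    rintro a b ⟨v, hv⟩ c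
    have : (volume : Measure ((Fin 3 → ℝ) × (Fin 3 → ℝ))).IsAddHaarMeasure :=
      Measure.prod.instIsAddHaarMeasure volume volume
    exact ae_ne_of_isLinearMap
      (volume : Measure ((Fin 3 → ℝ) × (Fin 3 → ℝ))) (f := fun z : (Fin 3 → ℝ) × (Fin 3 → ℝ) =>
      a 0 * z.1 0 + a 1 * z.1 1 + a 2 * z.1 2 + (b 0 * z.2 0 + b 1 * z.2 1 + b 2 * z.2 2))
      ⟨fun x y => by simp; ring, fun r x => by simp; ring⟩ hv c
  filter_upwards [key ![1, 0, 0] 0 ⟨(![1, 0, 0], 0), by simp⟩ 1,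
    key ![1, -1, 0] 0 ⟨(![1, 0, 0], 0), by simp⟩ 0,
    key ![0, 1, -1] 0 ⟨(![0, 1, 0], 0), by simp⟩ 0,
    key ![0, 0, 1] 0 ⟨(![0, 0, 1], 0), by simp⟩ 0,
    key 0 ![1, 0, 0] ⟨(0, ![1, 0, 0]), by simp⟩ 1,
    key 0 ![1, -1, 0] ⟨(0, ![1, 0, 0]), by simp⟩ 0,
    key 0 ![0, 1, -1] ⟨(0, ![0, 1, 0]), by simp⟩ 0,
    key 0 ![0, 0, 1] ⟨(0, ![0, 0, 1]), by simp⟩ 0,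
    key ![-1, 0, 0] ![1, 0, 0] ⟨(0, ![1, 0, 0]), by simp⟩ 0,
    key ![0, -1, 0] ![0, 1, 0] ⟨(0, ![0, 1, 0]), by simp⟩ 0,
    key ![0, 0, -1] ![0, 0, 1] ⟨(0, ![0, 0, 1]), by simp⟩ 0,
    key ![1, -1, 0] ![-1, 1, 0] ⟨(0, ![0, 1, 0]), by simp⟩ 0,
    key ![0, 1, -1] ![0, -1, 1] ⟨(0, ![0, 0, 1]), by simp⟩ 0]
    with z a1 a2 a3 a4 b1 b2 b3 b4 c1 c2 c3 c4 c5
  simp at a1 a2 a3 a4 b1 b2 b3 b4 c1 c2 c3 c4 c5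
  refine ⟨fun ⟨h1, h2, h3, h4⟩ => ⟨lt_of_le_of_ne h1 (Ne.symm a4), lt_of_le_of_ne h2 ?_,
    lt_of_le_of_ne h3 ?_, lt_of_le_of_ne h4 a1⟩, fun ⟨h1, h2, h3, h4⟩ =>
    ⟨lt_of_le_of_ne h1 (Ne.symm b4), lt_of_le_of_ne h2 ?_,
    lt_of_le_of_ne h3 ?_, lt_of_le_of_ne h4 b1⟩, exists_coneInv_mem ?_ ?_ ?_ ?_ ?_⟩
  · exact fun h => a3 (by linarith)
  · exact fun h => a2 (by linarith)
  · exact fun h => b3 (by linarith)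
  · exact fun h => b2 (by linarith)
  · exact fun h => c1 (by simp at h; linarith)
  · exact fun h => c2 (by simp at h; linarith)
  · exact fun h => c3 (by simp at h; linarith)
  · exact fun h => c4 (by simp at h; linarith)
  · exact fun h => c5 (by simp at h; linarith)

/-- Membership in the second cone does not depend on the order of its parameters. -/
lemma coneInv_mem_iff (sw : Bool) (u : Fin 3 → ℝ) (d : Fin 18) :
    coneInv sw u d ∈ coneDom (isPyramid d) ↔ coneInv false u d ∈ coneDom (isPyramid d) := by
  cases sw
  · rfl
  · rw [coneInv_true]
    split_ifs with h
    · subst h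
      simp only [coneDom, isPyramid_rows, coneInv_rows, cond_true, cond_false, mem_ofPred_eq]
      simp
      tauto
    · rfl

/-- The difference of the two components recovers `u`, and `u` lies in at most one open cone. -/
lemma cells_disjoint (sw : Bool) :
    Pairwise (Function.onFun Disjoint fun d => cellMap sw d '' cellDom (isPyramid d)) := by
  intro d d' hdd'
  refine disjoint_left.2 ?_
  rintro _ ⟨z, hz, rfl⟩ ⟨z', hz', h⟩
  have h1 : coneInv false (coneVec sw z.1 d) d ∈ coneDom (isPyramid d) := by
    rw [← coneInv_mem_iff sw, coneInv_coneVec]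
    exact hz.1
  have h2 : coneInv false (coneVec sw z.1 d) d' ∈ coneDom (isPyramid d') := by
    rw [← coneInv_mem_iff sw, ← cellMap_snd_sub_fst, ← h, cellMap_snd_sub_fst, coneInv_coneVec]
    exact hz'.1
  exact hdd' (coneInv_disjoint h1 h2)

lemma simplex_prod_ae_eq (sw : Bool) :
    (simplex ×ˢ simplex : Set ((Fin 3 → ℝ) × (Fin 3 → ℝ))) =ᵐ[volume]
      ⋃ d, cellMap sw d '' cellDom (isPyramid d) := by
  filter_upwards [ae_generic] with z hz
  apply propext
  constructor
  · rintro ⟨h1, h2⟩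
    obtain ⟨d, hd⟩ := hz.2.2
    have hd' := (coneInv_mem_iff sw _ _).2 hd
    set β := coneInv sw (z.2 - z.1) d with hβ
    have hu : coneVec sw β d = z.2 - z.1 := coneVec_coneInv _ _ _
    have hmap : cellMap sw d (β, z.1 - shift d (z.2 - z.1)) = z := by
      simp only [cellMap, hu, sub_add_cancel, add_sub_cancel]
    refine mem_iUnion.2 ⟨d, ⟨(β, z.1 - shift d (z.2 - z.1)), ?_, hmap⟩⟩
    refine mem_cellDom sw d hd' ?_ ?_ <;> rw [hmap]
    exacts [hz.1 h1, hz.2.1 h2]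
  · intro h
    obtain ⟨d, ⟨β, α⟩, hw, rfl⟩ := mem_iUnion.1 h
    exact cellMap_mem sw d (coneDom_subset _ hw.1)
      ⟨hw.2.1.le, hw.2.2.1.le, hw.2.2.2.1.le, hw.2.2.2.2.le⟩

lemma isOpen_cellDom (p : Bool) : IsOpen (cellDom p) := by
  have h : cellDom p = {z | 0 < z.1 2} ∩ {z | 0 < z.1 1} ∩ {z | z.1 1 < z.1 0} ∩
      {z | z.1 2 < bif p then z.1 0 else z.1 1} ∩ {z | z.1 0 < z.2 2} ∩ {z | z.2 2 < z.2 1} ∩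
      {z | z.2 1 < z.2 0} ∩ {z | z.2 0 < 1} := by
    ext z
    simp only [cellDom, coneDom, mem_ofPred_eq, mem_inter_iff]
    tauto
  rw [h]
  repeat' apply IsOpen.inter
  all_goals
    first
    | exact isOpen_lt (by fun_prop) (by fun_prop)
    | (cases p <;> exact isOpen_lt (by fun_prop) (by simp; fun_prop))

/-- Integrals over the product of two simplices as sums over the 18 cells. -/
lemma integral_simplex_prod (sw : Bool) (f : (Fin 3 → ℝ) × (Fin 3 → ℝ) → ℂ) :
    (IntegrableOn f (simplex ×ˢ simplex) ↔
      ∀ d, IntegrableOn (fun z => f (cellMap sw d z)) (cellDom (isPyramid d))) ∧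
    (IntegrableOn f (simplex ×ˢ simplex) → ∫ z in simplex ×ˢ simplex, f z =
      ∑ d, ∫ z in cellDom (isPyramid d), f (cellMap sw d z)) := by
  have h1 : ∀ d, IntegrableOn f (cellMap sw d '' cellDom (isPyramid d)) ↔
      IntegrableOn (fun z => f (cellMap sw d z)) (cellDom (isPyramid d)) := fun d =>
    (measurePreserving_cellMap sw d).integrableOn_image (measurableEmbedding_cellMap sw d)
  have h2 : IntegrableOn f (simplex ×ˢ simplex) ↔
      ∀ d, IntegrableOn f (cellMap sw d '' cellDom (isPyramid d)) := by
    rw [integrableOn_congr_set_ae (simplex_prod_ae_eq sw), integrableOn_finite_iUnion]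
  refine ⟨by simp only [h2, h1], fun hf => ?_⟩
  rw [setIntegral_congr_set (simplex_prod_ae_eq sw), integral_iUnion_fintype
    (fun d => (measurableEmbedding_cellMap sw d).measurableSet_image.2
      (isOpen_cellDom _).measurableSet) (cells_disjoint sw) (h2.1 hf)]
  refine Finset.sum_congr rfl fun d _ => ?_
  exact (measurePreserving_cellMap sw d).setIntegral_image_emb
    (measurableEmbedding_cellMap sw d) _ _

/-! ### Triangular changes of variables -/

/-- The open unit cube. -/
def cube (n : ℕ) : Set (Fin n → ℝ) := Set.pi univ fun _ => Ioo 0 1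

lemma mem_cube {n : ℕ} {t : Fin n → ℝ} : t ∈ cube n ↔ ∀ j, 0 < t j ∧ t j < 1 := by
  simp [cube]

lemma isOpen_cube (n : ℕ) : IsOpen (cube n) := isOpen_set_pi finite_univ fun _ _ => isOpen_Ioo

lemma cube_ae_eq (n : ℕ) : cube n =ᵐ[volume] Icc (0 : Fin n → ℝ) 1 :=
  Measure.univ_pi_Ioo_ae_eq_Icc (μ := fun _ => volume) (f := fun _ => (0 : ℝ)) (g := fun _ => 1)

section Triangular

variable {n : ℕ} {A B : (Fin n → ℝ) → Fin n → ℝ} {F : (Fin n → ℝ) → Fin n → ℝ}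

/-- The recursion determines component `j` from `t j` and the earlier components, so it depends only
on `t i` with `i ≤ j`. -/
lemma triangular_congr (hA : ∀ σ σ' j, (∀ i < j, σ i = σ' i) → A σ j = A σ' j)
    (hB : ∀ σ σ' j, (∀ i < j, σ i = σ' i) → B σ j = B σ' j)
    (hF : ∀ t j, F t j = A (F t) j + B (F t) j * t j) {t t' : Fin n → ℝ} (j : Fin n)
    (h : ∀ i ≤ j, t i = t' i) : F t j = F t' j := by
  induction j using WellFoundedLT.induction with
  | ind j ih =>
    have h1 : ∀ i < j, F t i = F t' i := fun i hi => ih i hi fun k hk => h k (hk.trans hi.le)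
    rw [hF t j, hF t' j, hA _ _ j h1, hB _ _ j h1, h j le_rfl]

/-- The Jacobian matrix is lower triangular, and since the bounds of component `j` do not involve `t
j`, its diagonal entries are the interval lengths. -/
lemma triangular_det (hA : ∀ σ σ' j, (∀ i < j, σ i = σ' i) → A σ j = A σ' j)
    (hB : ∀ σ σ' j, (∀ i < j, σ i = σ' i) → B σ j = B σ' j)
    (hF : ∀ t j, F t j = A (F t) j + B (F t) j * t j) (hd : Differentiable ℝ F)
    (t : Fin n → ℝ) : (fderiv ℝ F t).det = ∏ j, B (F t) j := by
  have hline : ∀ i j, HasDerivAt (fun x : ℝ => F (t + x • Pi.single i 1) j)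
      (fderiv ℝ F t (Pi.single i 1) j) 0 := by
    intro i j
    have h1 := (hd t).hasFDerivAt.hasLineDerivAt (Pi.single i 1)
    exact (hasDerivAt_pi.1 h1) j
  have hpre : ∀ i j, ∀ x : ℝ, (∀ k < j, k ≠ i) → ∀ k < j,
      F (t + x • Pi.single i 1) k = F t k := by
    intro i j x hij k hk
    refine triangular_congr hA hB hF k fun l hl => ?_
    simp [Pi.single_eq_of_ne (hij l (hl.trans_lt hk))]
  have hM : ∀ i j, LinearMap.toMatrix' (fderiv ℝ F t : (Fin n → ℝ) →ₗ[ℝ] _) j i =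
      fderiv ℝ F t (Pi.single i 1) j := fun i j => by
    simp [LinearMap.toMatrix'_apply]
  have h0 : ∀ i j, j < i → fderiv ℝ F t (Pi.single i 1) j = 0 := by
    intro i j hij
    refine (hline i j).unique ?_
    have : (fun x : ℝ => F (t + x • Pi.single i 1) j) = fun _ => F t j := by
      funext x
      refine triangular_congr hA hB hF j fun l hl => ?_
      simp [Pi.single_eq_of_ne (hl.trans_lt hij).ne]
    rw [this]
    exact hasDerivAt_const _ _
  have h1 : ∀ j, fderiv ℝ F t (Pi.single j 1) j = B (F t) j := by
    intro j
    refine (hline j j).unique ?_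
    have : (fun x : ℝ => F (t + x • Pi.single j 1) j) =
        fun x => A (F t) j + B (F t) j * (t j + x) := by
      funext x
      have h2 := hpre j j x fun k hk => hk.ne
      rw [hF, hA _ _ j h2, hB _ _ j h2]
      simp
    rw [this]
    simpa using (((hasDerivAt_id (0 : ℝ)).const_add (t j)).const_mul (B (F t) j)).const_add
      (A (F t) j)
  rw [ContinuousLinearMap.det, ← LinearMap.det_toMatrix',
    Matrix.det_of_isLowerTriangular _ fun i j hij => ?_]
  · simp only [hM, h1]
  · rw [hM]
    exact h0 _ _ hij

/-- Change of variables to the unit cube in a domain given by triangular inequalities. -/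
lemma integral_triangular (hA : ∀ σ σ' j, (∀ i < j, σ i = σ' i) → A σ j = A σ' j)
    (hB : ∀ σ σ' j, (∀ i < j, σ i = σ' i) → B σ j = B σ' j)
    (hF : ∀ t j, F t j = A (F t) j + B (F t) j * t j) (hd : Differentiable ℝ F)
    (hpos : ∀ t ∈ cube n, ∀ j, 0 < B (F t) j) (f : (Fin n → ℝ) → ℂ) :
    (IntegrableOn f {σ | ∀ j, A σ j < σ j ∧ σ j < A σ j + B σ j} ↔
      IntegrableOn (fun t => (∏ j, B (F t) j) • f (F t)) (cube n)) ∧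
    ∫ σ in {σ | ∀ j, A σ j < σ j ∧ σ j < A σ j + B σ j}, f σ =
      ∫ t in cube n, (∏ j, B (F t) j) • f (F t) := by
  have himg : {σ | ∀ j, A σ j < σ j ∧ σ j < A σ j + B σ j} = F '' cube n := by
    ext σ
    constructor
    · intro h
      -- Positivity of the lengths on the domain comes from nonemptiness of the intervals; the
      -- inverse map is the relative position in each interval.
      have hb : ∀ j, 0 < B σ j := fun j => by linarith [h j]
      have hF' : F (fun j => (σ j - A σ j) / B σ j) = σ := by
        funext j
        induction j using WellFoundedLT.induction with
        | ind j ih =>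
          rw [hF, hA _ _ j ih, hB _ _ j ih, mul_div_cancel₀ _ (hb j).ne', add_sub_cancel]
      refine ⟨_, mem_cube.2 fun j => ⟨div_pos (by linarith [h j]) (hb j), ?_⟩, hF'⟩
      rw [div_lt_one (hb j)]
      linarith [h j]
    · rintro ⟨t, ht, rfl⟩ j
      have h1 := hpos t ht j
      obtain ⟨h2, h3⟩ := mem_cube.1 ht j
      rw [hF t j]
      constructor
      · nlinarith [hF t j]
      · nlinarith [hF t j]
  have hinj : InjOn F (cube n) := by
    intro t ht t' ht' h
    funext j
    have h1 := hF t j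
    rw [h, hF t' j] at h1
    exact (mul_left_cancel₀ (hpos t' ht' j).ne' (add_left_cancel h1)).symm
  have hf' : ∀ t ∈ cube n, HasFDerivWithinAt F (fderiv ℝ F t) (cube n) t := fun t _ =>
    (hd t).hasFDerivAt.hasFDerivWithinAt
  have hdet : ∀ t ∈ cube n, |(fderiv ℝ F t).det| = ∏ j, B (F t) j := fun t ht => by
    rw [triangular_det hA hB hF hd]
    exact abs_of_pos (Finset.prod_pos fun j _ => hpos t ht j)
  rw [himg, integrableOn_image_iff_integrableOn_abs_det_fderiv_smul volume
    (isOpen_cube n).measurableSet hf' hinj, integral_image_eq_integral_abs_det_fderiv_smul volume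
    (isOpen_cube n).measurableSet hf' hinj]
  refine ⟨integrableOn_congr_fun (fun t ht => ?_) (isOpen_cube n).measurableSet,
    setIntegral_congr_fun (isOpen_cube n).measurableSet fun t ht => ?_⟩
  all_goals simp only [hdet t ht]

end Triangular

/-- Splitting off one variable from an integral over the cube. -/
lemma integral_cube_succ {n : ℕ} (i : Fin (n + 1)) {f : (Fin (n + 1) → ℝ) → ℂ}
    (hf : IntegrableOn f (cube (n + 1))) :
    (∀ᵐ y ∂volume.restrict (cube n), IntegrableOn (fun z => f (i.insertNth z y)) (Ioo 0 1)) ∧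
    IntegrableOn (fun y : Fin n → ℝ => ∫ z in (0 : ℝ)..1, f (i.insertNth z y)) (cube n) ∧
    ∫ t in cube (n + 1), f t = ∫ y in cube n, ∫ z in (0 : ℝ)..1, f (i.insertNth z y) := by
  set e := (MeasurableEquiv.piFinSuccAbove (fun _ : Fin (n + 1) => ℝ) i).symm with he
  have hmp : MeasurePreserving e := (volume_preserving_piFinSuccAbove (fun _ => ℝ) i).symm _
  have hpre : e ⁻¹' cube (n + 1) = Ioo 0 1 ×ˢ cube n := by
    ext ⟨z, y⟩
    simp only [mem_preimage, mem_cube, mem_prod, mem_Ioo, he,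
      MeasurableEquiv.piFinSuccAbove_symm_apply]
    rw [Fin.forall_iff_succAbove i]
    simp [Fin.insertNthEquiv]
  have hval : ∀ z y, e (z, y) = i.insertNth z y := fun z y => rfl
  have h1 : IntegrableOn (fun p : ℝ × (Fin n → ℝ) => f (e p)) (Ioo 0 1 ×ˢ cube n) := by
    rw [← hpre]
    exact (hmp.integrableOn_comp_preimage e.measurableEmbedding).2 hf
  have h2 : ∫ t in cube (n + 1), f t = ∫ p in Ioo 0 1 ×ˢ cube n, f (e p) := by
    rw [← hpre]
    exact (hmp.setIntegral_preimage_emb e.measurableEmbedding f _).symm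
  have h3 : Integrable (fun p : ℝ × (Fin n → ℝ) => f (e p))
      ((volume.restrict (Ioo 0 1)).prod (volume.restrict (cube n))) := by
    rw [Measure.prod_restrict]
    exact h1
  have h4 : ∀ y, ∫ z in (0 : ℝ)..1, f (i.insertNth z y) = ∫ z in Ioo (0 : ℝ) 1, f (e (z, y)) :=
    fun y => by
      rw [intervalIntegral.integral_of_le zero_le_one, integral_Ioc_eq_integral_Ioo]
      rfl
  simp only [h4]
  refine ⟨h3.prod_left_ae, h3.integral_prod_right, ?_⟩
  rw [h2, Measure.volume_eq_prod, ← Measure.prod_restrict, integral_prod_symm _ h3]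

/-! ### Cell coordinates on the cube -/

/-- The positions of the parameters `β` and `α` of a cell in the order of integration. -/
def cellIndex : CommonCase → Fin 3 ⊕ Fin 3 → Fin 6
  | .tetrahedron => Sum.elim ![0, 1, 2] ![5, 4, 3]
  | .face => Sum.elim ![1, 2, 3] ![5, 4, 0]
  | .edge => Sum.elim ![2, 3, 4] ![5, 0, 1]

/-- The parameters `(β, α)` of a cell, from the list in the order of integration. -/
def arrange (c : CommonCase) (σ : Fin 6 → ℝ) : (Fin 3 → ℝ) × (Fin 3 → ℝ) :=
  (fun i => σ (cellIndex c (Sum.inl i)), fun i => σ (cellIndex c (Sum.inr i)))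

/-- The lower bounds of the parameters of a cell. -/
def cellLower (c : CommonCase) (σ : Fin 6 → ℝ) : Fin 6 → ℝ :=
  match c with
  | .tetrahedron => ![0, 0, 0, σ 0, σ 3, σ 4]
  | .face => ![0, 0, 0, 0, σ 0, σ 4]
  | .edge => ![0, 0, 0, 0, 0, σ 0]

/-- The lengths of the intervals in which the parameters of a cell vary. -/
def cellLength (c : CommonCase) (p : Bool) (σ : Fin 6 → ℝ) : Fin 6 → ℝ :=
  match c with
  | .tetrahedron => ![1, σ 0, bif p then σ 0 else σ 1, 1 - σ 0, 1 - σ 3, 1 - σ 4]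
  | .face => ![1, σ 0, σ 1, bif p then σ 1 else σ 2, 1 - σ 0, 1 - σ 4]
  | .edge => ![1, σ 0, σ 1, σ 2, bif p then σ 2 else σ 3, 1 - σ 0]

/-- The parameters of a cell in terms of coordinates on the cube. -/
def cellCoord (c : CommonCase) (p : Bool) (t : Fin 6 → ℝ) : Fin 6 → ℝ :=
  match c with
  | .tetrahedron =>
    ![t 0, t 0 * t 1, (bif p then t 0 else t 0 * t 1) * t 2, t 0 + (1 - t 0) * t 3,
      t 0 + (1 - t 0) * t 3 + (1 - (t 0 + (1 - t 0) * t 3)) * t 4,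
      t 0 + (1 - t 0) * t 3 + (1 - (t 0 + (1 - t 0) * t 3)) * t 4 +
        (1 - (t 0 + (1 - t 0) * t 3 + (1 - (t 0 + (1 - t 0) * t 3)) * t 4)) * t 5]
  | .face =>
    ![t 0, t 0 * t 1, t 0 * t 1 * t 2, (bif p then t 0 * t 1 else t 0 * t 1 * t 2) * t 3,
      t 0 + (1 - t 0) * t 4, t 0 + (1 - t 0) * t 4 + (1 - (t 0 + (1 - t 0) * t 4)) * t 5]
  | .edge =>
    ![t 0, t 0 * t 1, t 0 * t 1 * t 2, t 0 * t 1 * t 2 * t 3,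
      (bif p then t 0 * t 1 * t 2 else t 0 * t 1 * t 2 * t 3) * t 4, t 0 + (1 - t 0) * t 5]

lemma cellLower_congr (c : CommonCase) (σ σ' : Fin 6 → ℝ) (j : Fin 6) (h : ∀ i < j, σ i = σ' i) :
    cellLower c σ j = cellLower c σ' j := by
  cases c <;> fin_cases j <;> simp [cellLower, h]

lemma cellLength_congr (c : CommonCase) (p : Bool) (σ σ' : Fin 6 → ℝ) (j : Fin 6)
    (h : ∀ i < j, σ i = σ' i) : cellLength c p σ j = cellLength c p σ' j := by
  cases c <;> cases p <;> fin_cases j <;> simp [cellLength, h]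

lemma cellCoord_eq (c : CommonCase) (p : Bool) (t : Fin 6 → ℝ) (j : Fin 6) :
    cellCoord c p t j =
      cellLower c (cellCoord c p t) j + cellLength c p (cellCoord c p t) j * t j := by
  cases c <;> cases p <;> fin_cases j <;> simp [cellCoord, cellLower, cellLength]

lemma contDiff_cellCoord (c : CommonCase) (p : Bool) : ContDiff ℝ 1 (cellCoord c p) := by
  rw [contDiff_pi]
  intro j
  cases c <;> cases p <;> fin_cases j <;> simp [cellCoord] <;> fun_prop

lemma cellLength_pos (c : CommonCase) (p : Bool) {t : Fin 6 → ℝ} (ht : t ∈ cube 6) (j : Fin 6) :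
    0 < cellLength c p (cellCoord c p t) j := by
  rw [mem_cube] at ht
  have h0 := fun i => (ht i).1
  have h1 := fun i => sub_pos.2 (ht i).2
  have h : ∀ a x : ℝ, 1 - (a + (1 - a) * x) = (1 - a) * (1 - x) := fun a x => by ring
  have h' : ∀ a x y : ℝ, 1 - (a + (1 - a) * x + (1 - a) * (1 - x) * y) =
      (1 - a) * (1 - x) * (1 - y) := fun a x y => by ring
  cases c <;> cases p <;> fin_cases j <;> simp [cellCoord, cellLength, -sub_pos, h, h', h0, h1]

/-- Only a relabelling of coordinates along the bijection `cellIndex c`. -/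
lemma measurePreserving_arrange (c : CommonCase) : MeasurePreserving (arrange c) ∧
    MeasurableEmbedding (arrange c) := by
  have hb : Function.Bijective (cellIndex c) := by cases c <;> decide
  set e := Equiv.ofBijective _ hb
  have h1 := (volume_measurePreserving_piCongrLeft (fun _ : Fin 6 => ℝ) e).symm _
  have h2 := volume_measurePreserving_sumPiEquivProdPi (fun _ : Fin 3 ⊕ Fin 3 => ℝ)
  exact ⟨h2.comp h1, (MeasurableEquiv.sumPiEquivProdPi _).measurableEmbedding.comp
    (MeasurableEquiv.piCongrLeft (fun _ : Fin 6 => ℝ) e).symm.measurableEmbedding⟩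

lemma arrange_preimage (c : CommonCase) (p : Bool) : arrange c ⁻¹' cellDom p =
    {σ | ∀ j, cellLower c σ j < σ j ∧ σ j < cellLower c σ j + cellLength c p σ j} := by
  ext σ
  simp only [mem_preimage, mem_ofPred_eq, cellDom, coneDom, Fin.forall_fin_succ,
    Fin.forall_fin_zero]
  cases c <;> cases p <;> simp [arrange, cellIndex, cellLower, cellLength] <;>
    constructor <;> intro h <;> casesm* _ ∧ _ <;> and_intros <;> linarith

/-- Whether the parameters of the second cone are exchanged. -/
def cellSwap : CommonCase → Bool
  | .edge => true
  | .face => false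
  | .tetrahedron => false

/-- The pair `(ξ, ξ + u)` in terms of coordinates on the cube. -/
def duffyCell (c : CommonCase) (d : Fin 18) (t : Fin 6 → ℝ) : (Fin 3 → ℝ) × (Fin 3 → ℝ) :=
  cellMap (cellSwap c) d
    (arrange c (cellCoord c (isPyramid d) t))

/-- The Jacobian of `duffyCell`. -/
def duffyCellJac (c : CommonCase) (d : Fin 18) (t : Fin 6 → ℝ) : ℝ :=
  ∏ j, cellLength c (isPyramid d) (cellCoord c (isPyramid d) t) j

/-- Integrals over the product of two simplices as sums of integrals over the cube. -/
lemma integral_simplex_prod_eq_cube (c : CommonCase) (f : (Fin 3 → ℝ) × (Fin 3 → ℝ) → ℂ) :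
    (IntegrableOn f (simplex ×ˢ simplex) ↔
      ∀ d, IntegrableOn (fun t => duffyCellJac c d t • f (duffyCell c d t)) (cube 6)) ∧
    (IntegrableOn f (simplex ×ˢ simplex) → ∫ z in simplex ×ˢ simplex, f z =
      ∑ d, ∫ t in cube 6, duffyCellJac c d t • f (duffyCell c d t)) := by
  obtain ⟨h1, h2⟩ := integral_simplex_prod (cellSwap c) f
  obtain ⟨hmp, hme⟩ := measurePreserving_arrange c
  have h3 := fun d => integral_triangular (cellLower_congr c) (cellLength_congr c (isPyramid d))
    (cellCoord_eq c (isPyramid d)) ((contDiff_cellCoord c (isPyramid d)).differentiable one_ne_zero)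
    (fun t ht => cellLength_pos c (isPyramid d) ht)
    fun σ => f (cellMap (cellSwap c) d (arrange c σ))
  simp only [← arrange_preimage] at h3
  refine ⟨h1.trans (forall_congr' fun d => ?_), fun hf => (h2 hf).trans
    (Finset.sum_congr rfl fun d _ => ?_)⟩
  · exact (hmp.integrableOn_comp_preimage hme).symm.trans (h3 d).1
  · exact (hmp.setIntegral_preimage_emb hme (fun z => f (cellMap (cellSwap c) d z)) _).symm.trans
      (h3 d).2

/-! ### Cell coordinates and Duffy transformations -/

lemma coneVec_smul (sw : Bool) (r : ℝ) (β : Fin 3 → ℝ) (d : Fin 18) :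
    coneVec sw (r • β) d = r • coneVec sw β d := by
  revert d
  cases sw <;> apply forall_fin_eighteen <;> simp only [coneVec_rows, cond_true, cond_false] <;>
    apply vec3_ext <;> simp <;> ring

lemma duffyTet_eq_coneVec (a b : ℝ) (d : Fin 18) :
    (duffyTet ![a, b] d).u = coneVec false ![1, a, bif isPyramid d then b else a * b] d ∧
    (duffyTet ![a, b] d).jac = bif isPyramid d then 1 else a := by
  revert d
  apply forall_fin_eighteen <;> simp only [coneVec_rows, isPyramid_rows, cond_true, cond_false] <;>
    refine ⟨(vec3_ext ?_ ?_ ?_).symm, ?_⟩ <;> simp [duffyTet] <;> ring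

/-- The exchange of arguments in the second row for a common edge is the exchange of the last two
cone parameters. -/
lemma duffyTet_eq_coneVec_true (a b : ℝ) (d : Fin 18) :
    (duffyTet (if d = 1 then ![b, a] else ![a, b]) d).u =
      coneVec true ![1, a, bif isPyramid d then b else a * b] d ∧
    (duffyTet (if d = 1 then ![b, a] else ![a, b]) d).jac = bif isPyramid d then 1 else a := by
  rw [coneVec_true]
  split_ifs with h
  · subst h
    simpa [isPyramid_rows] using duffyTet_eq_coneVec b a 1
  · exact duffyTet_eq_coneVec a b d

/-- The variables of the reduced integral among the coordinates on the cube. -/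
def duffyArg (c : CommonCase) (t : Fin 6 → ℝ) (i : Fin c.dimY) : ℝ :=
  t ⟨i + 1, by
    have h : c.dimY ≤ 4 := by cases c <;> decide
    omega⟩

lemma duffy_edge (d : Fin 18) (t : Fin 6 → ℝ) :
    duffy .edge d (duffyArg .edge t) = duffyEdge ![t 1, t 2, t 3, t 4] d := by
  have h : duffyArg .edge t = ![t 1, t 2, t 3, t 4] := by
    funext i
    fin_cases i <;> rfl
  rw [h]
  rfl

lemma duffy_face (d : Fin 18) (t : Fin 6 → ℝ) :
    duffy .face d (duffyArg .face t) = duffyFace ![t 1, t 2, t 3] d := by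
  have h : duffyArg .face t = ![t 1, t 2, t 3] := by
    funext i
    fin_cases i <;> rfl
  rw [h]
  rfl

lemma duffy_tetrahedron (d : Fin 18) (t : Fin 6 → ℝ) :
    duffy .tetrahedron d (duffyArg .tetrahedron t) = duffyTet ![t 1, t 2] d := by
  have h : duffyArg .tetrahedron t = ![t 1, t 2] := by
    funext i
    fin_cases i <;> rfl
  rw [h]
  rfl

/-- The factor of the Jacobian that belongs to the components of `ξ` integrated beforehand. -/
def freeJac (c : CommonCase) (t : Fin 6 → ℝ) : ℝ :=
  match c with
  | .tetrahedron => (1 - t 0) * (1 - (t 0 + (1 - t 0) * t 3)) *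
      (1 - (t 0 + (1 - t 0) * t 3 + (1 - (t 0 + (1 - t 0) * t 3)) * t 4))
  | .face => (1 - t 0) * (1 - (t 0 + (1 - t 0) * t 4))
  | .edge => 1 - t 0

/-- The values `ξ_i - U_i`. -/
def freeArg (c : CommonCase) (t : Fin 6 → ℝ) : Fin 3 → ℝ :=
  (arrange c (cellCoord c false t)).2

/-- The type of the cone affects only the coordinate of the last `β`, which is not used in any bound
for `α`. -/
lemma arrange_snd (c : CommonCase) (p : Bool) (t : Fin 6 → ℝ) :
    (arrange c (cellCoord c p t)).2 = freeArg c t := by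
  cases p
  · rfl
  · funext i
    cases c <;> fin_cases i <;> rfl

/-- On the cube `β` is a common product times `(1, a, a b)`, or `(1, a, b)` for a pyramid;
homogeneity of the cone map extracts the product, whose first factor is `w`. -/
lemma coneVec_arrange (c : CommonCase) (d : Fin 18) (t : Fin 6 → ℝ) :
    coneVec (cellSwap c) (arrange c (cellCoord c (isPyramid d) t)).1 d =
      t 0 • (duffy c d (duffyArg c t)).u := by
  cases c
  · have h : (arrange .edge (cellCoord .edge (isPyramid d) t)).1 =
        (t 0 * t 1 * t 2) • ![1, t 3, bif isPyramid d then t 4 else t 3 * t 4] := by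
      funext i
      fin_cases i <;> simp [arrange, cellIndex, cellCoord]
      cases isPyramid d
      · simp
        ring
      · simp
    rw [h, coneVec_smul, cellSwap, ← (duffyTet_eq_coneVec_true _ _ d).1]
    rw [duffy_edge, duffyEdge_eq]
    simp only [smul_smul, ← mul_assoc]
    rfl
  · have h : (arrange .face (cellCoord .face (isPyramid d) t)).1 =
        (t 0 * t 1) • ![1, t 2, bif isPyramid d then t 3 else t 2 * t 3] := by
      funext i
      fin_cases i <;> simp [arrange, cellIndex, cellCoord]
      cases isPyramid d
      · simp
        ring
      · simp
    rw [h, coneVec_smul, cellSwap, ← (duffyTet_eq_coneVec _ _ d).1]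
    rw [duffy_face, duffyFace_eq]
    simp only [smul_smul]
    rfl
  · have h : (arrange .tetrahedron (cellCoord .tetrahedron (isPyramid d) t)).1 =
        t 0 • ![1, t 1, bif isPyramid d then t 2 else t 1 * t 2] := by
      funext i
      fin_cases i <;> simp [arrange, cellIndex, cellCoord]
      cases isPyramid d
      · simp
        ring
      · simp
    rw [h, coneVec_smul, cellSwap, ← (duffyTet_eq_coneVec _ _ d).1, duffy_tetrahedron]

lemma duffyCell_eq (c : CommonCase) (d : Fin 18) (t : Fin 6 → ℝ) :
    (duffyCell c d t).1 = freeArg c t + shift d (t 0 • (duffy c d (duffyArg c t)).u) ∧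
    (duffyCell c d t).2 = (duffyCell c d t).1 + t 0 • (duffy c d (duffyArg c t)).u := by
  have h := coneVec_arrange c d t
  simp only [duffyCell, cellMap, arrange_snd]
  rw [h]
  exact ⟨rfl, rfl⟩

/-- A kept `α_i` is `w` times earlier ratios, and `U_i` is linear in `u`, which carries the factor
`w` as well. -/
lemma duffyCell_kept (c : CommonCase) (d : Fin 18) (t : Fin 6 → ℝ) (i : Fin 3) (hi : i ∈ kept c) :
    (duffyCell c d t).1 i = t 0 * (duffy c d (duffyArg c t)).xi i := by
  rw [(duffyCell_eq c d t).1]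
  have hs : shift d (t 0 • (duffy c d (duffyArg c t)).u) =
      t 0 • shift d (duffy c d (duffyArg c t)).u := by
    obtain ⟨-, k2, -, k4, -, k6⟩ := xiLimits_smul (t 0) (duffy c d (duffyArg c t)).u d
    exact vec3_ext k6 k4 k2
  rw [hs]
  cases c
  · rw [duffy_edge, duffyEdge_eq]
    simp only [Matrix.cons_val]
    set R := (duffyTet (if d = 1 then ![t 4, t 3] else ![t 3, t 4]) d).u with hR
    fin_cases i
    · simp [kept, CommonCase.numCV] at hi
    · simp [freeArg, arrange, cellIndex, cellCoord]
      ring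
    -- The table entry is `y₁ (1 + U₃(y₂ a))`, whereas the cell gives `y₁ + U₃(y₁ y₂ a)`.
    · have := (xiLimits_smul (t 1) (t 2 • R) d).2.1
      rw [smul_smul] at this
      simp [freeArg, arrange, cellIndex, cellCoord, this]
      ring
  · rw [duffy_face, duffyFace_eq]
    fin_cases i
    · simp [kept, CommonCase.numCV] at hi
    · simp [kept, CommonCase.numCV] at hi
    · simp [freeArg, arrange, cellIndex, cellCoord]
      ring
  · simp [kept, CommonCase.numCV] at hi
    omega

lemma duffyCellJac_eq (c : CommonCase) (d : Fin 18) (t : Fin 6 → ℝ) :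
    duffyCellJac c d t =
      t 0 ^ c.dimY * (duffy c d (duffyArg c t)).jac * freeJac c t := by
  rw [duffyCellJac, Fin.prod_univ_six]
  cases c
  · have h := (duffyTet_eq_coneVec_true (t 3) (t 4) d).2
    have h' : (duffy .edge d (duffyArg .edge t)).jac =
        t 1 ^ 3 * t 2 ^ 2 * bif isPyramid d then 1 else t 3 := by
      rw [← h, duffy_edge, duffyEdge_eq]
      rfl
    rw [h']
    cases isPyramid d <;> simp [cellLength, cellCoord, freeJac, CommonCase.dimY, CommonCase.numCV,
      -mul_eq_mul_right_iff, -mul_eq_mul_left_iff]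
      <;> ring
  · have h := (duffyTet_eq_coneVec (t 2) (t 3) d).2
    have h' : (duffy .face d (duffyArg .face t)).jac =
        t 1 ^ 2 * bif isPyramid d then 1 else t 2 := by
      rw [← h, duffy_face, duffyFace_eq]
      rfl
    rw [h']
    cases isPyramid d <;> simp [cellLength, cellCoord, freeJac, CommonCase.dimY, CommonCase.numCV,
      -mul_eq_mul_right_iff, -mul_eq_mul_left_iff]
      <;> ring
  · have h : (duffy .tetrahedron d (duffyArg .tetrahedron t)).jac =
        bif isPyramid d then 1 else t 1 := by
      rw [duffy_tetrahedron]
      exact (duffyTet_eq_coneVec (t 1) (t 2) d).2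
    rw [h]
    cases isPyramid d <;> simp [cellLength, cellCoord, freeJac, CommonCase.dimY, CommonCase.numCV,
      -mul_eq_mul_right_iff, -mul_eq_mul_left_iff]
      <;> ring

/-! ### Integration over the components of `ξ` on which the distance does not depend -/

lemma integral_unit_substitution (φ : ℝ → ℂ) (a U : ℝ) :
    ∫ z in (0 : ℝ)..1, ((1 - a : ℝ) : ℂ) * φ (a + (1 - a) * z + U) =
      ∫ s in (a + U)..(1 + U), φ s := by
  have h := intervalIntegral.smul_integral_comp_add_mul (a := 0) (b := 1) φ (1 - a) (a + U)
  rw [show a + U + (1 - a) * 0 = a + U by ring, show a + U + (1 - a) * 1 = 1 + U by ring] at h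
  rw [← h, intervalIntegral.integral_const_mul, Complex.real_smul]
  congr 2
  funext z
  congr 1
  ring

section

variable (P : MvPolynomial (Fin 3 ⊕ Fin 3) ℂ) (V V' : Fin 4 → E3) (d : Fin 18)

/-- With `a` the value of `α₂`, the identity `U₂ = U₁ - L₁` turns the lower limit into `a + U₁`; the
integral then runs over `a ≤ α₁ ≤ 1`, rescaled to the unit interval. The other two cases nest this
one. -/
lemma pbar_edge_eq {u ξ : Fin 3 → ℝ} {a : ℝ} (h : ξ 1 = a + (xiLimits u d).U₂) :
    pbar .edge P V V' d u ξ = ∫ z in (0 : ℝ)..1, ((1 - a : ℝ) : ℂ) *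
      polyXi P V V' ![a + (1 - a) * z + (xiLimits u d).U₁, ξ 1, ξ 2] u := by
  rw [integral_unit_substitution fun s => polyXi P V V' ![s, ξ 1, ξ 2] u]
  have : ξ 1 + (xiLimits u d).L₁ = a + (xiLimits u d).U₁ := by
    rw [h, xiLimits_U₂]
    ring
  simp only [pbar, this]

lemma pbar_face_eq {u ξ : Fin 3 → ℝ} {a : ℝ} (h : ξ 2 = a + (xiLimits u d).U₃) :
    pbar .face P V V' d u ξ = ∫ z in (0 : ℝ)..1, ∫ z' in (0 : ℝ)..1,
      (((1 - a) * (1 - (a + (1 - a) * z)) : ℝ) : ℂ) *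
      polyXi P V V' ![a + (1 - a) * z + (1 - (a + (1 - a) * z)) * z' + (xiLimits u d).U₁,
        a + (1 - a) * z + (xiLimits u d).U₂, ξ 2] u := by
  have h2 : ξ 2 + (xiLimits u d).L₂ = a + (xiLimits u d).U₂ := by
    rw [h, xiLimits_U₃]
    ring
  simp only [pbar, h2]
  rw [← integral_unit_substitution fun s₂ => ∫ s₁ in (s₂ + (xiLimits u d).L₁)..
    (1 + (xiLimits u d).U₁), polyXi P V V' ![s₁, s₂, ξ 2] u]
  congr 1
  funext z
  have := pbar_edge_eq P V V' d (u := u)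
    (ξ := ![0, a + (1 - a) * z + (xiLimits u d).U₂, ξ 2]) rfl
  simp only [pbar, Matrix.cons_val] at this
  rw [this, ← intervalIntegral.integral_const_mul]
  simp only [Complex.ofReal_mul, mul_assoc]

lemma pbar_tetrahedron_eq {u : Fin 3 → ℝ} {a : ℝ} (ξ : Fin 3 → ℝ)
    (h : (xiLimits u d).L₃ = a + (xiLimits u d).U₃) :
    pbar .tetrahedron P V V' d u ξ = ∫ z'' in (0 : ℝ)..1, ∫ z in (0 : ℝ)..1, ∫ z' in (0 : ℝ)..1,
      (((1 - a) * (1 - (a + (1 - a) * z'')) * (1 - (a + (1 - a) * z'' +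
        (1 - (a + (1 - a) * z'')) * z)) : ℝ) : ℂ) *
      polyXi P V V' ![a + (1 - a) * z'' + (1 - (a + (1 - a) * z'')) * z +
          (1 - (a + (1 - a) * z'' + (1 - (a + (1 - a) * z'')) * z)) * z' + (xiLimits u d).U₁,
        a + (1 - a) * z'' + (1 - (a + (1 - a) * z'')) * z + (xiLimits u d).U₂,
        a + (1 - a) * z'' + (xiLimits u d).U₃] u := by
  simp only [pbar, h]
  rw [← integral_unit_substitution fun s₃ => ∫ s₂ in (s₃ + (xiLimits u d).L₂)..
    (1 + (xiLimits u d).U₂), ∫ s₁ in (s₂ + (xiLimits u d).L₁)..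
    (1 + (xiLimits u d).U₁), polyXi P V V' ![s₁, s₂, s₃] u]
  congr 1
  funext z''
  have := pbar_face_eq P V V' d (u := u)
    (ξ := ![0, 0, a + (1 - a) * z'' + (xiLimits u d).U₃]) rfl
  simp only [pbar, Matrix.cons_val] at this
  rw [this, ← intervalIntegral.integral_const_mul]
  congr 1
  funext z
  rw [← intervalIntegral.integral_const_mul]
  simp only [Complex.ofReal_mul, mul_assoc]

end

/-! ### The free cube coordinates produce the inner integral. -/

/-- The polynomial factor of the integrand in cell coordinates. -/
noncomputable def cellPoly (c : CommonCase) (P : MvPolynomial (Fin 3 ⊕ Fin 3) ℂ) (V V' : Fin 4 → E3)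
    (d : Fin 18) (t : Fin 6 → ℝ) : ℂ :=
  polyXi P V V' (duffyCell c d t).1 (t 0 • (duffy c d (duffyArg c t)).u)

section

variable (P : MvPolynomial (Fin 3 ⊕ Fin 3) ℂ) (V V' : Fin 4 → E3) (d : Fin 18)

lemma integral_cellPoly_edge (w : ℝ) (y : Fin 4 → ℝ) :
    ∫ z in (0 : ℝ)..1, (freeJac .edge ![w, y 0, y 1, y 2, y 3, z] : ℂ) *
      cellPoly .edge P V V' d ![w, y 0, y 1, y 2, y 3, z] = pbarDuffy .edge P V V' d y w := by
  have hy : ∀ z, duffyArg .edge ![w, y 0, y 1, y 2, y 3, z] = y := fun z => by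
    funext i
    fin_cases i <;> rfl
  have h1 := fun z => (duffyCell_eq .edge d ![w, y 0, y 1, y 2, y 3, z]).1
  have h2 := fun z => duffyCell_kept .edge d ![w, y 0, y 1, y 2, y 3, z]
  -- The kept component does not depend on the free coordinate, so the value `0` chosen for it is
  -- arbitrary; the equation reads `ξ₂ = w + U₂`.
  have e1 := h2 0 1 (by simp [kept, CommonCase.numCV])
  rw [h1, hy] at e1
  change _ = pbar .edge P V V' d (w • (duffy .edge d y).u) (w • (duffy .edge d y).xi)
  rw [pbar_edge_eq P V V' d (a := w) e1.symm]
  congr 1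
  funext z
  congr 1
  rw [cellPoly, hy]
  refine congrArg₂ _ (vec3_ext ?_ ?_ ?_).symm rfl
  · rw [h1, hy]
    rfl
  · rw [h2 z 1 (by simp [kept, CommonCase.numCV]), hy]
    rfl
  · rw [h2 z 2 (by simp [kept, CommonCase.numCV]), hy]
    rfl

lemma integral_cellPoly_face (w : ℝ) (y : Fin 3 → ℝ) :
    ∫ z in (0 : ℝ)..1, ∫ z' in (0 : ℝ)..1, (freeJac .face ![w, y 0, y 1, y 2, z, z'] : ℂ) *
      cellPoly .face P V V' d ![w, y 0, y 1, y 2, z, z'] = pbarDuffy .face P V V' d y w := by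
  have hy : ∀ z z', duffyArg .face ![w, y 0, y 1, y 2, z, z'] = y := fun z z' => by
    funext i
    fin_cases i <;> rfl
  have h1 := fun z z' => (duffyCell_eq .face d ![w, y 0, y 1, y 2, z, z']).1
  have h2 := fun z z' => duffyCell_kept .face d ![w, y 0, y 1, y 2, z, z']
  have e1 := h2 0 0 2 (by simp [kept, CommonCase.numCV])
  rw [h1, hy] at e1
  change _ = pbar .face P V V' d (w • (duffy .face d y).u) (w • (duffy .face d y).xi)
  rw [pbar_face_eq P V V' d (a := w) e1.symm]
  congr 1
  funext z
  congr 1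
  funext z'
  congr 1
  rw [cellPoly, hy]
  refine congrArg₂ _ (vec3_ext ?_ ?_ ?_).symm rfl
  · rw [h1, hy]
    rfl
  · rw [h1, hy]
    rfl
  · rw [h2 z z' 2 (by simp [kept, CommonCase.numCV]), hy]
    rfl

lemma integral_cellPoly_tetrahedron (w : ℝ) (y : Fin 2 → ℝ) :
    ∫ z'' in (0 : ℝ)..1, ∫ z in (0 : ℝ)..1, ∫ z' in (0 : ℝ)..1,
      (freeJac .tetrahedron ![w, y 0, y 1, z'', z, z'] : ℂ) *
      cellPoly .tetrahedron P V V' d ![w, y 0, y 1, z'', z, z'] =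
      pbarDuffy .tetrahedron P V V' d y w := by
  have hy : ∀ z'' z z', duffyArg .tetrahedron ![w, y 0, y 1, z'', z, z'] = y := fun z'' z z' => by
    funext i
    fin_cases i <;> rfl
  have h1 := fun z'' z z' => (duffyCell_eq .tetrahedron d ![w, y 0, y 1, z'', z, z']).1
  have h3 := coneVec_arrange .tetrahedron d ![w, y 0, y 1, 0, 0, 0]
  rw [hy] at h3
  -- For a common tetrahedron `w` is `β 0` itself, which gives the lower limit `L₃ = w + U₃`; the
  -- free coordinates are set to `0` arbitrarily.
  have h4 := L₃_sub_U₃ (cellSwap .tetrahedron)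
    (arrange .tetrahedron (cellCoord .tetrahedron (isPyramid d) ![w, y 0, y 1, 0, 0, 0])).1 d
  rw [h3, sub_eq_iff_eq_add] at h4
  change (xiLimits (w • (duffy .tetrahedron d y).u) d).L₃ =
    w + (xiLimits (w • (duffy .tetrahedron d y).u) d).U₃ at h4
  change _ = pbar .tetrahedron P V V' d (w • (duffy .tetrahedron d y).u)
    (w • (duffy .tetrahedron d y).xi)
  rw [pbar_tetrahedron_eq P V V' d (a := w) _ h4]
  refine intervalIntegral.integral_congr fun z'' _ => intervalIntegral.integral_congr fun z _ =>
    intervalIntegral.integral_congr fun z' _ => ?_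
  simp only [cellPoly, hy]
  refine congrArg₂ (· * ·) (congrArg _ (by simp [freeJac]))
    (congrArg₂ _ (vec3_ext ?_ ?_ ?_).symm rfl)
    <;> rw [h1, hy] <;> simp [freeArg, arrange, cellIndex, cellCoord]

/-- Integration over the variables of the cube on which the distance does not depend. -/
lemma integral_cube_cellPoly (c : CommonCase) (h : ℝ → (Fin c.dimY → ℝ) → ℂ)
    (hf : IntegrableOn (fun t => h (t 0) (duffyArg c t) * ((freeJac c t : ℂ) *
      cellPoly c P V V' d t)) (cube 6)) :
    (∀ᵐ y ∂volume.restrict (cube c.dimY),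
      IntegrableOn (fun w => h w y * pbarDuffy c P V V' d y w) (Ioo 0 1)) ∧
    IntegrableOn (fun y => ∫ w in (0 : ℝ)..1, h w y * pbarDuffy c P V V' d y w) (cube c.dimY) ∧
    ∫ t in cube 6, h (t 0) (duffyArg c t) * ((freeJac c t : ℂ) * cellPoly c P V V' d t) =
      ∫ y in cube c.dimY, ∫ w in (0 : ℝ)..1, h w y * pbarDuffy c P V V' d y w := by
  cases c with
  | edge =>
    -- The free coordinates come last and are removed from the end; removing coordinate `0`
    -- afterwards separates `w` from `y`.
    obtain ⟨-, h1, e1⟩ := integral_cube_succ (Fin.last 5) hf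
    obtain ⟨h2, h3, e2⟩ := integral_cube_succ 0 h1
    have key : ∀ (w : ℝ) (y : Fin 4 → ℝ), (∫ z in (0 : ℝ)..1,
        (fun t => h (t 0) (duffyArg .edge t) * ((freeJac .edge t : ℂ) * cellPoly .edge P V V' d t))
          ((Fin.last 5).insertNth (α := fun _ => ℝ) z (Fin.insertNth (α := fun _ => ℝ) 0 w y))) =
        h w y * pbarDuffy .edge P V V' d y w := by
      intro w y
      have ht : ∀ z, (Fin.last 5).insertNth (α := fun _ => ℝ) z
          (Fin.insertNth (α := fun _ => ℝ) 0 w y) = ![w, y 0, y 1, y 2, y 3, z] := fun z => by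
        funext i
        fin_cases i <;> rfl
      have hy : ∀ z, duffyArg .edge ![w, y 0, y 1, y 2, y 3, z] = y := fun z => by
        funext i
        fin_cases i <;> rfl
      simp only [ht, hy, Matrix.cons_val_zero]
      rw [intervalIntegral.integral_const_mul, integral_cellPoly_edge]
    simp only [key] at h2 h3 e2
    exact ⟨h2, h3, e1.trans e2⟩
  | face =>
    obtain ⟨-, h1, e1⟩ := integral_cube_succ (Fin.last 5) hf
    obtain ⟨-, h1', e1'⟩ := integral_cube_succ (Fin.last 4) h1
    obtain ⟨h2, h3, e2⟩ := integral_cube_succ 0 h1'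
    have key : ∀ (w : ℝ) (y : Fin 3 → ℝ), (∫ z in (0 : ℝ)..1, ∫ z' in (0 : ℝ)..1,
        (fun t => h (t 0) (duffyArg .face t) * ((freeJac .face t : ℂ) * cellPoly .face P V V' d t))
          ((Fin.last 5).insertNth (α := fun _ => ℝ) z' ((Fin.last 4).insertNth (α := fun _ => ℝ) z
            (Fin.insertNth (α := fun _ => ℝ) 0 w y)))) =
        h w y * pbarDuffy .face P V V' d y w := by
      intro w y
      have ht : ∀ z z', (Fin.last 5).insertNth (α := fun _ => ℝ) z'
          ((Fin.last 4).insertNth (α := fun _ => ℝ) z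
            (Fin.insertNth (α := fun _ => ℝ) 0 w y)) = ![w, y 0, y 1, y 2, z, z'] := fun z z' => by
        funext i
        fin_cases i <;> rfl
      have hy : ∀ z z', duffyArg .face ![w, y 0, y 1, y 2, z, z'] = y := fun z z' => by
        funext i
        fin_cases i <;> rfl
      simp only [ht, hy, Matrix.cons_val_zero, intervalIntegral.integral_const_mul]
      rw [integral_cellPoly_face]
    simp only [key] at h2 h3 e2
    exact ⟨h2, h3, e1.trans (e1'.trans e2)⟩
  | tetrahedron =>
    obtain ⟨-, h1, e1⟩ := integral_cube_succ (Fin.last 5) hf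
    obtain ⟨-, h1', e1'⟩ := integral_cube_succ (Fin.last 4) h1
    obtain ⟨-, h1'', e1''⟩ := integral_cube_succ (Fin.last 3) h1'
    obtain ⟨h2, h3, e2⟩ := integral_cube_succ 0 h1''
    have key : ∀ (w : ℝ) (y : Fin 2 → ℝ), (∫ z'' in (0 : ℝ)..1, ∫ z in (0 : ℝ)..1,
        ∫ z' in (0 : ℝ)..1, (fun t => h (t 0) (duffyArg .tetrahedron t) *
          ((freeJac .tetrahedron t : ℂ) * cellPoly .tetrahedron P V V' d t))
          ((Fin.last 5).insertNth (α := fun _ => ℝ) z' ((Fin.last 4).insertNth (α := fun _ => ℝ) z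
            ((Fin.last 3).insertNth (α := fun _ => ℝ) z''
              (Fin.insertNth (α := fun _ => ℝ) 0 w y))))) =
        h w y * pbarDuffy .tetrahedron P V V' d y w := by
      intro w y
      have ht : ∀ z'' z z', (Fin.last 5).insertNth (α := fun _ => ℝ) z'
          ((Fin.last 4).insertNth (α := fun _ => ℝ) z
            ((Fin.last 3).insertNth (α := fun _ => ℝ) z''
              (Fin.insertNth (α := fun _ => ℝ) 0 w y))) =
          ![w, y 0, y 1, z'', z, z'] := fun z'' z z' => by
        funext i
        fin_cases i <;> rfl
      have hy : ∀ z'' z z', duffyArg .tetrahedron ![w, y 0, y 1, z'', z, z'] = y :=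
        fun z'' z z' => by
          funext i
          fin_cases i <;> rfl
      simp only [ht, hy, Matrix.cons_val_zero, intervalIntegral.integral_const_mul]
      rw [integral_cellPoly_tetrahedron]
    simp only [key] at h2 h3 e2
    exact ⟨h2, h3, e1.trans (e1'.trans (e1''.trans e2))⟩

end

/-! ### The volume of the standard simplex and integrals over tetrahedra -/

lemma simplex_ae_eq : simplexInt =ᵐ[volume] simplex := by
  have key : ∀ a : Fin 3 → ℝ, (∃ v : Fin 3 → ℝ, a 0 * v 0 + a 1 * v 1 + a 2 * v 2 ≠ 0) →
      ∀ c : ℝ, ∀ᵐ z : Fin 3 → ℝ, a 0 * z 0 + a 1 * z 1 + a 2 * z 2 ≠ c := by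
    rintro a ⟨v, hv⟩ c
    exact ae_ne_of_isLinearMap volume (f := fun z : Fin 3 → ℝ => a 0 * z 0 + a 1 * z 1 + a 2 * z 2)
      ⟨fun x y => by simp; ring, fun r x => by simp; ring⟩ hv c
  filter_upwards [key ![1, 0, 0] ⟨![1, 0, 0], by simp⟩ 1,
    key ![1, -1, 0] ⟨![1, 0, 0], by simp⟩ 0, key ![0, 1, -1] ⟨![0, 1, 0], by simp⟩ 0,
    key ![0, 0, 1] ⟨![0, 0, 1], by simp⟩ 0] with z a1 a2 a3 a4
  simp at a1 a2 a3 a4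
  refine propext ⟨fun h => simplexInt_subset h, fun ⟨h1, h2, h3, h4⟩ =>
    ⟨lt_of_le_of_ne h1 (Ne.symm a4), lt_of_le_of_ne h2 ?_, lt_of_le_of_ne h3 ?_,
      lt_of_le_of_ne h4 a1⟩⟩
  · exact fun h => a3 (by linarith)
  · exact fun h => a2 (by linarith)

lemma volume_real_simplex : volume.real simplex = 1 / 6 := by
  set A : (Fin 3 → ℝ) → Fin 3 → ℝ := fun _ => 0 with hA
  set B : (Fin 3 → ℝ) → Fin 3 → ℝ := fun σ => ![1, σ 0, σ 1] with hB
  set F : (Fin 3 → ℝ) → Fin 3 → ℝ := fun t => ![t 0, t 0 * t 1, t 0 * t 1 * t 2] with hF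
  have h := (integral_triangular (A := A) (B := B) (F := F) (fun _ _ _ _ => rfl)
    (fun σ σ' j h => by fin_cases j <;> simp [hB, h])
    (fun t j => by fin_cases j <;> simp [hA, hB, hF])
    (by
      rw [differentiable_pi]
      intro j
      fin_cases j <;> simp [hF] <;> fun_prop)
    (fun t ht j => by
      have h0 := fun i => (mem_cube.1 ht i).1
      fin_cases j <;> simp [hB, hF, h0]) (fun _ => 1)).2
  have hs : {σ | ∀ j, A σ j < σ j ∧ σ j < A σ j + B σ j} = simplexInt := by
    ext σ
    simp only [hA, hB, simplexInt, mem_ofPred_eq, Fin.forall_fin_succ, Fin.forall_fin_zero]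
    simp
    constructor <;> intro h <;> casesm* _ ∧ _ <;> and_intros <;> linarith
  rw [hs, setIntegral_congr_set simplex_ae_eq, setIntegral_const] at h
  -- The Jacobian of the successive ratios is `t₁² t₂`, with integral `1/3 · 1/2`.
  have h2 : ∫ t in cube 3, (∏ j, B (F t) j) • (1 : ℂ) = 1 / 6 := by
    have e : ∀ t : Fin 3 → ℝ, (∏ j, B (F t) j) • (1 : ℂ) =
        ∏ j, (![fun x => ((x ^ 2 : ℝ) : ℂ), fun x => (x : ℂ), fun _ => 1] :
          Fin 3 → ℝ → ℂ) j (t j) := by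
      intro t
      simp [Fin.prod_univ_three, hB, hF]
      ring
    simp only [e]
    rw [cube, volume_pi, Measure.restrict_pi_pi, integral_fintype_prod_eq_prod,
      Fin.prod_univ_three]
    simp only [Matrix.cons_val]
    simp only [← integral_Ioc_eq_integral_Ioo, ← intervalIntegral.integral_of_le zero_le_one]
    rw [intervalIntegral.integral_ofReal, intervalIntegral.integral_ofReal, integral_pow,
      integral_id]
    norm_num
  rw [h2] at h
  simp only [Complex.real_smul, mul_one] at h
  have h' : ((volume.real simplex : ℝ) : ℂ) = ((1 / 6 : ℝ) : ℂ) := by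
    rw [h]
    norm_num
  exact_mod_cast h'

/-- The parametrization of a tetrahedron multiplies volumes by a constant. -/
lemma map_point {V : Fin 4 → E3} (hV : AffineIndependent ℝ V) :
    ∃ k : NNReal, k ≠ 0 ∧ Measure.map (point V) volume = k • (volume : Measure E3) ∧
      (k : ℝ) * volume.real (tet V) = 1 / 6 := by
  have hinj := edgeMap_injective hV
  set L : (Fin 3 → ℝ) ≃ₗ[ℝ] E3 := LinearEquiv.ofInjectiveOfFinrankEq (edgeMap V) hinj (by simp)
    with hL
  have hLe : ∀ ξ, L ξ = edgeMap V ξ := fun ξ => rfl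
  have hmap : Measure.map (point V) volume = Measure.map L.toContinuousLinearEquiv volume := by
    have h1 : point V = (fun x => V 0 + x) ∘ L.toContinuousLinearEquiv := by
      funext ξ
      rfl
    rw [h1, ← Measure.map_map (measurable_const_add _)
      L.toContinuousLinearEquiv.continuous.measurable]
    exact map_add_left_eq_self _ _
  set k := Measure.addHaarScalarFactor (Measure.map L.toContinuousLinearEquiv volume)
    (volume : Measure E3) with hk
  have h2 : Measure.map L.toContinuousLinearEquiv volume = k • (volume : Measure E3) :=
    Measure.isAddLeftInvariant_eq_smul _ _
  refine ⟨k, ?_, hmap.trans h2, ?_⟩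
  · exact (Measure.addHaarScalarFactor_pos_of_isAddHaarMeasure _ _).ne'
  · have h3 : Measure.map (point V) volume (tet V) = volume simplex := by
      have he : MeasurableEmbedding (point V) :=
        (continuous_point V).measurableEmbedding (point_injective hV)
      rw [he.map_apply, tet_eq_image, preimage_image_eq _ (point_injective hV)]
    rw [hmap, h2] at h3
    rw [← volume_real_simplex, measureReal_def, measureReal_def, ← h3]
    simp

lemma integral_tet_prod {V V' : Fin 4 → E3} (hV : AffineIndependent ℝ V)
    (hV' : AffineIndependent ℝ V') (f : E3 × E3 → ℂ) :
    (IntegrableOn f (tet V ×ˢ tet V') ↔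
      IntegrableOn (fun z => f (point V z.1, point V' z.2)) (simplex ×ˢ simplex)) ∧
    ∫ z in tet V ×ˢ tet V', f z = ((36 * volume.real (tet V) * volume.real (tet V') : ℝ) : ℂ) *
      ∫ z in simplex ×ˢ simplex, f (point V z.1, point V' z.2) := by
  obtain ⟨k, hk, hm, hv⟩ := map_point hV
  obtain ⟨k', hk', hm', hv'⟩ := map_point hV'
  have hφ : MeasurableEmbedding (Prod.map (point V) (point V')) :=
    ((continuous_point V).prodMap (continuous_point V')).measurableEmbedding
      ((point_injective hV).prodMap (point_injective hV'))
  have hmap : Measure.map (Prod.map (point V) (point V'))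
      (volume : Measure ((Fin 3 → ℝ) × (Fin 3 → ℝ))) = (k * k') • (volume : Measure (E3 × E3)) := by
    rw [Measure.volume_eq_prod, ← Measure.map_prod_map _ _ (continuous_point V).measurable
      (continuous_point V').measurable, hm, hm', Measure.volume_eq_prod]
    rw [Measure.prod_smul_left, Measure.prod_smul_right, smul_smul]
  have hpre : Prod.map (point V) (point V') ⁻¹' (tet V ×ˢ tet V') = simplex ×ˢ simplex := by
    rw [preimage_prod_map_prod, tet_eq_image, tet_eq_image,
      preimage_image_eq _ (point_injective hV), preimage_image_eq _ (point_injective hV')]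
  have h1 := hφ.integrableOn_map_iff (f := f) (μ := volume) (s := tet V ×ˢ tet V')
  have h2 := hφ.setIntegral_map (μ := volume) f (tet V ×ˢ tet V')
  rw [hmap, hpre] at h1 h2
  constructor
  · rw [← Function.comp_def f] at *
    refine Iff.trans ?_ h1
    rw [IntegrableOn, IntegrableOn, Measure.restrict_smul]
    exact (integrable_smul_measure (by simpa using ⟨hk, hk'⟩)
      (by simpa using ENNReal.mul_ne_top ENNReal.coe_ne_top ENNReal.coe_ne_top)).symm
  · rw [show (fun z : (Fin 3 → ℝ) × (Fin 3 → ℝ) => f (point V z.1, point V' z.2)) =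
      fun z => f (Prod.map (point V) (point V') z) from rfl, ← h2, Measure.restrict_smul,
      integral_smul_nnreal_measure, NNReal.smul_def, Complex.real_smul, ← mul_assoc,
      ← Complex.ofReal_mul]
    -- Each scaling constant satisfies `k 𝒱 = 1/6`, so the factor `36 𝒱 𝒱'` cancels `k k'`.
    have : 36 * volume.real (tet V) * volume.real (tet V') * ((k * k' : NNReal) : ℝ) = 1 := by
      push_cast
      calc _ = 36 * (k * volume.real (tet V)) * (k' * volume.real (tet V')) := by ring
        _ = 1 := by rw [hv, hv']; norm_num
    rw [this]
    simp

/-! ### The reduction formula -/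

section Reduction

variable {c : CommonCase} {V V' : Fin 4 → E3}

/-- The integrand in cell coordinates. -/
lemma kernelIntegrand_duffyCell (hcommon : ∀ i : Fin 4, (i : ℕ) < c.numCV → V i = V' i)
    (P : MvPolynomial (Fin 3 ⊕ Fin 3) ℂ) (K : ℝ → ℂ) (d : Fin 18) {t : Fin 6 → ℝ} (ht : 0 ≤ t 0) :
    duffyCellJac c d t •
      kernelIntegrand P K (point V (duffyCell c d t).1) (point V' (duffyCell c d t).2) =
    ((t 0 ^ c.dimY * (duffy c d (duffyArg c t)).jac : ℝ) : ℂ) *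
      K (t 0 * xdist c V V' d (duffyArg c t)) * ((freeJac c t : ℂ) * cellPoly c P V V' d t) := by
  have h1 : ‖point V (duffyCell c d t).1 - point V' (duffyCell c d t).2‖ =
      t 0 * xdist c V V' d (duffyArg c t) := by
    rw [(duffyCell_eq c d t).2]
    exact pairDist_smul hcommon ht (duffyCell_kept c d t)
  rw [kernelIntegrand, h1, (duffyCell_eq c d t).2, duffyCellJac_eq, Complex.real_smul, cellPoly,
    polyXi]
  push_cast
  ring

lemma xdist_nonneg (d : Fin 18) (y : Fin c.dimY → ℝ) : 0 ≤ xdist c V V' d y := norm_nonneg _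

/-- The integral over `w` in terms of the first integrals of the kernel. -/
lemma integral_pbarDuffy {K : ℝ → ℂ} (hK : LocallyIntegrableOn K (Ioi 0))
    (P : MvPolynomial (Fin 3 ⊕ Fin 3) ℂ) (d : Fin 18) (y : Fin c.dimY → ℝ)
    (h : IntegrableOn (fun w : ℝ => ((w ^ c.dimY * (duffy c d y).jac : ℝ) : ℂ) *
      K (w * xdist c V V' d y) * pbarDuffy c P V V' d y w) (Ioo 0 1)) :
    ∫ w in (0 : ℝ)..1, ((w ^ c.dimY * (duffy c d y).jac : ℝ) : ℂ) *
      K (w * xdist c V V' d y) * pbarDuffy c P V V' d y w =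
    ((duffy c d y).jac : ℂ) * ∑ n ∈ Finset.range (numTerms c P),
      pcoeff c P V V' d n y * firstIntegral K (n + c.dimY) (xdist c V V' d y) := by
  rcases eq_or_ne (duffy c d y).jac 0 with h0 | h0
  · simp [h0]
  set X := xdist c V V' d y with hX
  obtain ⟨-, e⟩ := pbarDuffy_eq_sum c P V V' d
  have h0' : ((duffy c d y).jac : ℂ) ≠ 0 := by exact_mod_cast h0
  set p : Polynomial ℂ := ∑ k ∈ Finset.range (numTerms c P),
    Polynomial.C (pcoeff c P V V' d k y) * Polynomial.X ^ k with hp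
  have hpe : ∀ w : ℝ, pbarDuffy c P V V' d y w = p.eval (w : ℂ) := fun w => by
    rw [e, hp, Polynomial.eval_finsetSum]
    simp
  have hcoeff : ∀ n ∈ Finset.range (numTerms c P), p.coeff n = pcoeff c P V V' d n y := by
    intro n hn
    rw [hp, Polynomial.finsetSum_coeff]
    simp only [Polynomial.coeff_C_mul_X_pow, Finset.sum_ite_eq, if_pos hn]
  have h1 : IntegrableOn (fun w : ℝ => ((w ^ c.dimY : ℝ) : ℂ) * p.eval (w : ℂ) * K (w * X))
      (Ioc 0 1) := by
    rw [integrableOn_Ioc_iff_integrableOn_Ioo]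
    refine IntegrableOn.congr_fun (h.const_mul ((duffy c d y).jac : ℂ)⁻¹) (fun w _ => ?_)
      measurableSet_Ioo
    simp only [hpe, Complex.ofReal_mul]
    field_simp
  have hterm : ∀ n ∈ Finset.range (numTerms c P), IntervalIntegrable (fun w : ℝ =>
      pcoeff c P V V' d n y * (((w ^ (n + c.dimY) : ℝ) : ℂ) * K (w * X))) volume 0 1 := by
    intro n hn
    -- When a coefficient vanishes the corresponding first integral need not converge, but the
    -- product is identically zero.
    rcases eq_or_ne (pcoeff c P V V' d n y) 0 with hz | hz
    · simp [hz]
    · refine IntervalIntegrable.const_mul ?_ _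
      rw [intervalIntegrable_iff_integrableOn_Ioc_of_le zero_le_one]
      -- Without an assumption on how the tetrahedra meet, `X = 0` may occur; the kernel factor is
      -- then the constant `K 0`.
      rcases (xdist_nonneg d y : 0 ≤ xdist c V V' d y).eq_or_lt with hX0 | hX0
      · rw [← hX] at hX0
        rw [← hX0]
        simp only [mul_zero]
        refine Integrable.mul_const ?_ _
        exact (Continuous.integrableOn_Icc (by fun_prop)).mono_set Ioc_subset_Icc_self
      · exact integrable_terms hK hX0 _ p h1 (by rwa [hcoeff n hn])
  have h2 : ∀ w : ℝ, ((w ^ c.dimY * (duffy c d y).jac : ℝ) : ℂ) * K (w * X) *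
      pbarDuffy c P V V' d y w = ((duffy c d y).jac : ℂ) * ∑ n ∈ Finset.range (numTerms c P),
        pcoeff c P V V' d n y * (((w ^ (n + c.dimY) : ℝ) : ℂ) * K (w * X)) := by
    intro w
    rw [e, Finset.mul_sum, Finset.mul_sum]
    refine Finset.sum_congr rfl fun n _ => ?_
    push_cast
    ring
  simp only [h2]
  rw [intervalIntegral.integral_const_mul, intervalIntegral.integral_finsetSum hterm]
  simp only [intervalIntegral.integral_const_mul]
  rfl

theorem reduction_formula (hV : AffineIndependent ℝ V) (hV' : AffineIndependent ℝ V')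
    (hcommon : ∀ i : Fin 4, (i : ℕ) < c.numCV → V i = V' i)
    (P : MvPolynomial (Fin 3 ⊕ Fin 3) ℂ) {K : ℝ → ℂ} (hK : LocallyIntegrableOn K (Ioi 0))
    (hint : IntegrableOn (fun z : E3 × E3 => kernelIntegrand P K z.1 z.2) (tet V ×ˢ tet V')) :
    IntegrableOn (reducedIntegrand c P K V V') (Icc 0 1) ∧
    ∫ x in tet V, ∫ x' in tet V', kernelIntegrand P K x x' =
      ((36 * volume.real (tet V) * volume.real (tet V') : ℝ) : ℂ) *
        ∫ y in Icc (0 : Fin c.dimY → ℝ) 1, reducedIntegrand c P K V V' y := by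
  obtain ⟨h1, h2⟩ := integral_tet_prod hV hV' fun z : E3 × E3 => kernelIntegrand P K z.1 z.2
  have h3 := h1.1 hint
  obtain ⟨h4, h5⟩ := integral_simplex_prod_eq_cube c fun z =>
    kernelIntegrand P K (point V z.1) (point V' z.2)
  have hm : MeasurableSet (cube 6) := (isOpen_cube 6).measurableSet
  have hcell : ∀ d, EqOn (fun t => duffyCellJac c d t •
      kernelIntegrand P K (point V (duffyCell c d t).1) (point V' (duffyCell c d t).2))
      (fun t => ((t 0 ^ c.dimY * (duffy c d (duffyArg c t)).jac : ℝ) : ℂ) *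
      K (t 0 * xdist c V V' d (duffyArg c t)) * ((freeJac c t : ℂ) * cellPoly c P V V' d t))
      (cube 6) := fun d t ht =>
    kernelIntegrand_duffyCell hcommon P K d (mem_cube.1 ht 0).1.le
  have h6 := fun d => integral_cube_cellPoly P V V' d c (fun w y =>
    ((w ^ c.dimY * (duffy c d y).jac : ℝ) : ℂ) * K (w * xdist c V V' d y))
    ((integrableOn_congr_fun (hcell d) hm).1 (h4.1 h3 d))
  have h7 : (fun y => ∑ d, ∫ w in (0 : ℝ)..1, ((w ^ c.dimY * (duffy c d y).jac : ℝ) : ℂ) *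
      K (w * xdist c V V' d y) * pbarDuffy c P V V' d y w) =ᵐ[volume.restrict (cube c.dimY)]
      reducedIntegrand c P K V V' := by
    -- Fubini gives integrability in `w` only for almost every `y`, which is enough to identify the
    -- reduced integrand.
    filter_upwards [ae_all_iff.2 fun d => (h6 d).1] with y hy
    exact Finset.sum_congr rfl fun d _ => integral_pbarDuffy hK P d y (hy d)
  constructor
  · rw [← integrableOn_congr_set_ae (cube_ae_eq _)]
    exact (integrable_finsetSum _ fun d _ => (h6 d).2.1).congr h7
  · rw [← setIntegral_congr_set (cube_ae_eq _), ← integral_congr_ae h7,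
      integral_finsetSum _ fun d _ => (h6 d).2.1]
    have h8 := setIntegral_prod (μ := volume) (ν := volume) _ hint
    rw [← Measure.volume_eq_prod] at h8
    rw [← h8, h2, h5 h3]
    congr 1
    refine Finset.sum_congr rfl fun d _ => ?_
    rw [← (h6 d).2.2]
    exact setIntegral_congr_fun hm (hcell d)

end Reduction

/-! ### Desingularization -/

lemma continuous_of_mem_polyFun {ι : Type*} {f : (ι → ℝ) → ℂ} (hf : f ∈ polyFun ι) :
    Continuous f := by
  obtain ⟨Q, hQ⟩ := mem_polyFun.1 hf
  rw [funext hQ]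
  exact (MvPolynomial.continuous_eval Q).comp (by fun_prop)

lemma RealMem.continuous {ι : Type*} {f : (ι → ℝ) → ℝ} (hf : RealMem (polyFun ι) f) :
    Continuous f :=
  Complex.continuous_re.comp (continuous_of_mem_polyFun hf)

lemma continuous_duffy_jac (c : CommonCase) (d : Fin 18) :
    Continuous fun y => (duffy c d y).jac := (realMem_duffy c d).1.continuous

lemma continuous_xdist (c : CommonCase) (V V' : Fin 4 → E3) (d : Fin 18) :
    Continuous (xdist c V V' d) := by
  have hu : Continuous fun y => (duffy c d y).u :=
    continuous_pi fun i => ((realMem_duffy c d).2.1 i).continuous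
  have hx : Continuous fun y => (duffy c d y).xi :=
    continuous_pi fun i => ((realMem_duffy c d).2.2 i).continuous
  exact (((continuous_point V).comp hx).sub ((continuous_point V').comp (hx.add hu))).norm

lemma continuous_duffyArg (c : CommonCase) : Continuous (duffyArg c) :=
  continuous_pi fun _ => continuous_apply _

lemma continuous_freeJac (c : CommonCase) : Continuous (freeJac c) := by
  change Continuous fun t => freeJac c t
  cases c <;> simp only [freeJac] <;> fun_prop

lemma continuous_arrange (c : CommonCase) : Continuous (arrange c) :=
  (continuous_pi fun _ => continuous_apply _).prodMk (continuous_pi fun _ => continuous_apply _)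

lemma continuous_duffyCell (c : CommonCase) (d : Fin 18) : Continuous (duffyCell c d) :=
  (continuous_cellMap _ d).comp
    ((continuous_arrange c).comp (contDiff_cellCoord c (isPyramid d)).continuous)

lemma continuous_duffyCellJac (c : CommonCase) (d : Fin 18) : Continuous (duffyCellJac c d) := by
  have : duffyCellJac c d = fun t =>
      t 0 ^ c.dimY * (duffy c d (duffyArg c t)).jac * freeJac c t :=
    funext fun t => duffyCellJac_eq c d t
  rw [this]
  exact (((continuous_apply 0).pow _).mul ((continuous_duffy_jac c d).comp
    (continuous_duffyArg c))).mul (continuous_freeJac c)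

lemma continuous_polyEval (P : MvPolynomial (Fin 3 ⊕ Fin 3) ℂ) :
    Continuous fun z : E3 × E3 => polyEval P z.1 z.2 := by
  refine (MvPolynomial.continuous_eval P).comp (continuous_pi fun i => ?_)
  rcases i with i | i
  · exact (by fun_prop : Continuous fun z : E3 × E3 => (z.1 i : ℂ))
  · exact (by fun_prop : Continuous fun z : E3 × E3 => (z.2 i : ℂ))

/-- The open cube is mapped into the closed set `simplex ×ˢ simplex`; continuity extends this to the
closed cube, including degenerate parameters. -/
lemma duffyCell_mem (c : CommonCase) (d : Fin 18) {t : Fin 6 → ℝ}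
    (ht : t ∈ Icc (0 : Fin 6 → ℝ) 1) : duffyCell c d t ∈ simplex ×ˢ simplex := by
  have hcl : t ∈ closure (cube 6) := by
    rw [cube, closure_pi_set]
    simp only [closure_Ioo zero_ne_one]
    exact fun i _ => ⟨ht.1 i, ht.2 i⟩
  have hclosed : IsClosed (simplex ×ˢ simplex) := by
    have : IsClosed simplex := by
      have h : simplex = {ξ | 0 ≤ ξ 2} ∩ {ξ | ξ 2 ≤ ξ 1} ∩ {ξ | ξ 1 ≤ ξ 0} ∩ {ξ | ξ 0 ≤ 1} := by
        ext ξ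
        simp only [simplex, mem_ofPred_eq, mem_inter_iff]
        tauto
      rw [h]
      repeat' apply IsClosed.inter
      all_goals exact isClosed_le (by fun_prop) (by fun_prop)
    exact this.prod this
  rw [← hclosed.closure_eq]
  refine map_mem_closure (continuous_duffyCell c d) hcl fun s hs => ?_
  have h1 : arrange c (cellCoord c (isPyramid d) s) ∈ cellDom (isPyramid d) := by
    rw [← mem_preimage, arrange_preimage]
    intro j
    have h2 := cellLength_pos c (isPyramid d) hs j
    obtain ⟨h3, h4⟩ := mem_cube.1 hs j
    have e := cellCoord_eq c (isPyramid d) s j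
    constructor
    · linarith [mul_pos h2 h3]
    · linarith [mul_pos h2 (sub_pos.2 h4)]
  exact cellMap_mem _ d (coneDom_subset _ h1.1)
    ⟨h1.2.1.le, h1.2.2.1.le, h1.2.2.2.1.le, h1.2.2.2.2.le⟩

section Common

variable {c : CommonCase} {V V' : Fin 4 → E3}

lemma exists_duffyArg_eq {y : Fin c.dimY → ℝ} (hy : y ∈ Icc 0 1) :
    ∃ t ∈ Icc (0 : Fin 6 → ℝ) 1, t 0 = 1 ∧ duffyArg c t = y := by
  have h4 : c.dimY ≤ 4 := by cases c <;> decide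
  refine ⟨fun i => if h : 1 ≤ (i : ℕ) ∧ (i : ℕ) ≤ c.dimY then y ⟨i - 1, by omega⟩ else 1,
    ⟨fun i => ?_, fun i => ?_⟩, ?_, ?_⟩
  · dsimp only
    split_ifs
    exacts [hy.1 _, zero_le_one]
  · dsimp only
    split_ifs
    exacts [hy.2 _, le_rfl]
  · simp
  · funext i
    have := i.2
    simp only [duffyArg]
    rw [dif_pos ⟨by omega, by omega⟩]
    rfl

/-- At `w = 1` the pair really lies in the two simplices, so `pairDist_pos` applies. If `u` and the
kept components of `ξ` all vanished, then `α₂`, `α₃` or `β₁`, in the three cases respectively, would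
be `0`, although it equals `w = 1`. -/
lemma xdist_pos (hV : AffineIndependent ℝ V) (hV' : AffineIndependent ℝ V')
    (hcommon : ∀ i : Fin 4, (i : ℕ) < c.numCV → V i = V' i) (hmeet : MeetInCommonSimplex c V V')
    (d : Fin 18) {y : Fin c.dimY → ℝ} (hy : y ∈ Icc 0 1) : 0 < xdist c V V' d y := by
  obtain ⟨t, ht, ht0, rfl⟩ := exists_duffyArg_eq hy
  obtain ⟨h1, h2⟩ := duffyCell_mem c d ht
  obtain ⟨h3, h4⟩ := duffyCell_eq c d t
  have h5 := pairDist_smul hcommon (zero_le_one : (0 : ℝ) ≤ 1)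
    (fun i hi => by rw [duffyCell_kept c d t i hi, ht0]) (u := (duffy c d (duffyArg c t)).u)
    (ξ := (duffyCell c d t).1) (ζ := (duffy c d (duffyArg c t)).xi)
  rw [one_smul, one_mul] at h5
  rw [ht0, one_smul] at h3 h4
  rw [h4] at h2
  rw [xdist, ← h5]
  refine pairDist_pos hV hV' hcommon hmeet h1 h2 ?_
  by_contra! hne
  obtain ⟨hk, hu⟩ := hne
  have hz := xiLimits_smul 0 0 d
  simp only [zero_smul, zero_mul] at hz
  rw [hu] at h3
  have hs : shift d 0 = 0 := vec3_ext hz.2.2.2.2.2 hz.2.2.2.1 hz.2.1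
  rw [hs, add_zero] at h3
  cases c with
  | edge =>
    have := hk 1 (by simp [kept, CommonCase.numCV])
    rw [h3] at this
    simp [freeArg, arrange, cellIndex, cellCoord, ht0] at this
  | face =>
    have := hk 2 (by simp [kept, CommonCase.numCV])
    rw [h3] at this
    simp [freeArg, arrange, cellIndex, cellCoord, ht0] at this
  | tetrahedron =>
    have h6 := coneVec_arrange .tetrahedron d t
    rw [hu, smul_zero] at h6
    have h7 := L₃_sub_U₃ (cellSwap .tetrahedron)
      (arrange .tetrahedron (cellCoord .tetrahedron (isPyramid d) t)).1 d
    rw [h6, hz.1, hz.2.1] at h7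
    simp [arrange, cellIndex, cellCoord, ht0] at h7

/-- Integrability for tetrahedra that meet only in their common simplex. -/
theorem integrableOn_kernelIntegrand (hV : AffineIndependent ℝ V) (hV' : AffineIndependent ℝ V')
    (hcommon : ∀ i : Fin 4, (i : ℕ) < c.numCV → V i = V' i) (hmeet : MeetInCommonSimplex c V V')
    {P : MvPolynomial (Fin 3 ⊕ Fin 3) ℂ} {K : ℝ → ℂ} {q : ℝ} {m : ℕ} (hK : ContinuousOn K (Ioi 0))
    (hO : K =O[𝓝[>] 0] fun r : ℝ => r ^ (-q)) (hP : VanishesOnDiagonal P m)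
    (hq : q ≤ ((c.dimY + m : ℕ) : ℝ)) :
    IntegrableOn (fun z : E3 × E3 => kernelIntegrand P K z.1 z.2) (tet V ×ˢ tet V') := by
  rw [(integral_tet_prod hV hV' _).1, (integral_simplex_prod_eq_cube c fun z =>
    kernelIntegrand P K (point V z.1) (point V' z.2)).1]
  intro d
  have hx : Continuous fun t => point V (duffyCell c d t).1 :=
    (continuous_point V).comp (continuous_fst.comp (continuous_duffyCell c d))
  have hx' : Continuous fun t => point V' (duffyCell c d t).2 :=
    (continuous_point V').comp (continuous_snd.comp (continuous_duffyCell c d))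
  have hr : ∀ t ∈ cube 6, ‖point V (duffyCell c d t).1 - point V' (duffyCell c d t).2‖ =
      t 0 * xdist c V V' d (duffyArg c t) := by
    intro t ht
    rw [(duffyCell_eq c d t).2]
    exact pairDist_smul hcommon (mem_cube.1 ht 0).1.le (duffyCell_kept c d t)
  have hcube : cube 6 ⊆ Icc 0 1 := fun t ht =>
    ⟨fun i => (mem_cube.1 ht i).1.le, fun i => (mem_cube.1 ht i).2.le⟩
  have harg : ∀ t ∈ Icc (0 : Fin 6 → ℝ) 1, duffyArg c t ∈ Icc (0 : Fin c.dimY → ℝ) 1 :=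
    fun t ht => ⟨fun i => ht.1 _, fun i => ht.2 _⟩
  have hpos : ∀ t ∈ cube 6, 0 < t 0 * xdist c V V' d (duffyArg c t) := fun t ht =>
    mul_pos (mem_cube.1 ht 0).1 (xdist_pos hV hV' hcommon hmeet d (harg t (hcube ht)))
  have hc : IsCompact (Icc (0 : Fin 6 → ℝ) 1) := isCompact_Icc
  obtain ⟨R₁, hR₁⟩ := hc.exists_bound_of_continuousOn hx.continuousOn
  obtain ⟨R₂, hR₂⟩ := hc.exists_bound_of_continuousOn (hx'.sub hx).continuousOn
  obtain ⟨B, hB⟩ := hc.exists_bound_of_continuousOn (f := fun t =>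
    (duffy c d (duffyArg c t)).jac * freeJac c t) (((continuous_duffy_jac c d).comp
    (continuous_duffyArg c)).mul (continuous_freeJac c)).continuousOn
  -- The positive minimum `X` of the distance factor gives `w ≤ r / X`, which converts the `w ^ Y`
  -- of the Jacobian into a power of `r`.
  obtain ⟨y₀, hy₀, hmin⟩ := (isCompact_Icc (a := (0 : Fin c.dimY → ℝ)) (b := 1)).exists_isMinOn
    ⟨0, le_rfl, zero_le_one⟩ (continuous_xdist c V V' d).continuousOn
  have hX := xdist_pos hV hV' hcommon hmeet d hy₀
  set X := xdist c V V' d y₀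
  obtain ⟨C, hC0, hC⟩ := hP.exists_bound (max R₁ R₂)
  obtain ⟨C', hC0', hC'⟩ := exists_bound_kernel hK hO hq R₂
  refine IntegrableOn.of_bound ?_ ?_ (B * C * C' / X ^ c.dimY) ?_
  · rw [measure_congr (cube_ae_eq 6)]
    exact hc.measure_lt_top
  · refine ContinuousOn.aestronglyMeasurable ?_ (isOpen_cube 6).measurableSet
    refine (continuous_duffyCellJac c d).continuousOn.smul (ContinuousOn.mul ?_ ?_)
    · exact ((continuous_polyEval P).comp (hx.prodMk hx')).continuousOn
    · refine hK.comp (hx.sub hx').norm.continuousOn fun t ht => ?_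
      rw [hr t ht]
      exact hpos t ht
  · rw [ae_restrict_iff' (isOpen_cube 6).measurableSet]
    refine ae_of_all _ fun t ht => ?_
    have ht' := hcube ht
    set r := t 0 * xdist c V V' d (duffyArg c t) with hrdef
    have hrpos : 0 < r := hpos t ht
    set x := point V (duffyCell c d t).1
    set x' := point V' (duffyCell c d t).2
    have hxr : ‖x' - x‖ = r := by rw [norm_sub_rev, hr t ht]
    have hrR : r ≤ R₂ := hxr ▸ hR₂ t ht'
    have hP1 : ‖polyEval P x x'‖ ≤ C * r ^ m := by
      have := hC x (x' - x) ((hR₁ t ht').trans (le_max_left _ _))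
        ((hxr ▸ hrR).trans (le_max_right _ _))
      rwa [add_sub_cancel, hxr] at this
    have hK1 := hC' r hrpos hrR
    have hw : t 0 ^ c.dimY ≤ r ^ c.dimY / X ^ c.dimY := by
      rw [← div_pow]
      refine pow_le_pow_left₀ (mem_cube.1 ht 0).1.le ?_ _
      rw [le_div_iff₀ hX]
      exact mul_le_mul_of_nonneg_left (hmin (harg t ht')) (mem_cube.1 ht 0).1.le
    have hJ : ‖duffyCellJac c d t‖ ≤ r ^ c.dimY / X ^ c.dimY * B := by
      rw [duffyCellJac_eq, mul_assoc, norm_mul, Real.norm_of_nonneg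
        (pow_nonneg (mem_cube.1 ht 0).1.le _)]
      exact mul_le_mul hw (hB t ht') (norm_nonneg _) (by positivity)
    have hB0 : 0 ≤ B := (norm_nonneg _).trans (hB t ht')
    rw [norm_smul, kernelIntegrand, norm_mul, hr t ht]
    calc ‖duffyCellJac c d t‖ * (‖polyEval P x x'‖ * ‖K r‖)
        ≤ (r ^ c.dimY / X ^ c.dimY * B) * ((C * r ^ m) * ‖K r‖) := by gcongr
      _ = B * C * (‖K r‖ * r ^ (c.dimY + m)) / X ^ c.dimY := by
        rw [pow_add]
        ring
      _ ≤ B * C * C' / X ^ c.dimY := by gcongr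

/-- Terms with `n < m` vanish identically; for the others `q ≤ n + Y`, so the first integral is
continuous at the positive values of `X_d`. -/
theorem continuousOn_reducedIntegrand (hV : AffineIndependent ℝ V)
    (hV' : AffineIndependent ℝ V')
    (hcommon : ∀ i : Fin 4, (i : ℕ) < c.numCV → V i = V' i) (hmeet : MeetInCommonSimplex c V V')
    {P : MvPolynomial (Fin 3 ⊕ Fin 3) ℂ} {K : ℝ → ℂ} {q : ℝ} {m : ℕ} (hK : ContinuousOn K (Ioi 0))
    (hO : K =O[𝓝[>] 0] fun r : ℝ => r ^ (-q)) (hP : VanishesOnDiagonal P m)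
    (hq : q ≤ ((c.dimY + m : ℕ) : ℝ)) :
    ContinuousOn (reducedIntegrand c P K V V') (Icc 0 1) := by
  refine continuousOn_finsetSum _ fun d _ => ContinuousOn.mul
    (Complex.continuous_ofReal.comp (continuous_duffy_jac c d)).continuousOn
    (continuousOn_finsetSum _ fun n _ => ?_)
  rcases lt_or_ge n m with hn | hn
  · simp only [pcoeff_eq_zero hcommon hP d hn, zero_mul]
    exact continuousOn_const
  · refine ContinuousOn.mul
      (continuous_of_mem_polyFun ((pbarDuffy_eq_sum c P V V' d).1 n)).continuousOn ?_
    have hp : q ≤ ((n + c.dimY : ℕ) : ℝ) := hq.trans (by exact_mod_cast (by omega))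
    exact (firstIntegral_regular hK hO hp).2.comp (continuous_xdist c V V' d).continuousOn
      fun y hy => xdist_pos hV hV' hcommon hmeet d hy

end Common

end TaylorDuffy

theorem mainTheorem1 (c : CommonCase) (V V' : Fin 4 → E3)
    (hV : AffineIndependent ℝ V) (hV' : AffineIndependent ℝ V')
    (hcommon : ∀ i : Fin 4, (i : ℕ) < c.numCV → V i = V' i)
    (P : MvPolynomial (Fin 3 ⊕ Fin 3) ℂ) (K : ℝ → ℂ) :
    -- the coefficients are polynomials in `y`, and the expansion in powers of `w` is finite
    (∀ (d : Fin 18) (n : ℕ), ∃ Q : MvPolynomial (Fin c.dimY) ℂ, ∀ y : Fin c.dimY → ℝ,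
      pcoeff c P V V' d n y = MvPolynomial.eval (fun i => (y i : ℂ)) Q) ∧
    (∀ (d : Fin 18) (y : Fin c.dimY → ℝ) (w : ℝ),
      pbarDuffy c P V V' d y w =
        ∑ n ∈ Finset.range (numTerms c P), pcoeff c P V V' d n y * (w : ℂ) ^ n) ∧
    -- the distance is `w * X_d(y)`, whatever the values of the `ξ` that were integrated out
    (∀ (d : Fin 18) (y : Fin c.dimY → ℝ) (w : ℝ), 0 ≤ w → ∀ ξ : Fin 3 → ℝ,
      (∀ i ∈ kept c, ξ i = w * (duffy c d y).xi i) →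
      pairDist V V' ξ (w • (duffy c d y).u) = w * xdist c V V' d y) ∧
    -- the reduction formula
    (LocallyIntegrableOn K (Ioi 0) →
      IntegrableOn (fun z : E3 × E3 => kernelIntegrand P K z.1 z.2) (tet V ×ˢ tet V') →
      IntegrableOn (reducedIntegrand c P K V V') (Icc 0 1) ∧
      ∫ x in tet V, ∫ x' in tet V', kernelIntegrand P K x x' =
        ((36 * volume.real (tet V) * volume.real (tet V') : ℝ) : ℂ) *
          ∫ y in Icc (0 : Fin c.dimY → ℝ) 1, reducedIntegrand c P K V V' y) ∧
    -- if `P` vanishes to order `m` at `x = x'`, the sum over `n` begins at `m`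
    (∀ m : ℕ, VanishesOnDiagonal P m →
      ∀ (d : Fin 18) (n : ℕ), n < m → ∀ y : Fin c.dimY → ℝ, pcoeff c P V V' d n y = 0) ∧
    -- existence and regularity of the first integrals
    (∀ q : ℝ, ContinuousOn K (Ioi 0) → K =O[𝓝[>] 0] (fun r : ℝ => r ^ (-q)) →
      ∀ p : ℕ, q ≤ p →
        (∀ X : ℝ, 0 < X →
          IntervalIntegrable (fun w : ℝ => ((w ^ p : ℝ) : ℂ) * K (w * X)) volume 0 1) ∧
        ContinuousOn (firstIntegral K p) (Ioi 0)) ∧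
    -- tetrahedra that meet only in their common simplex: `X_d` does not vanish, and kernels
    -- with a singularity of degree `q ≤ Y + m` are desingularized
    (MeetInCommonSimplex c V V' →
      (∀ (d : Fin 18), ∀ y ∈ Icc (0 : Fin c.dimY → ℝ) 1, 0 < xdist c V V' d y) ∧
      (∀ (q : ℝ) (m : ℕ), ContinuousOn K (Ioi 0) →
        K =O[𝓝[>] 0] (fun r : ℝ => r ^ (-q)) → VanishesOnDiagonal P m →
        q ≤ ((c.dimY + m : ℕ) : ℝ) →
        IntegrableOn (fun z : E3 × E3 => kernelIntegrand P K z.1 z.2) (tet V ×ˢ tet V') ∧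
        ContinuousOn (reducedIntegrand c P K V V') (Icc 0 1))) := by
  refine ⟨fun d n => mem_polyFun.1 ((pbarDuffy_eq_sum c P V V' d).1 n),
    fun d => (pbarDuffy_eq_sum c P V V' d).2,
    fun d y w hw ξ hξ => pairDist_smul hcommon hw hξ,
    fun hK hint => reduction_formula hV hV' hcommon P hK hint,
    fun m hP d n hn y => pcoeff_eq_zero hcommon hP d hn y,
    fun q hK hO p hp => firstIntegral_regular hK hO hp,
    fun hmeet => ⟨fun d y hy => xdist_pos hV hV' hcommon hmeet d hy, fun q m hK hO hP hq =>
      ⟨integrableOn_kernelIntegrand hV hV' hcommon hmeet hK hO hP hq,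
        continuousOn_reducedIntegrand hV hV' hcommon hmeet hK hO hP hq⟩⟩⟩
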